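/- Let $X$ be a complex Banach space. For a closed linear operator $D$ on $X$ with domain $\operatorname{dom}D$ let $R(\lambda,D)=(\lambda-D)^{-1}$ denote its resolvent. For $\theta\in(0,1)$ and $1\le p\le\infty$ let $$K(t,x)=\inf_{b\in \operatorname{dom}D}\bigl(\|x-b\|+t(\|b\|+\|Db\|)\bigr),\qquad t>0,\ x\in X,$$ and let $\mathsf D_D(\theta,p)=(X,\operatorname{dom}D)_{\theta,p}$ be the space of all $x\in X$ with $t^{-\theta}K(t,x)\in L^p((0,\infty),dt/t)$, normed by $\|t^{-\theta}K(t,x)\|_{L^p((0,\infty),dt/t)}$. Let $\mathsf D_D(\theta)=(X,\operatorname{dom}D)_\theta$ be the subspace of $\mathsf D_D(\theta,\infty)$, with the induced norm, of all $x$ with $\lim_{t\to0+}t^{-\theta}K(t,x)=0$. For $\varphi\in(0,\pi)$ put $\Sigma_\varphi=\{\lambda\in\mathbb C:|\arg\lambda|\le\varphi\}\cup\{0\}$, and let $\Sigma_\varphi^\circ$ be its interior. The operator $D$ is called sectorial of angle $\varphi$ if $\sigma(D)\subseteq\Sigma_\varphi$ and $\sup_{\lambda\notin\Sigma_{\varphi'}}\|\lambda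 R(\lambda,D)\|<\infty$ for every $\varphi'\in(\varphi,\pi)$. Products of operators have their natural domains, and $A$ commutes with an invertible operator $D$ if $AD\subseteq DA$. **Theorem.** Let $A$, $B$ and $D$ be closed linear operators on $X$ such that both $A$ and $B$ commute with $D$. Assume that (a) $D$ is invertible (with $D^{-1}\in\mathcal L(X)$) and sectorial of angle $\varphi_1\in(0,\pi)$; (b) there is $\varphi_2\in(\varphi_1,\pi)$ such that the inverse $H(\lambda)=(\lambda^2+\lambda B+A)^{-1}$ of the operator $\lambda^2+\lambda B+A$ with domain $\operatorname{dom}B\cap\operatorname{dom}A$ exists in $\mathcal L(X)$ for every $\lambda\in\Sigma_{\varphi_2}\setminus\{0\}$; (c) $H$ is bounded on $\Sigma_{\varphi_2}\setminus\{0\}$ and holomorphic in $\Sigma_{\varphi_2}^\circ$, with values in $\mathcal L(X)$; (d) the functions $\lambda\mapsto\lambda^2H(\lambda)$, $\lambda\mapsto\lambda BH(\lambda)$ and $\lambda\mapsto AH(\lambda)$ are uniformly bounded on $\Sigma_{\varphi_2}\setminus\{0\}$ with values in $\mathcal L(X)$. Then for every $\theta\in(0,1)$ and every $1\le p\le\infty$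 the operator $L_{\theta,p}$ on $\mathsf D_D(\theta,p)$ given by $$\operatorname{dom}L_{\theta,p}=\{x\in\operatorname{dom}D^2\cap\operatorname{dom}BD\cap\operatorname{dom}A: D^2x,\,BDx,\,Ax\in\mathsf D_D(\theta,p)\},\qquad L_{\theta,p}x=D^2x+BDx+Ax,$$ is closed and boundedly invertible. More precisely, let $\varphi'\in(\varphi_1,\varphi_2)$, and let $\Gamma$ be a piecewise $C^1$ path in $\Sigma_{\varphi_2}^\circ$ that comes from $e^{i\varphi'}\infty$ along the ray $e^{i\varphi'}(0,\infty)$, ends in $e^{-i\varphi'}\infty$ along the ray $e^{-i\varphi'}(0,\infty)$, and surrounds $\sigma(D)$ in the sense that for some $\varepsilon>0$ the disc $\{|\lambda|<\varepsilon\}$ is contained in the resolvent set of $D$ and $\Gamma$ does not meet $\{\lambda\in\Sigma_{\varphi_1}:|\lambda|\ge\varepsilon\}$. Then for every $x\in X$ the integral $$Sx=\frac1{2\pi i}\int_\Gamma R(\lambda,D)H(\lambda)x\,d\lambda$$ converges absolutely, and $S\in\mathcal L(X)$. The operator $S$ is a left inverse of $D^2+BD+A$ in $X$, that is, $S(D^2+BD+A)x=x$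 for every $x\in\operatorname{dom}D^2\cap\operatorname{dom}BD\cap\operatorname{dom}A$. Moreover, for every $\theta\in(0,1)$ and $1\le p\le\infty$ and every $x\in\mathsf D_D(\theta,p)$ one has $$Sx\in\operatorname{dom}D^2\cap\operatorname{dom}BD\cap\operatorname{dom}A,\qquad D^2Sx,\ BDSx,\ ASx\in\mathsf D_D(\theta,p),\qquad L_{\theta,p}Sx=(D^2+BD+A)Sx=x,$$ and $S$ restricted to $\mathsf D_D(\theta,p)$ is the bounded inverse of $L_{\theta,p}$. All these assertions also hold for every $\theta\in(0,1)$ with $\mathsf D_D(\theta)$ in place of $\mathsf D_D(\theta,p)$ and the analogously defined operator $L_\theta$ in place of $L_{\theta,p}$. -/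

import Mathlib

open Set Filter Topology MeasureTheory
open scoped ENNReal

namespace OpSum

noncomputable section

/-! ### Unbounded operators -/

section Operators

variable {E : Type*} [NormedAddCommGroup E] [NormedSpace ℂ E]

/-- The composition `g f` of two unbounded operators with its natural domain
`{x ∈ dom f : f x ∈ dom g}`. -/
def natComp (g f : E →ₗ.[ℂ] E) : E →ₗ.[ℂ] E where
  domain :=
    { carrier := {x | ∃ h : x ∈ f.domain, f ⟨x, h⟩ ∈ g.domain}
      add_mem' := by
        rintro a b ⟨ha, ha'⟩ ⟨hb, hb'⟩
        refine ⟨f.domain.add_mem ha hb, ?_⟩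
        have h := g.domain.add_mem ha' hb'
        rwa [← f.map_add] at h
      zero_mem' := by
        refine ⟨f.domain.zero_mem, ?_⟩
        have h := g.domain.zero_mem
        rwa [← f.map_zero] at h
      smul_mem' := by
        rintro c a ⟨ha, ha'⟩
        refine ⟨f.domain.smul_mem c ha, ?_⟩
        have h := g.domain.smul_mem c ha'
        rwa [← f.map_smul] at h }
  toFun :=
    { toFun := fun x => g ⟨f ⟨x.1, x.2.1⟩, x.2.2⟩
      map_add' := by
        rintro ⟨a, ha⟩ ⟨b, hb⟩
        rw [← g.map_add]
        congr 1
        apply Subtype.ext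
        exact f.map_add ⟨a, ha.1⟩ ⟨b, hb.1⟩
      map_smul' := by
        rintro c ⟨a, ha⟩
        rw [RingHom.id_apply, ← g.map_smul]
        congr 1
        apply Subtype.ext
        exact f.map_smul c ⟨a, ha.1⟩ }

/-- `A` commutes with `D`: `AD ⊆ DA` (compositions with natural domains). -/
def CommutesWith (A D : E →ₗ.[ℂ] E) : Prop := natComp A D ≤ natComp D A

/-- The bounded operator `S` is the (two-sided) inverse of the unbounded operator `T`. -/
def IsBoundedInverse (T : E →ₗ.[ℂ] E) (S : E →L[ℂ] E) : Prop :=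
  (∀ x : T.domain, S (T x) = x) ∧ ∀ y : E, ∃ h : S y ∈ T.domain, T ⟨S y, h⟩ = y

/-- `T` is boundedly invertible: `T⁻¹` exists in `ℒ(E)`. -/
def BoundedlyInvertible (T : E →ₗ.[ℂ] E) : Prop := ∃ S : E →L[ℂ] E, IsBoundedInverse T S

open Classical in
/-- The inverse `T⁻¹ ∈ ℒ(E)` (which is unique), and `0` if `T` is not boundedly invertible. -/
def boundedInverse (T : E →ₗ.[ℂ] E) : E →L[ℂ] E :=
  if h : BoundedlyInvertible T then h.choose else 0

/-- The operator `z - D` with domain `dom D`. -/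
def shifted (D : E →ₗ.[ℂ] E) (z : ℂ) : E →ₗ.[ℂ] E :=
  (z • (LinearMap.id : E →ₗ[ℂ] E)) +ᵥ (-D)

/-- The resolvent set of `D`. -/
def resSet (D : E →ₗ.[ℂ] E) : Set ℂ := {z | BoundedlyInvertible (shifted D z)}

/-- The spectrum of `D`. -/
def opSpectrum (D : E →ₗ.[ℂ] E) : Set ℂ := (resSet D)ᶜ

/-- The resolvent `R(z, D) = (z - D)⁻¹`. -/
def res (D : E →ₗ.[ℂ] E) (z : ℂ) : E →L[ℂ] E := boundedInverse (shifted D z)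

/-- The closed sector `{z : |arg z| ≤ φ} ∪ {0}`. -/
def sector (φ : ℝ) : Set ℂ := {z | |z.arg| ≤ φ} ∪ {0}

/-- The interior `{z ≠ 0 : |arg z| < φ}` of `sector φ`, for `0 < φ < π`. -/
def openSector (φ : ℝ) : Set ℂ := {z | z ≠ 0 ∧ |z.arg| < φ}

/-- `D` is sectorial of angle `φ`. -/
def IsSectorial (D : E →ₗ.[ℂ] E) (φ : ℝ) : Prop :=
  opSpectrum D ⊆ sector φ ∧
    ∀ φ' ∈ Ioo φ Real.pi, ∃ C : ℝ, ∀ z ∉ sector φ', ‖z • res D z‖ ≤ C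

/-- The operator `z² + z B + A` with domain `dom B ∩ dom A`. -/
def pencil (A B : E →ₗ.[ℂ] E) (z : ℂ) : E →ₗ.[ℂ] E :=
  (z ^ 2 • (LinearMap.id : E →ₗ[ℂ] E)) +ᵥ (z • B + A)

/-- `H(z) = (z² + z B + A)⁻¹`. -/
def pencilInv (A B : E →ₗ.[ℂ] E) (z : ℂ) : E →L[ℂ] E := boundedInverse (pencil A B z)

/-- The family of operators `G z`, `z ∈ s`, composed with `T` on the left, is a uniformly bounded
family in `ℒ(E)` after multiplication by `c z`: each `T (G z)` is everywhere defined, and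
`‖c z T (G z)‖ ≤ C` for all `z ∈ s`. -/
def UnifBdd (s : Set ℂ) (c : ℂ → ℂ) (T : E →ₗ.[ℂ] E) (G : ℂ → E →L[ℂ] E) : Prop :=
  ∃ C : ℝ, ∀ z ∈ s, ∀ x : E, ∃ h : G z x ∈ T.domain, ‖c z • T ⟨G z x, h⟩‖ ≤ C * ‖x‖

/-- The operator `D² + BD + A` with its natural domain `dom D² ∩ dom BD ∩ dom A`. -/
def sumOp (A B D : E →ₗ.[ℂ] E) : E →ₗ.[ℂ] E := natComp D D + natComp B D + A

/-- The part of an operator `T` on `E` in a space `F` that is embedded in `E` by `ι`: its domain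
consists of the `u ∈ F` with `u ∈ dom T` and `T u ∈ F`. -/
def partIn {F : Type*} [AddCommGroup F] [Module ℂ F] (ι : F →ₗ[ℂ] E)
    (hι : Function.Injective ι) (T : E →ₗ.[ℂ] E) : F →ₗ.[ℂ] F where
  domain :=
    { carrier := {u | ∃ h : ι u ∈ T.domain, T ⟨ι u, h⟩ ∈ LinearMap.range ι}
      add_mem' := by
        rintro a b ⟨ha, ha'⟩ ⟨hb, hb'⟩
        have hab : ι (a + b) ∈ T.domain := by
          rw [map_add]; exact T.domain.add_mem ha hb
        refine ⟨hab, ?_⟩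
        have h := (LinearMap.range ι).add_mem ha' hb'
        rw [← T.map_add] at h
        convert h using 2
        exact Subtype.ext (map_add ι a b)
      zero_mem' := by
        have h0 : ι 0 ∈ T.domain := by rw [map_zero]; exact T.domain.zero_mem
        refine ⟨h0, ?_⟩
        have h := (LinearMap.range ι).zero_mem
        rw [← T.map_zero] at h
        convert h using 2
        exact Subtype.ext (map_zero ι)
      smul_mem' := by
        rintro c a ⟨ha, ha'⟩
        have hca : ι (c • a) ∈ T.domain := by
          rw [map_smul]; exact T.domain.smul_mem c ha
        refine ⟨hca, ?_⟩
        have h := (LinearMap.range ι).smul_mem c ha'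
        rw [← T.map_smul] at h
        convert h using 2
        exact Subtype.ext (map_smul ι c a) }
  toFun :=
    { toFun := fun u => (LinearEquiv.ofInjective ι hι).symm ⟨T ⟨ι u.1, u.2.1⟩, u.2.2⟩
      map_add' := by
        rintro ⟨a, ha⟩ ⟨b, hb⟩
        rw [← map_add]
        congr 1
        apply Subtype.ext
        refine Eq.trans ?_ (T.map_add ⟨ι a, ha.1⟩ ⟨ι b, hb.1⟩)
        exact congrArg T (Subtype.ext (map_add ι a b))
      map_smul' := by
        rintro c ⟨a, ha⟩
        rw [RingHom.id_apply, ← map_smul]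
        congr 1
        apply Subtype.ext
        refine Eq.trans ?_ (T.map_smul c ⟨ι a, ha.1⟩)
        exact congrArg T (Subtype.ext (map_smul ι c a)) }

/-- Defining property of the part: `ι (T_F u) = T (ι u)`. -/
theorem partIn_apply {F : Type*} [AddCommGroup F] [Module ℂ F] (ι : F →ₗ[ℂ] E)
    (hι : Function.Injective ι) (T : E →ₗ.[ℂ] E) (u : (partIn ι hι T).domain) :
    ι (partIn ι hι T u) = T ⟨ι u.1, u.2.1⟩ := by
  have h := (LinearEquiv.ofInjective ι hι).apply_symm_apply ⟨T ⟨ι u.1, u.2.1⟩, u.2.2⟩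
  exact congrArg Subtype.val h

/-- The operator `u ↦ D² u + B D u + A u` on a space `F` embedded in `E` by `ι`, with domain
`{u ∈ dom D² ∩ dom BD ∩ dom A : D² u, B D u, A u ∈ F}`. -/
def sumOpIn {F : Type*} [AddCommGroup F] [Module ℂ F] (ι : F →ₗ[ℂ] E)
    (hι : Function.Injective ι) (A B D : E →ₗ.[ℂ] E) : F →ₗ.[ℂ] F :=
  partIn ι hι (natComp D D) + partIn ι hι (natComp B D) + partIn ι hι A

end Operators

/-! ### Real interpolation spaces between `X` and `dom D` (K-method) -/

section Interpolation

variable {X : Type*} [NormedAddCommGroup X] [NormedSpace ℂ X]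

/-- The K-functional of the couple `(X, dom D)`, where `dom D` carries the graph norm
`‖b‖ + ‖D b‖`. It is used for `t > 0` only. -/
def kFun (D : X →ₗ.[ℂ] X) (t : ℝ) (x : X) : ℝ :=
  ⨅ b : D.domain, (‖x - (b : X)‖ + t * (‖(b : X)‖ + ‖D b‖))

/-- The measure `dt / t` on `(0, ∞)`. -/
def haarPos : Measure ℝ :=
  (volume.restrict (Ioi (0 : ℝ))).withDensity (fun t => ENNReal.ofReal t⁻¹)

/-- The function `t ↦ t ^ (-θ) K(t, x)`. -/
def kWeighted (D : X →ₗ.[ℂ] X) (θ : ℝ) (x : X) (t : ℝ) : ℝ := t ^ (-θ) * kFun D t x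

variable (D : X →ₗ.[ℂ] X)

lemma kFun_bdd {t : ℝ} (ht : 0 < t) (x : X) :
    BddBelow (range fun b : D.domain => ‖x - (b : X)‖ + t * (‖(b : X)‖ + ‖D b‖)) :=
  ⟨0, by rintro _ ⟨b, rfl⟩; positivity⟩

lemma kFun_nonneg {t : ℝ} (ht : 0 < t) (x : X) : 0 ≤ kFun D t x :=
  le_ciInf fun b => by positivity

lemma kFun_add_le {t : ℝ} (ht : 0 < t) (x y : X) :
    kFun D t (x + y) ≤ kFun D t x + kFun D t y := by
  refine le_ciInf_add_ciInf fun a b => ?_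
  refine (ciInf_le (kFun_bdd D ht (x + y)) (a + b)).trans ?_
  have h1 : ‖x + y - ((a + b : D.domain) : X)‖ ≤ ‖x - (a : X)‖ + ‖y - (b : X)‖ := by
    have : x + y - ((a + b : D.domain) : X) = (x - a) + (y - b) := by
      push_cast; abel
    rw [this]; exact norm_add_le _ _
  have h2 : ‖((a + b : D.domain) : X)‖ ≤ ‖(a : X)‖ + ‖(b : X)‖ := by
    push_cast; exact norm_add_le _ _
  have h3 : ‖D (a + b)‖ ≤ ‖D a‖ + ‖D b‖ := by
    rw [D.map_add]; exact norm_add_le _ _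
  have h4 : t * (‖((a + b : D.domain) : X)‖ + ‖D (a + b)‖)
      ≤ t * ((‖(a : X)‖ + ‖(b : X)‖) + (‖D a‖ + ‖D b‖)) := by gcongr
  linarith

lemma kFun_smul_le {t : ℝ} (ht : 0 < t) (c : ℂ) (x : X) :
    kFun D t (c • x) ≤ ‖c‖ * kFun D t x := by
  unfold kFun
  rw [Real.mul_iInf_of_nonneg (norm_nonneg c)]
  refine le_ciInf fun b => ?_
  refine (ciInf_le (kFun_bdd D ht (c • x)) (c • b)).trans (le_of_eq ?_)
  rw [D.map_smul, Submodule.coe_smul, ← smul_sub, norm_smul, norm_smul, norm_smul]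
  ring

lemma kFun_lower {t : ℝ} (ht : 0 < t) (x : X) : min 1 t * ‖x‖ ≤ kFun D t x := by
  refine le_ciInf fun b => ?_
  have h1 : ‖x‖ ≤ ‖x - (b : X)‖ + ‖(b : X)‖ := by
    simpa using norm_add_le (x - (b : X)) b
  have hm : 0 ≤ min 1 t := le_min zero_le_one ht.le
  calc min 1 t * ‖x‖ ≤ min 1 t * ‖x - (b : X)‖ + min 1 t * ‖(b : X)‖ := by
        rw [← mul_add]; gcongr
    _ ≤ 1 * ‖x - (b : X)‖ + t * ‖(b : X)‖ := by
        gcongr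
        · exact min_le_left _ _
        · exact min_le_right _ _
    _ ≤ _ := by
        rw [one_mul]
        gcongr
        exact le_add_of_nonneg_right (norm_nonneg _)

lemma kFun_mono (x : X) : MonotoneOn (fun t => kFun D t x) (Ioi 0) := by
  intro s hs t _ hst
  refine le_ciInf fun b => (ciInf_le (kFun_bdd D hs x) b).trans ?_
  gcongr

lemma ae_haarPos_pos : ∀ᵐ t ∂haarPos, 0 < t :=
  (withDensity_absolutelyContinuous _ _).ae_le (ae_restrict_mem measurableSet_Ioi)

lemma kWeighted_aesm (θ : ℝ) (x : X) : AEStronglyMeasurable (kWeighted D θ x) haarPos := by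
  have h1 : AEMeasurable (fun t => kFun D t x) (volume.restrict (Ioi (0 : ℝ))) :=
    aemeasurable_restrict_of_monotoneOn measurableSet_Ioi (kFun_mono D x)
  have h2 : AEMeasurable (fun t => kFun D t x) haarPos :=
    h1.mono_ac (withDensity_absolutelyContinuous _ _)
  have h3 : Measurable fun t : ℝ => t ^ (-θ) := by fun_prop
  exact (h3.aemeasurable.mul h2).aestronglyMeasurable

lemma kWeighted_add_le (θ : ℝ) (x y : X) :
    ∀ᵐ t ∂haarPos, ‖kWeighted D θ (x + y) t‖ ≤ ‖(kWeighted D θ x + kWeighted D θ y) t‖ := by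
  filter_upwards [ae_haarPos_pos] with t ht
  have hw : 0 ≤ t ^ (-θ) := Real.rpow_nonneg ht.le _
  have hx := kFun_nonneg D ht x
  have hy := kFun_nonneg D ht y
  have hxy := kFun_nonneg D ht (x + y)
  simp only [kWeighted, Pi.add_apply]
  rw [Real.norm_of_nonneg (by positivity), Real.norm_of_nonneg (by positivity), ← mul_add]
  gcongr
  exact kFun_add_le D ht x y

lemma kWeighted_smul_le (θ : ℝ) (c : ℂ) (x : X) :
    ∀ᵐ t ∂haarPos, ‖kWeighted D θ (c • x) t‖ ≤ ‖(‖c‖ • kWeighted D θ x) t‖ := by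
  filter_upwards [ae_haarPos_pos] with t ht
  have hw : 0 ≤ t ^ (-θ) := Real.rpow_nonneg ht.le _
  have hx := kFun_nonneg D ht x
  have hcx := kFun_nonneg D ht (c • x)
  simp only [kWeighted, Pi.smul_apply, smul_eq_mul]
  rw [Real.norm_of_nonneg (by positivity), Real.norm_of_nonneg (by positivity), mul_left_comm]
  gcongr
  exact kFun_smul_le D ht c x

lemma kWeighted_zero (θ : ℝ) : kWeighted D θ 0 =ᵐ[haarPos] 0 := by
  filter_upwards [ae_haarPos_pos] with t ht
  have h : kFun D t 0 ≤ 0 := by simpa using kFun_smul_le D ht 0 0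
  simp [kWeighted, le_antisymm h (kFun_nonneg D ht 0)]

/-- The real interpolation space `(X, dom D)_{θ,p}` as a linear subspace of `X`: all `x` with
`t ^ (-θ) K(t, x) ∈ L^p((0, ∞), dt/t)`. -/
def interpSubmodule (θ : ℝ) (p : ℝ≥0∞) : Submodule ℂ X where
  carrier := {x | MemLp (kWeighted D θ x) p haarPos}
  add_mem' := fun {x y} hx hy =>
    (MemLp.add hx hy).mono (kWeighted_aesm D θ (x + y)) (kWeighted_add_le D θ x y)
  zero_mem' := (memLp_congr_ae (kWeighted_zero D θ)).2 MemLp.zero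
  smul_mem' := fun c x hx =>
    (MemLp.const_smul hx ‖c‖).mono (kWeighted_aesm D θ (c • x)) (kWeighted_smul_le D θ c x)

/-- The real interpolation space `D_D(θ, p) = (X, dom D)_{θ,p}`, to be normed by its own norm (not
by that of `X`). -/
def InterpSpace (θ : ℝ) (p : ℝ≥0∞) : Type _ := interpSubmodule D θ p

instance (θ : ℝ) (p : ℝ≥0∞) : AddCommGroup (InterpSpace D θ p) :=
  inferInstanceAs (AddCommGroup (interpSubmodule D θ p))

instance (θ : ℝ) (p : ℝ≥0∞) : Module ℂ (InterpSpace D θ p) :=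
  inferInstanceAs (Module ℂ (interpSubmodule D θ p))

/-- The inclusion of `D_D(θ, p)` in `X`. -/
def InterpSpace.incl (θ : ℝ) (p : ℝ≥0∞) : InterpSpace D θ p →ₗ[ℂ] X :=
  (interpSubmodule D θ p).subtype

lemma InterpSpace.incl_injective (θ : ℝ) (p : ℝ≥0∞) :
    Function.Injective (InterpSpace.incl D θ p) :=
  (interpSubmodule D θ p).subtype_injective

lemma InterpSpace.memLp {θ : ℝ} {p : ℝ≥0∞} (u : InterpSpace D θ p) :
    MemLp (kWeighted D θ (InterpSpace.incl D θ p u)) p haarPos := u.2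

/-- The norm `‖t ^ (-θ) K(t, u)‖` in `L^p((0, ∞), dt/t)`. -/
def interpNorm (θ : ℝ) (p : ℝ≥0∞) (u : InterpSpace D θ p) : ℝ :=
  (eLpNorm (kWeighted D θ (InterpSpace.incl D θ p u)) p haarPos).toReal

lemma interpNorm_smul_le (θ : ℝ) (p : ℝ≥0∞) (c : ℂ) (u : InterpSpace D θ p) :
    interpNorm D θ p (c • u) ≤ ‖c‖ * interpNorm D θ p u := by
  have h := eLpNorm_mono_ae (p := p)
    (kWeighted_smul_le D θ c (InterpSpace.incl D θ p u))
  rw [eLpNorm_const_smul] at h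
  have h' := ENNReal.toReal_mono
    (ENNReal.mul_ne_top (by simp) (InterpSpace.memLp D u).eLpNorm_ne_top) h
  rw [ENNReal.toReal_mul] at h'
  simpa [interpNorm] using h'

lemma eq_zero_of_kWeighted (θ : ℝ) (x : X) (h : kWeighted D θ x =ᵐ[haarPos] 0) : x = 0 := by
  have h1 : ∀ᵐ t ∂haarPos, t ∈ Ioi (0 : ℝ) → x = 0 := by
    filter_upwards [h] with t ht htp
    have htp' : (0 : ℝ) < t := htp
    have hk : kFun D t x = 0 := by
      have : t ^ (-θ) * kFun D t x = 0 := ht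
      exact (mul_eq_zero.1 this).resolve_left (Real.rpow_pos_of_pos htp' _).ne'
    have hl := kFun_lower D htp' x
    rw [hk] at hl
    have hm : 0 < min 1 t := lt_min one_pos htp'
    by_contra hx
    have := mul_pos hm (norm_pos_iff.2 hx)
    linarith
  by_contra hx
  have h2 : ∀ᵐ t ∂haarPos, False := by
    filter_upwards [h1, ae_haarPos_pos] with t ht htp using hx (ht htp)
  have h3 : ∀ᵐ t ∂(volume.restrict (Ioi (0 : ℝ))), ENNReal.ofReal t⁻¹ ≠ 0 → False :=
    (ae_withDensity_iff (by fun_prop)).1 h2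
  have h4 : ∀ᵐ t ∂(volume.restrict (Ioi (0 : ℝ))), False := by
    filter_upwards [h3, ae_restrict_mem measurableSet_Ioi] with t ht htp
    refine ht ?_
    have : (0 : ℝ) < t⁻¹ := inv_pos.2 htp
    simpa using this
  have h5 : volume (Ioi (0 : ℝ)) = 0 := by
    have h6 := ae_iff.1 h4
    simpa only [not_false_eq_true, ofPred_true, Measure.restrict_apply_univ] using h6
  simp at h5

instance (θ : ℝ) (p : ℝ≥0∞) [hp : Fact (1 ≤ p)] : NormedAddCommGroup (InterpSpace D θ p) :=
  AddGroupNorm.toNormedAddCommGroup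
    { toFun := interpNorm D θ p
      map_zero' := by
        simp [interpNorm, eLpNorm_congr_ae (kWeighted_zero D θ)]
      add_le' := fun u v => by
        have h := (eLpNorm_mono_ae (p := p) (kWeighted_add_le D θ (InterpSpace.incl D θ p u)
          (InterpSpace.incl D θ p v))).trans
          (eLpNorm_add_le (kWeighted_aesm D θ _) (kWeighted_aesm D θ _) hp.out)
        have hu := (InterpSpace.memLp D u).eLpNorm_ne_top
        have hv := (InterpSpace.memLp D v).eLpNorm_ne_top
        have h' := ENNReal.toReal_mono (ENNReal.add_ne_top.2 ⟨hu, hv⟩) h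
        rw [ENNReal.toReal_add hu hv] at h'
        simpa [interpNorm] using h'
      neg' := fun u => by
        have key : ∀ v, interpNorm D θ p (-v) ≤ interpNorm D θ p v := fun v => by
          simpa using interpNorm_smul_le D θ p (-1) v
        refine le_antisymm (key u) ?_
        simpa using key (-u)
      eq_zero_of_map_eq_zero' := fun u hu => by
        have h0 : eLpNorm (kWeighted D θ (InterpSpace.incl D θ p u)) p haarPos = 0 :=
          ((ENNReal.toReal_eq_zero_iff _).1 hu).resolve_right
            (InterpSpace.memLp D u).eLpNorm_ne_top
        have hp0 : p ≠ 0 := (zero_lt_one.trans_le hp.out).ne'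
        have h1 := (eLpNorm_eq_zero_iff (kWeighted_aesm D θ _) hp0).1 h0
        have h2 := eq_zero_of_kWeighted D θ _ h1
        exact InterpSpace.incl_injective D θ p (by simpa using h2) }

instance (θ : ℝ) (p : ℝ≥0∞) [Fact (1 ≤ p)] : NormedSpace ℂ (InterpSpace D θ p) where
  norm_smul_le := interpNorm_smul_le D θ p

/-- The continuous interpolation space `D_D(θ) = (X, dom D)_θ`, a subspace of `D_D(θ, ∞)` with the
induced norm: all `u` with `t ^ (-θ) K(t, u) → 0` as `t → 0+`. (For `t → ∞` and `θ > 0` this limit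
is always `0`, since `K(t, u) ≤ ‖u‖`.) -/
def littleInterp (θ : ℝ) : Submodule ℂ (InterpSpace D θ ∞) where
  carrier := {u | Tendsto (kWeighted D θ (InterpSpace.incl D θ ∞ u)) (𝓝[>] 0) (𝓝 0)}
  add_mem' := by
    intro u v hu hv
    have h := Tendsto.add hu hv
    rw [add_zero] at h
    refine squeeze_zero' ?_ ?_ h
    · filter_upwards [self_mem_nhdsWithin] with t ht
      exact mul_nonneg (Real.rpow_nonneg (le_of_lt ht) _) (kFun_nonneg D ht _)
    · filter_upwards [self_mem_nhdsWithin] with t ht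
      simp only [kWeighted, map_add]
      rw [← mul_add]
      exact mul_le_mul_of_nonneg_left (kFun_add_le D ht _ _)
        (Real.rpow_nonneg (le_of_lt ht) _)
  zero_mem' := by
    refine (tendsto_congr' ?_).2 tendsto_const_nhds
    filter_upwards [self_mem_nhdsWithin] with t ht
    have h : kFun D t 0 ≤ 0 := by simpa using kFun_smul_le D ht 0 0
    simp [kWeighted, le_antisymm h (kFun_nonneg D ht 0)]
  smul_mem' := by
    intro c u hu
    have h := Tendsto.const_mul ‖c‖ hu
    rw [mul_zero] at h
    refine squeeze_zero' ?_ ?_ h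
    · filter_upwards [self_mem_nhdsWithin] with t ht
      exact mul_nonneg (Real.rpow_nonneg (le_of_lt ht) _) (kFun_nonneg D ht _)
    · filter_upwards [self_mem_nhdsWithin] with t ht
      simp only [kWeighted, map_smul]
      rw [mul_left_comm]
      exact mul_le_mul_of_nonneg_left (kFun_smul_le D ht _ _)
        (Real.rpow_nonneg (le_of_lt ht) _)

/-- The inclusion of `D_D(θ)` in `X`. -/
def littleInterp.incl (θ : ℝ) : littleInterp D θ →ₗ[ℂ] X :=
  InterpSpace.incl D θ ∞ ∘ₗ (littleInterp D θ).subtype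

lemma littleInterp.incl_injective (θ : ℝ) : Function.Injective (littleInterp.incl D θ) :=
  (InterpSpace.incl_injective D θ ∞).comp (littleInterp D θ).subtype_injective

/-- The operator `L_{θ,p}` on `D_D(θ, p)`. -/
def interpOp (A B D : X →ₗ.[ℂ] X) (θ : ℝ) (p : ℝ≥0∞) :
    InterpSpace D θ p →ₗ.[ℂ] InterpSpace D θ p :=
  sumOpIn (InterpSpace.incl D θ p) (InterpSpace.incl_injective D θ p) A B D

/-- The analogous operator `L_θ` on `D_D(θ)`. -/
def littleOp (A B D : X →ₗ.[ℂ] X) (θ : ℝ) : littleInterp D θ →ₗ.[ℂ] littleInterp D θ :=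
  sumOpIn (littleInterp.incl D θ) (littleInterp.incl_injective D θ) A B D

end Interpolation

/-! ### Contours -/

/-- `γ` is piecewise continuously differentiable, with finitely many break points: it is `C¹` on
every compact interval without a break point in its interior. -/
def PiecewiseC1 (γ : ℝ → ℂ) : Prop :=
  Continuous γ ∧ ∃ s : Finset ℝ, ∀ a b : ℝ, a < b → Disjoint (Ioo a b) (s : Set ℝ) →
    ContDiffOn ℝ 1 γ (Icc a b)

/-- `γ` is a path in the sector of angle `φ₂`, minus `0`, that comes from `e^{iφ'} ∞`, ends in
`e^{-iφ'} ∞`, and surrounds the spectrum of `D` (of which it is assumed that it lies in the sector of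
angle `φ₁` and does not contain `0`): for some `ε > 0` the disc of radius `ε` about `0` does not
meet the spectrum, and `γ` runs around the truncated sector
`{z : |arg z| ≤ φ₁, |z| ≥ ε}`, which contains the spectrum, without meeting it. -/
structure IsContour {X : Type*} [NormedAddCommGroup X] [NormedSpace ℂ X] (D : X →ₗ.[ℂ] X)
    (φ₁ φ₂ φ' : ℝ) (γ : ℝ → ℂ) : Prop where
  piecewiseC1 : PiecewiseC1 γ
  ends : ∃ r : ℝ, 0 < r ∧
    (∀ t ≤ -r, γ t = ((-t : ℝ) : ℂ) * Complex.exp ((φ' : ℂ) * Complex.I)) ∧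
    (∀ t ≥ r, γ t = (t : ℂ) * Complex.exp (-(φ' : ℂ) * Complex.I))
  mem_sector : ∀ t, γ t ∈ openSector φ₂
  surrounds : ∃ ε : ℝ, 0 < ε ∧ Metric.ball 0 ε ⊆ resSet D ∧
    ∀ t, γ t ∈ sector φ₁ → ‖γ t‖ < ε

/-- The integrand of the contour integral `∫_γ R(z, D) H(z) x dz`, pulled back to the parameter. -/
def contourIntegrand {X : Type*} [NormedAddCommGroup X] [NormedSpace ℂ X] (A B D : X →ₗ.[ℂ] X)
    (γ : ℝ → ℂ) (x : X) (t : ℝ) : X :=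
  deriv γ t • res D (γ t) (pencilInv A B (γ t) x)

end

end OpSum

/-! Write `R(z) = R(z, D)`, `J = D⁻¹` and `N(z) = D R(z) = z R(z) - 1`. As `A` and `B` commute with
`D`, the pencil inverse `H(z)` commutes with `J` and with the resolvents, and the contour integral
`S` is Cauchy's formula for substituting `D` for `z` in `(z² + zB + A)⁻¹`.

Left inverse (`SumSetting.solution_left_inv`): algebra turns `R(z) H(z) (D² + BD + A) x` into `z⁻¹
R(z) D x + z⁻¹ H(z) A x - H(z) D x`. The last two terms are holomorphic and of order `|z|⁻²` in the
open sector of angle `φ₂`, so their integrals vanish (`IsContour.integral_eq_zero`). The first gives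
`2πi x`, by the residue formula `∫ z⁻¹ R(z) v dz = 2πi J v` (`IsContour.integral_inv_smul_res`).

Right inverse (`SumSetting.exists_right_inv`): formally `D² S x`, `B D S x` and `A S x` are `(2πi)⁻¹
∫ z⁻¹ G(z) N(z) x dz` with the bounded holomorphic families `G = z² H`, `z B H`, `A H`. On an
interpolation space these integrals converge, because `‖N(z) x‖` is at most a constant times
`K(1/|z|, x)`, hence times `|z|^(-θ)` (`norm_resN_le_kFun`, `exists_kFun_le_rpow`). The three
families add up to `1`, so the three terms add up to `(2πi)⁻¹ ∫ z⁻¹ N(z) x dz = x`.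

Regularity (`SumSetting.kDominated_family`): `K(t, y)` is controlled by `‖N(-1/t) y‖`. When `N(-s)`
is moved into the integral for `y`, the resolvent identity splits the integrand; one part integrates
to zero, and the other yields `K(t, y) ≤ C ∫ K(τ, x) / (1 + τ/t) dτ/τ`. This Hardy type operator
preserves the weighted `L^p` spaces by the Schur test (`KDominated.memLp`) and the decay at `0`
(`KDominated.tendsto`).

Contour integrals along general paths are evaluated by primitives, obtained by integrating along
rays, and not by deforming the path. -/

namespace OpSum

/-! ### Sectors -/

section Sectors

/-- The cosine is strictly decreasing on `[0, π]`. In this form a sector is cut out by an inequality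
between continuous functions, free of the jump of `arg`. -/
lemma abs_arg_lt_iff {φ : ℝ} (h0 : 0 ≤ φ) (hπ : φ ≤ Real.pi) {z : ℂ} (hz : z ≠ 0) :
    |z.arg| < φ ↔ ‖z‖ * Real.cos φ < z.re := by
  have h1 : Real.cos φ < Real.cos |z.arg| ↔ |z.arg| < φ :=
    Real.strictAntiOn_cos.lt_iff_gt ⟨h0, hπ⟩ ⟨abs_nonneg _, Complex.abs_arg_le_pi z⟩
  rw [← h1, Real.cos_abs, Complex.cos_arg hz, lt_div_iff₀ (norm_pos_iff.2 hz), mul_comm]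

lemma mem_openSector_iff {φ : ℝ} (h0 : 0 ≤ φ) (hπ : φ ≤ Real.pi) {z : ℂ} :
    z ∈ openSector φ ↔ ‖z‖ * Real.cos φ < z.re := by
  rcases eq_or_ne z 0 with rfl | hz
  · simp [openSector]
  · simp only [openSector, mem_ofPred_eq, ne_eq, hz, not_false_eq_true, true_and]
    exact abs_arg_lt_iff h0 hπ hz

lemma mem_sector_iff {φ : ℝ} (h0 : 0 ≤ φ) (hπ : φ ≤ Real.pi) {z : ℂ} :
    z ∈ sector φ ↔ ‖z‖ * Real.cos φ ≤ z.re := by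
  rcases eq_or_ne z 0 with rfl | hz
  · simp [sector]
  · have h1 : Real.cos φ ≤ Real.cos |z.arg| ↔ |z.arg| ≤ φ :=
      Real.strictAntiOn_cos.le_iff_ge ⟨h0, hπ⟩ ⟨abs_nonneg _, Complex.abs_arg_le_pi z⟩
    have : z ∈ sector φ ↔ |z.arg| ≤ φ := by simp [sector, hz]
    rw [this, ← h1, Real.cos_abs, Complex.cos_arg hz, le_div_iff₀ (norm_pos_iff.2 hz), mul_comm]

lemma openSector_subset_sector (φ : ℝ) : openSector φ ⊆ sector φ \ {0} :=
  fun _ hz => ⟨Or.inl hz.2.le, hz.1⟩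

lemma openSector_subset_slitPlane {φ : ℝ} (hπ : φ ≤ Real.pi) :
    openSector φ ⊆ Complex.slitPlane := by
  intro z hz
  rw [Complex.mem_slitPlane_iff_arg]
  refine ⟨fun h => ?_, hz.1⟩
  have := hz.2
  rw [h, abs_of_pos Real.pi_pos] at this
  linarith

lemma isOpen_openSector {φ : ℝ} (h0 : 0 ≤ φ) (hπ : φ ≤ Real.pi) : IsOpen (openSector φ) := by
  have : openSector φ = {z : ℂ | ‖z‖ * Real.cos φ < z.re} := by
    ext z; exact mem_openSector_iff h0 hπ
  rw [this]
  exact isOpen_lt (by fun_prop) Complex.continuous_re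

lemma smul_mem_openSector {φ s : ℝ} (hs : 0 < s) {z : ℂ} (hz : z ∈ openSector φ) :
    (s : ℂ) * z ∈ openSector φ := by
  refine ⟨mul_ne_zero (by exact_mod_cast hs.ne') hz.1, ?_⟩
  rw [Complex.arg_real_mul z hs]; exact hz.2

lemma inv_mem_openSector {φ : ℝ} (hπ : φ ≤ Real.pi) {z : ℂ} (hz : z ∈ openSector φ) :
    z⁻¹ ∈ openSector φ := by
  have h := (Complex.mem_slitPlane_iff_arg.1 (openSector_subset_slitPlane hπ hz)).1
  refine ⟨inv_ne_zero hz.1, ?_⟩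
  rw [Complex.arg_inv, if_neg h, abs_neg]; exact hz.2

lemma neg_mem_openSector_iff {φ : ℝ} (h0 : 0 ≤ φ) (hπ : φ ≤ Real.pi) {z : ℂ} :
    -z ∈ openSector (Real.pi - φ) ↔ z ∉ sector φ := by
  rw [mem_openSector_iff (by linarith) (by linarith), mem_sector_iff h0 hπ, Real.cos_pi_sub,
    norm_neg, Complex.neg_re, not_le]
  constructor <;> intro h <;> linarith

/-- The open sector is the image under `exp` of a horizontal strip, which is convex. -/
lemma isPreconnected_openSector {φ : ℝ} (hπ : φ ≤ Real.pi) : IsPreconnected (openSector φ) := by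
  have h : openSector φ = Complex.exp '' (Complex.im ⁻¹' Ioo (-φ) φ) := by
    ext z
    constructor
    · intro hz
      refine ⟨Complex.log z, ?_, Complex.exp_log hz.1⟩
      simp only [mem_preimage, Complex.log_im]
      exact abs_lt.1 hz.2
    · rintro ⟨w, hw, rfl⟩
      refine ⟨Complex.exp_ne_zero w, ?_⟩
      rw [← Complex.log_im, Complex.log_exp (by linarith [hw.1]) (by linarith [hw.2])]
      exact abs_lt.2 hw
  rw [h]
  refine IsPreconnected.image ?_ _ Complex.continuous_exp.continuousOn
  exact ((convex_Ioo _ _).linear_preimage (f := Complex.imLm)).isPreconnected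

/-- With `c = cos φ` the law of cosines bounds `‖z + s‖²` below by `‖z‖² + s² + 2 c s ‖z‖`, which is
`(1 + c)/2 (‖z‖ + s)² + (1 - c)/2 (‖z‖ - s)²`. -/
lemma norm_add_pos_ge {φ : ℝ} (h0 : 0 ≤ φ) (hπ : φ < Real.pi) {z : ℂ} (hz : z ∈ sector φ)
    {s : ℝ} (hs : 0 ≤ s) :
    √((1 + Real.cos φ) / 2) * (‖z‖ + s) ≤ ‖z + s‖ := by
  have hz' := (mem_sector_iff h0 hπ.le).1 hz
  have hc : -1 < Real.cos φ := by
    have := Real.strictAntiOn_cos ⟨h0, hπ.le⟩ ⟨Real.pi_pos.le, le_rfl⟩ hπ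
    simpa using this
  have hn : ‖z + s‖ ^ 2 = ‖z‖ ^ 2 + 2 * s * z.re + s ^ 2 := by
    rw [← Complex.normSq_eq_norm_sq, ← Complex.normSq_eq_norm_sq, Complex.normSq_apply,
      Complex.normSq_apply]
    simp
    ring
  refine (sq_le_sq₀ (by positivity) (norm_nonneg _)).1 ?_
  rw [mul_pow, Real.sq_sqrt (by linarith), hn]
  have hc1 := Real.cos_le_one φ
  nlinarith [mul_nonneg (sub_nonneg.2 hc1) (sq_nonneg (‖z‖ - s)), mul_le_mul_of_nonneg_left hz' hs]

lemma sqrt_one_add_cos_pos {φ : ℝ} (h0 : 0 ≤ φ) (hπ : φ < Real.pi) :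
    0 < √((1 + Real.cos φ) / 2) := by
  have := Real.strictAntiOn_cos ⟨h0, hπ.le⟩ ⟨Real.pi_pos.le, le_rfl⟩ hπ
  rw [Real.cos_pi] at this
  exact Real.sqrt_pos.2 (by linarith)

lemma mul_exp_mem_openSector_iff {φ s α : ℝ} (hs : 0 < s) (hα : α ∈ Ioc (-Real.pi) Real.pi) :
    (s : ℂ) * Complex.exp (α * Complex.I) ∈ openSector φ ↔ |α| < φ := by
  have : Complex.arg ((s : ℂ) * Complex.exp (α * Complex.I)) = α := by
    rw [Complex.arg_real_mul _ hs, Complex.arg_exp_mul_I, (toIocMod_eq_self _).2]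
    rwa [show -Real.pi + 2 * Real.pi = Real.pi by ring]
  simp [openSector, this, hs.ne']

lemma mul_exp_mem_sector_iff {φ s α : ℝ} (hs : 0 < s) (hα : α ∈ Ioc (-Real.pi) Real.pi) :
    (s : ℂ) * Complex.exp (α * Complex.I) ∈ sector φ ↔ |α| ≤ φ := by
  have : Complex.arg ((s : ℂ) * Complex.exp (α * Complex.I)) = α := by
    rw [Complex.arg_real_mul _ hs, Complex.arg_exp_mul_I, (toIocMod_eq_self _).2]
    rwa [show -Real.pi + 2 * Real.pi = Real.pi by ring]
  simp [sector, this, hs.ne']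

end Sectors

/-! ### Primitives along rays -/

section Primitives

variable {E : Type*} [NormedAddCommGroup E] [NormedSpace ℂ E] [CompleteSpace E]

/-- The integral of `g` along the segment from `0` to `z`. -/
noncomputable def radialPrimitive (g : ℂ → E) (z : ℂ) : E := ∫ s in (0 : ℝ)..1, z • g (s * z)

lemma norm_radialPrimitive_le {g : ℂ → E} {z : ℂ} {C : ℝ}
    (hC : ∀ s ∈ Ioc (0 : ℝ) 1, ‖g (s * z)‖ ≤ C) : ‖radialPrimitive g z‖ ≤ C * ‖z‖ := by
  have := intervalIntegral.norm_integral_le_of_norm_le_const (a := 0) (b := 1) (C := C * ‖z‖)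
    (f := fun s : ℝ => z • g (s * z)) (fun s hs => by
      rw [uIoc_of_le zero_le_one] at hs
      rw [norm_smul, mul_comm]
      gcongr
      exact hC s hs)
  simpa [radialPrimitive] using this

/-- Differentiation under the integral works because the `z`-derivative of `z g(sz)` equals the
`s`-derivative of `s g(sz)`, which integrates to `g z`. Nothing but boundedness is required of `g`
near the origin, so that the origin may lie on the boundary of the region. -/
lemma hasDerivAt_radialPrimitive {g : ℂ → E} {z : ℂ} {r C : ℝ} (hr : 0 < r)
    (hg : ∀ w ∈ Metric.ball z r, ∀ s ∈ Ioc (0 : ℝ) 1,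
      DifferentiableAt ℂ g (s * w) ∧ ‖g (s * w)‖ ≤ C) :
    HasDerivAt (radialPrimitive g) (g z) z := by
  have hC0 : 0 ≤ C := (norm_nonneg _).trans (hg z (Metric.mem_ball_self hr) 1 (by simp)).2
  set F : ℂ → ℝ → E := fun w s => w • g (s * w)
  set F' : ℂ → ℝ → E := fun w s => deriv (fun w => F w s) w
  have hFd : ∀ s ∈ Ioc (0 : ℝ) 1, DifferentiableOn ℂ (fun w => F w s) (Metric.ball z r) := by
    intro s hs w hw
    have h1 : DifferentiableAt ℂ (fun w : ℂ => g (s * w)) w :=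
      DifferentiableAt.comp (g := g) (f := fun w : ℂ => (s : ℂ) * w) w (hg w hw s hs).1 (by fun_prop)
    exact (differentiableAt_id.smul h1).differentiableWithinAt
  have hFb : ∀ s ∈ Ioc (0 : ℝ) 1, ∀ w ∈ Metric.ball z r, ‖F w s‖ ≤ (‖z‖ + r) * C := by
    intro s hs w hw
    rw [norm_smul]
    gcongr
    · have := norm_sub_norm_le w z
      rw [Metric.mem_ball, dist_eq_norm] at hw
      linarith
    · exact (hg w hw s hs).2
  have hsub : ∀ w ∈ Metric.ball z (r / 2), Metric.closedBall w (r / 3) ⊆ Metric.ball z r := by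
    intro w hw u hu
    rw [Metric.mem_ball] at *
    rw [Metric.mem_closedBall] at hu
    linarith [dist_triangle u w z]
  have hder : ∀ s ∈ Ioc (0 : ℝ) 1, ∀ w ∈ Metric.ball z (r / 2),
      HasDerivAt (fun w => F w s) (F' w s) w := by
    intro s hs w hw
    have hwr : w ∈ Metric.ball z r := Metric.ball_subset_ball (by linarith) hw
    exact ((hFd s hs).differentiableAt (Metric.isOpen_ball.mem_nhds hwr)).hasDerivAt
  have hF'b : ∀ s ∈ Ioc (0 : ℝ) 1, ∀ w ∈ Metric.ball z (r / 2),
      ‖F' w s‖ ≤ (‖z‖ + r) * C / (r / 3) := by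
    intro s hs w hw
    -- Cauchy's estimate on a circle of radius `r / 3`, which stays in the ball of radius `r`.
    refine Complex.norm_deriv_le_of_forall_mem_sphere_norm_le (by positivity) ?_ ?_
    · exact ((hFd s hs).mono (hsub w hw)).diffContOnCl_ball subset_rfl
    · intro u hu
      exact hFb s hs u (hsub w hw (Metric.sphere_subset_closedBall hu))
  have hcont : ∀ w ∈ Metric.ball z r, ContinuousOn (fun s : ℝ => g (s * w)) (Ioc 0 1) := by
    intro w hw s hs
    have := (hg w hw s hs).1.continuousAt
    exact (ContinuousAt.comp (g := g) (f := fun s : ℝ => (s : ℂ) * w) this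
      (by fun_prop)).continuousWithinAt
  have hFc : ∀ w ∈ Metric.ball z r, ContinuousOn (fun s : ℝ => F w s) (Ioc 0 1) := by
    intro w hw
    exact continuousOn_const.smul (hcont w hw)
  have hmeas : ∀ w ∈ Metric.ball z r,
      AEStronglyMeasurable (F w) (volume.restrict (uIoc (0 : ℝ) 1)) := by
    intro w hw
    rw [uIoc_of_le zero_le_one]
    exact (hFc w hw).aestronglyMeasurable measurableSet_Ioc
  have hzr : z ∈ Metric.ball z r := Metric.mem_ball_self hr
  have hz2 : z ∈ Metric.ball z (r / 2) := Metric.mem_ball_self (by positivity)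
  -- the derivative at `z` in closed form
  have hF'z : ∀ s ∈ Ioc (0 : ℝ) 1,
      HasDerivAt (fun s : ℝ => (s : ℂ) • g (s * z)) (F' z s) s := by
    intro s hs
    have hgd := (hg z hzr s hs).1.hasDerivAt
    have h1 : HasDerivAt (fun w => F w s) (z • ((s : ℂ) • deriv g (s * z)) + (1 : ℂ) • g (s * z))
        z := by
      refine (hasDerivAt_id z).smul ?_
      have := HasDerivAt.scomp (g₁ := g) (h := fun w : ℂ => (s : ℂ) * w) z hgd
        ((hasDerivAt_id z).const_mul (s : ℂ))
      simpa [Function.comp_def] using this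
    have h2 : F' z s = z • ((s : ℂ) • deriv g (s * z)) + (1 : ℂ) • g (s * z) := h1.deriv
    rw [h2]
    have h3 : HasDerivAt (fun s : ℝ => (s : ℂ)) (1 : ℂ) s := Complex.ofRealCLM.hasDerivAt
    have h4 : HasDerivAt (fun s : ℝ => g (s * z)) (z • deriv g (s * z)) s := by
      have := HasDerivAt.scomp (g₁ := g) (h := fun s : ℝ => (s : ℂ) * z) s hgd
        (h3.mul_const z)
      simpa [Function.comp_def] using this
    refine (h3.smul h4).congr_deriv ?_
    rw [smul_comm z (s : ℂ)]
  have hF'meas : AEStronglyMeasurable (F' z) (volume.restrict (uIoc (0 : ℝ) 1)) := by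
    rw [uIoc_of_le zero_le_one]
    have h1 : AEStronglyMeasurable (fun s => deriv (fun s : ℝ => (s : ℂ) • g (s * z)) s)
        (volume.restrict (Ioc (0 : ℝ) 1)) :=
      (aestronglyMeasurable_deriv _ _)
    refine h1.congr ?_
    filter_upwards [ae_restrict_mem measurableSet_Ioc] with s hs
    exact (hF'z s hs).deriv
  have key := intervalIntegral.hasDerivAt_integral_of_dominated_loc_of_deriv_le (𝕜 := ℂ)
    (μ := volume) (a := 0) (b := 1)
    (F := F) (F' := F') (x₀ := z) (s := Metric.ball z (r / 2))
    (bound := fun _ => (‖z‖ + r) * C / (r / 3))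
    (Metric.ball_mem_nhds z (by positivity))
    (by filter_upwards [Metric.ball_mem_nhds z hr] with w hw using hmeas w hw)
    (by
      rw [intervalIntegrable_iff]
      have : IsFiniteMeasure (volume.restrict (uIoc (0 : ℝ) 1)) := ⟨by simp⟩
      refine Integrable.of_bound (hmeas z hzr) ((‖z‖ + r) * C) ?_
      refine (ae_restrict_mem measurableSet_uIoc).mono fun s hs => ?_
      rw [uIoc_of_le zero_le_one] at hs
      exact hFb s hs z hzr)
    hF'meas
    (by
      refine Eventually.of_forall fun s hs w hw => ?_
      rw [uIoc_of_le zero_le_one] at hs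
      exact hF'b s hs w hw)
    intervalIntegrable_const
    (by
      refine Eventually.of_forall fun s hs w hw => ?_
      rw [uIoc_of_le zero_le_one] at hs
      exact hder s hs w hw)
  have hval : ∫ s in (0 : ℝ)..1, F' z s = g z := by
    -- At `s = 0` the factor `s` compensates for the possible discontinuity of the bounded `g`.
    have hc : ContinuousOn (fun s : ℝ => (s : ℂ) • g (s * z)) (Icc 0 1) := by
      intro s hs
      rcases eq_or_lt_of_le hs.1 with h | h
      · subst h
        have : Tendsto (fun s : ℝ => (s : ℂ) • g (s * z)) (𝓝[Icc 0 1] 0) (𝓝 0) := by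
          refine squeeze_zero_norm' (a := fun s : ℝ => |s| * C) ?_ ?_
          · filter_upwards [self_mem_nhdsWithin] with s hs
            rcases eq_or_lt_of_le hs.1 with h | h
            · simp [← h]
            · rw [norm_smul, Complex.norm_real, Real.norm_eq_abs]
              gcongr
              exact (hg z hzr s ⟨h, hs.2⟩).2
          · have : Continuous fun s : ℝ => |s| * C := by fun_prop
            have := this.tendsto 0
            simp only [abs_zero, zero_mul] at this
            exact this.mono_left nhdsWithin_le_nhds
        simpa [ContinuousWithinAt] using this
      · exact (hF'z s ⟨h, hs.2⟩).continuousAt.continuousWithinAt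
    rw [intervalIntegral.integral_eq_sub_of_hasDerivAt_of_le zero_le_one hc
      (fun s hs => hF'z s ⟨hs.1, hs.2.le⟩) key.1]
    simp
  have := key.2
  rw [hval] at this
  exact this

/-- A function that is holomorphic on an open sector and of order `|z|⁻²` has there a primitive of
order `|z|⁻¹`. -/
lemma exists_primitive_openSector {φ : ℝ} (h0 : 0 ≤ φ) (hπ : φ ≤ Real.pi) {f : ℂ → E} {C : ℝ}
    (hf : DifferentiableOn ℂ f (openSector φ))
    (hC : ∀ z ∈ openSector φ, ‖f z‖ ≤ C * ‖z‖⁻¹ ^ 2) :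
    ∃ F : ℂ → E, (∀ z ∈ openSector φ, HasDerivAt F (f z) z) ∧
      ∀ z ∈ openSector φ, ‖F z‖ ≤ C * ‖z‖⁻¹ := by
  have ho := isOpen_openSector h0 hπ
  -- The inversion `z ↦ z⁻¹` preserves the sector and turns the decay at infinity into boundedness
  -- of `g`. Integrating `g` from `0` to `z⁻¹` amounts to integrating `f` from infinity to `z`.
  set g : ℂ → E := fun z => (-(z⁻¹ ^ 2)) • f z⁻¹
  have hgb : ∀ z ∈ openSector φ, ‖g z‖ ≤ C := by
    intro z hz
    have hz0 : 0 < ‖z‖ := norm_pos_iff.2 hz.1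
    have := hC _ (inv_mem_openSector hπ hz)
    rw [norm_smul, norm_neg, norm_pow, norm_inv]
    calc ‖z‖⁻¹ ^ 2 * ‖f z⁻¹‖ ≤ ‖z‖⁻¹ ^ 2 * (C * ‖z⁻¹‖⁻¹ ^ 2) := by gcongr
      _ = C := by rw [norm_inv, inv_inv]; field_simp
  have hgd : ∀ z ∈ openSector φ, DifferentiableAt ℂ g z := by
    intro z hz
    have h1 : DifferentiableAt ℂ f z⁻¹ :=
      hf.differentiableAt (ho.mem_nhds (inv_mem_openSector hπ hz))
    have h2 : DifferentiableAt ℂ (fun z : ℂ => z⁻¹) z := differentiableAt_inv hz.1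
    have h3 : DifferentiableAt ℂ (fun z => f z⁻¹) z := DifferentiableAt.comp (g := f) z h1 h2
    exact (h2.pow 2).neg.smul h3
  refine ⟨fun z => radialPrimitive g z⁻¹, fun z hz => ?_, fun z hz => ?_⟩
  · have hz' := inv_mem_openSector hπ hz
    obtain ⟨r, hr, hball⟩ := Metric.isOpen_iff.1 ho _ hz'
    have h := hasDerivAt_radialPrimitive (g := g) (C := C) hr (fun w hw s hs =>
      ⟨hgd _ (smul_mem_openSector hs.1 (hball hw)), hgb _ (smul_mem_openSector hs.1 (hball hw))⟩)
    have h2 := HasDerivAt.scomp (h := fun z : ℂ => z⁻¹) z h (hasDerivAt_inv hz.1)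
    refine h2.congr_deriv ?_
    have := hz.1
    simp only [g, inv_inv, smul_smul]
    rw [show -(z ^ 2)⁻¹ * -z ^ 2 = 1 by field_simp, one_smul]
  · have hz' := inv_mem_openSector hπ hz
    have := norm_radialPrimitive_le (g := g) (z := z⁻¹) (C := C)
      (fun s hs => hgb _ (smul_mem_openSector hs.1 hz'))
    rwa [norm_inv] at this

end Primitives

/-! ### Contour integrals -/

section Contours

lemma PiecewiseC1.exists_local_contDiffOn {γ : ℝ → ℂ} (h : PiecewiseC1 γ) (t₀ : ℝ) :
    ∃ δ > 0, ContDiffOn ℝ 1 γ (Icc (t₀ - δ) t₀) ∧ ContDiffOn ℝ 1 γ (Icc t₀ (t₀ + δ)) := by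
  obtain ⟨-, s, hs⟩ := h
  have hc : ((s.erase t₀ : Finset ℝ) : Set ℝ)ᶜ ∈ 𝓝 t₀ :=
    (s.erase t₀).finite_toSet.isClosed.isOpen_compl.mem_nhds (by simp)
  obtain ⟨δ, hδ, hball⟩ := Metric.mem_nhds_iff.1 hc
  have hd : ∀ u, |u - t₀| < δ → u ≠ t₀ → u ∉ s := by
    intro u hu hne hus
    exact hball (show u ∈ Metric.ball t₀ δ by rwa [Metric.mem_ball, Real.dist_eq])
      (by simp [hne, hus])
  refine ⟨δ, hδ, hs _ _ (by linarith) ?_, hs _ _ (by linarith) ?_⟩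
  · refine Set.disjoint_left.2 fun u hu => hd u (abs_lt.2 ⟨?_, ?_⟩) hu.2.ne <;>
      linarith [hu.1, hu.2]
  · refine Set.disjoint_left.2 fun u hu => hd u (abs_lt.2 ⟨?_, ?_⟩) hu.1.ne' <;>
      linarith [hu.1, hu.2]

lemma exists_deriv_bound_of_contDiffOn {γ : ℝ → ℂ} {a b : ℝ} (hab : a < b)
    (h : ContDiffOn ℝ 1 γ (Icc a b)) : ∃ M, ∀ t ∈ Ioo a b, ‖deriv γ t‖ ≤ M := by
  obtain ⟨M, hM⟩ := isCompact_Icc.exists_bound_of_continuousOn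
    (h.continuousOn_derivWithin (uniqueDiffOn_Icc hab) le_rfl)
  refine ⟨M, fun t ht => ?_⟩
  rw [← derivWithin_of_mem_nhds (Icc_mem_nhds ht.1 ht.2)]
  exact hM t (Ioo_subset_Icc_self ht)

lemma PiecewiseC1.exists_deriv_bound {γ : ℝ → ℂ} (h : PiecewiseC1 γ) {K : Set ℝ}
    (hK : IsCompact K) : ∃ M, ∀ t ∈ K, ‖deriv γ t‖ ≤ M := by
  refine hK.induction_on (p := fun K => ∃ M, ∀ t ∈ K, ‖deriv γ t‖ ≤ M) ⟨0, by simp⟩ ?_ ?_ ?_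
  · rintro s t hst ⟨M, hM⟩
    exact ⟨M, fun u hu => hM u (hst hu)⟩
  · rintro s t ⟨M, hM⟩ ⟨N, hN⟩
    exact ⟨max M N, fun u hu => hu.elim (fun hu => (hM u hu).trans (le_max_left _ _))
      fun hu => (hN u hu).trans (le_max_right _ _)⟩
  · intro t₀ _
    obtain ⟨δ, hδ, h1, h2⟩ := h.exists_local_contDiffOn t₀
    obtain ⟨M, hM⟩ := exists_deriv_bound_of_contDiffOn (by linarith) h1
    obtain ⟨N, hN⟩ := exists_deriv_bound_of_contDiffOn (by linarith) h2
    -- The point `t₀` may be a break point, where `deriv γ` can have its default value; it enters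
    -- the bound separately.
    refine ⟨Ioo (t₀ - δ) (t₀ + δ), mem_nhdsWithin_of_mem_nhds
      (Ioo_mem_nhds (by linarith) (by linarith)), max (max M N) ‖deriv γ t₀‖, fun t ht => ?_⟩
    rcases lt_trichotomy t t₀ with h | h | h
    · exact (hM t ⟨ht.1, h⟩).trans ((le_max_left _ _).trans (le_max_left _ _))
    · rw [h]; exact le_max_right _ _
    · exact (hN t ⟨h, ht.2⟩).trans ((le_max_right _ _).trans (le_max_left _ _))

lemma PiecewiseC1.exists_hasDerivAt {γ : ℝ → ℂ} (h : PiecewiseC1 γ) :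
    ∃ s : Finset ℝ, ∀ t ∉ s, HasDerivAt γ (deriv γ t) t := by
  obtain ⟨-, s, hs⟩ := h
  refine ⟨s, fun t ht => ?_⟩
  obtain ⟨δ, hδ, hball⟩ := Metric.mem_nhds_iff.1
    (s.finite_toSet.isClosed.isOpen_compl.mem_nhds (show t ∈ (s : Set ℝ)ᶜ by simpa using ht))
  rw [Real.ball_eq_Ioo] at hball
  have := hs (t - δ) (t + δ) (by linarith) (Set.disjoint_left.2 fun u hu => hball hu)
  exact ((this.differentiableOn one_ne_zero).differentiableAt
    (Icc_mem_nhds (by linarith) (by linarith))).hasDerivAt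

variable {X : Type*} [NormedAddCommGroup X] [NormedSpace ℂ X] {D : X →ₗ.[ℂ] X}
  {φ₁ φ₂ φ' : ℝ} {γ : ℝ → ℂ}

lemma IsContour.exists_deriv_bound (h : IsContour D φ₁ φ₂ φ' γ) :
    ∃ M, 0 ≤ M ∧ ∀ t, ‖deriv γ t‖ ≤ M := by
  obtain ⟨r, hr, hl, hu⟩ := h.ends
  obtain ⟨M, hM⟩ := h.piecewiseC1.exists_deriv_bound (isCompact_Icc (a := -r) (b := r))
  refine ⟨max M 1, zero_le_one.trans (le_max_right _ _), fun t => ?_⟩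
  have hid : HasDerivAt (fun t : ℝ => (t : ℂ)) 1 t := Complex.ofRealCLM.hasDerivAt
  by_cases h1 : t < -r
  · have : deriv γ t = -1 * Complex.exp ((φ' : ℂ) * Complex.I) := by
      rw [Filter.EventuallyEq.deriv_eq
        (mem_of_superset (Iio_mem_nhds h1) fun u hu => hl u (le_of_lt hu) : γ =ᶠ[𝓝 t] _)]
      simp only [Complex.ofReal_neg]
      exact (hid.neg.mul_const _).deriv
    rw [this]
    simp [Complex.norm_exp_ofReal_mul_I]
  by_cases h2 : r < t
  · have : deriv γ t = 1 * Complex.exp (-(φ' : ℂ) * Complex.I) := by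
      rw [Filter.EventuallyEq.deriv_eq
        (mem_of_superset (Ioi_mem_nhds h2) fun u hut => hu u (le_of_lt hut) : γ =ᶠ[𝓝 t] _)]
      exact (hid.mul_const _).deriv
    rw [this, ← Complex.ofReal_neg, norm_mul, Complex.norm_exp_ofReal_mul_I]
    simp
  · exact (hM t ⟨not_lt.1 h1, not_lt.1 h2⟩).trans (le_max_left _ _)

/-- On the rays `‖γ t‖ = |t|`, and on the compact middle part `γ` avoids `0`. Together with the
bound of `deriv γ` this reduces integrability along the contour to powers of `1 + |t|`. -/
lemma IsContour.exists_norm_ge (h : IsContour D φ₁ φ₂ φ' γ) :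
    ∃ c > 0, ∀ t, c * (1 + |t|) ≤ ‖γ t‖ := by
  obtain ⟨r, hr, hl, hu⟩ := h.ends
  obtain ⟨t₀, -, ht₀⟩ := (isCompact_Icc (a := -r) (b := r)).exists_isMinOn
    ⟨0, by constructor <;> linarith⟩ (h.piecewiseC1.1.norm.continuousOn)
  have hm : 0 < ‖γ t₀‖ := norm_pos_iff.2 (h.mem_sector t₀).1
  have hout : ∀ t, r < |t| → ‖γ t‖ = |t| := by
    intro t ht
    rcases lt_abs.1 ht with h | h
    · rw [hu t h.le, ← Complex.ofReal_neg, norm_mul, Complex.norm_exp_ofReal_mul_I]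
      simp
    · rw [hl t (by linarith), norm_mul, Complex.norm_exp_ofReal_mul_I]
      simp
  refine ⟨min ‖γ t₀‖ r / (1 + r), by positivity, fun t => ?_⟩
  rw [div_mul_eq_mul_div, div_le_iff₀ (by positivity)]
  by_cases h1 : |t| ≤ r
  · gcongr
    exact (min_le_left _ _).trans (ht₀ (abs_le.1 h1))
  · rw [hout t (not_le.1 h1)]
    calc min ‖γ t₀‖ r * (1 + |t|) ≤ r * (1 + |t|) := by gcongr; exact min_le_right _ _
      _ ≤ |t| * (1 + r) := by linarith [not_le.1 h1]

lemma IsContour.ne_zero (h : IsContour D φ₁ φ₂ φ' γ) (t : ℝ) : γ t ≠ 0 := (h.mem_sector t).1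

lemma IsContour.continuous (h : IsContour D φ₁ φ₂ φ' γ) : Continuous γ := h.piecewiseC1.1

variable {E : Type*} [NormedAddCommGroup E] [NormedSpace ℂ E]

lemma IsContour.integrable_of_rpow (h : IsContour D φ₁ φ₂ φ' γ) {f : ℝ → E} (hf : Continuous f)
    {C δ : ℝ} (hδ : 0 < δ) (hC : ∀ t, ‖f t‖ ≤ C * ‖γ t‖ ^ (-(1 + δ))) :
    Integrable fun t => deriv γ t • f t := by
  obtain ⟨M, hM0, hM⟩ := h.exists_deriv_bound
  obtain ⟨c, hc, hγ⟩ := h.exists_norm_ge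
  have hC0 : 0 ≤ C := by
    by_contra hneg
    have h1 := (norm_nonneg _).trans (hC 0)
    have h2 : 0 < ‖γ 0‖ ^ (-(1 + δ)) := Real.rpow_pos_of_pos (norm_pos_iff.2 (h.ne_zero 0)) _
    nlinarith
  have hint : Integrable fun t : ℝ => (1 + ‖t‖) ^ (-(1 + δ)) :=
    integrable_one_add_norm (by simpa using hδ)
  refine (hint.const_mul (M * (C * c ^ (-(1 + δ))))).mono'
    ((aestronglyMeasurable_deriv γ volume).smul hf.aestronglyMeasurable)
    (Eventually.of_forall fun t => ?_)
  rw [norm_smul]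
  calc ‖deriv γ t‖ * ‖f t‖ ≤ M * (C * (c * (1 + ‖t‖)) ^ (-(1 + δ))) := by
        gcongr
        · exact hM t
        · refine (hC t).trans ?_
          gcongr C * ?_
          exact Real.rpow_le_rpow_of_nonpos (by positivity) (hγ t) (by linarith)
    _ = M * (C * c ^ (-(1 + δ))) * (1 + ‖t‖) ^ (-(1 + δ)) := by
        rw [Real.mul_rpow hc.le (by positivity)]; ring

lemma IsContour.integrable_of_sq (h : IsContour D φ₁ φ₂ φ' γ) {f : ℝ → E} (hf : Continuous f)
    {C : ℝ} (hC : ∀ t, ‖f t‖ ≤ C * ‖γ t‖⁻¹ ^ 2) : Integrable fun t => deriv γ t • f t := by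
  refine h.integrable_of_rpow hf one_pos (C := C) fun t => (hC t).trans_eq ?_
  rw [Real.rpow_neg (norm_nonneg _)]
  norm_num

variable [CompleteSpace E]

/-- The fundamental theorem of calculus off the finitely many break points. It is needed only that
`F` is a primitive along the path. -/
lemma IsContour.integral_eq (h : IsContour D φ₁ φ₂ φ' γ) {f : ℝ → E} {F : ℂ → E} {L : E}
    (hi : Integrable fun t => deriv γ t • f t) (hF : ∀ t, HasDerivAt F (f t) (γ t))
    (hL : Tendsto (fun T : ℝ => F (γ T) - F (γ (-T))) atTop (𝓝 L)) :
    ∫ t, deriv γ t • f t = L := by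
  obtain ⟨s, hs⟩ := h.piecewiseC1.exists_hasDerivAt
  have h1 : ∀ T : ℝ, ∫ t in (-T)..T, deriv γ t • f t = F (γ T) - F (γ (-T)) := by
    intro T
    refine integral_eq_of_hasDerivAt_off_countable (fun t => F (γ t)) _ s.countable_toSet ?_ ?_
      hi.intervalIntegrable
    · intro t _
      exact (ContinuousAt.comp (g := F) (hF t).continuousAt
        h.continuous.continuousAt).continuousWithinAt
    · intro t ht
      exact HasDerivAt.scomp t (hF t) (hs t ht.2)
  have h2 := intervalIntegral_tendsto_integral hi tendsto_neg_atTop_atBot tendsto_id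
  refine tendsto_nhds_unique h2 ?_
  simpa only [id, h1] using hL

lemma IsContour.tendsto_norm (h : IsContour D φ₁ φ₂ φ' γ) :
    Tendsto (fun T : ℝ => ‖γ T‖⁻¹) atTop (𝓝 0) ∧ Tendsto (fun T : ℝ => ‖γ (-T)‖⁻¹) atTop (𝓝 0) := by
  obtain ⟨c, hc, hγ⟩ := h.exists_norm_ge
  have h1 : Tendsto (fun t : ℝ => c * (1 + |t|)) atTop atTop :=
    (tendsto_atTop_add_const_left _ _ tendsto_abs_atTop_atTop).const_mul_atTop hc
  refine ⟨(tendsto_atTop_mono hγ h1).inv_tendsto_atTop, ?_⟩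
  refine (tendsto_atTop_mono (fun t => ?_) h1).inv_tendsto_atTop
  simpa using hγ (-t)

/-- The contour integral vanishes for a holomorphic function in the sector to the right of the
contour. -/
lemma IsContour.integral_eq_zero (h : IsContour D φ₁ φ₂ φ' γ) (h0 : 0 ≤ φ₂) (hπ : φ₂ ≤ Real.pi)
    {f : ℂ → E} {C : ℝ} (hf : DifferentiableOn ℂ f (openSector φ₂))
    (hC : ∀ z ∈ openSector φ₂, ‖f z‖ ≤ C * ‖z‖⁻¹ ^ 2) :
    (Integrable fun t => deriv γ t • f (γ t)) ∧ ∫ t, deriv γ t • f (γ t) = 0 := by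
  have hi : Integrable fun t => deriv γ t • f (γ t) :=
    h.integrable_of_sq (hf.continuousOn.comp_continuous h.continuous h.mem_sector)
      fun t => hC _ (h.mem_sector t)
  refine ⟨hi, ?_⟩
  -- A primitive that decays like `‖z‖⁻¹` tends to zero at both ends of the contour.
  obtain ⟨F, hF, hFC⟩ := exists_primitive_openSector h0 hπ hf hC
  refine h.integral_eq hi (fun t => hF _ (h.mem_sector t)) ?_
  have h1 : Tendsto (fun T : ℝ => F (γ T)) atTop (𝓝 0) :=
    squeeze_zero_norm (fun T => hFC _ (h.mem_sector T)) (by simpa using h.tendsto_norm.1.const_mul C)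
  have h2 : Tendsto (fun T : ℝ => F (γ (-T))) atTop (𝓝 0) :=
    squeeze_zero_norm (fun T => hFC _ (h.mem_sector (-T)))
      (by simpa using h.tendsto_norm.2.const_mul C)
  simpa using h1.sub h2

end Contours

/-! ### Graphs, inverses and resolvents of unbounded operators -/

section OperatorTheory

variable {X : Type*} [NormedAddCommGroup X] [NormedSpace ℂ X]

lemma mem_graph_iff_exists {f : X →ₗ.[ℂ] X} {x y : X} :
    (x, y) ∈ f.graph ↔ ∃ h : x ∈ f.domain, f ⟨x, h⟩ = y := by
  rw [LinearPMap.mem_graph_iff]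
  constructor
  · rintro ⟨u, rfl, rfl⟩; exact ⟨u.2, rfl⟩
  · rintro ⟨h, rfl⟩; exact ⟨⟨x, h⟩, rfl, rfl⟩

lemma mem_graph_natComp {f g : X →ₗ.[ℂ] X} {x z : X} :
    (x, z) ∈ (natComp g f).graph ↔ ∃ y, (x, y) ∈ f.graph ∧ (y, z) ∈ g.graph := by
  simp only [mem_graph_iff_exists]
  constructor
  · rintro ⟨h, rfl⟩
    exact ⟨_, ⟨h.1, rfl⟩, h.2, rfl⟩
  · rintro ⟨y, ⟨h1, rfl⟩, h2, rfl⟩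
    exact ⟨⟨h1, h2⟩, rfl⟩

lemma mem_graph_add {f g : X →ₗ.[ℂ] X} {x z : X} :
    (x, z) ∈ (f + g).graph ↔ ∃ a b, (x, a) ∈ f.graph ∧ (x, b) ∈ g.graph ∧ a + b = z := by
  simp only [mem_graph_iff_exists]
  constructor
  · rintro ⟨h, rfl⟩
    exact ⟨_, _, ⟨h.1, rfl⟩, ⟨h.2, rfl⟩, rfl⟩
  · rintro ⟨_, _, ⟨h1, rfl⟩, ⟨h2, rfl⟩, rfl⟩
    exact ⟨⟨h1, h2⟩, rfl⟩

lemma mem_graph_le {f g : X →ₗ.[ℂ] X} (h : f ≤ g) {x y : X} (hxy : (x, y) ∈ f.graph) :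
    (x, y) ∈ g.graph := LinearPMap.le_graph_iff.2 h hxy

lemma mem_graph_inj {f : X →ₗ.[ℂ] X} {x x' y y' : X} (h : (x, y) ∈ f.graph)
    (h' : (x', y') ∈ f.graph) (hx : x = x') : y = y' := LinearPMap.mem_graph_snd_inj f h h' hx

lemma isBoundedInverse_boundedInverse {T : X →ₗ.[ℂ] X} (h : BoundedlyInvertible T) :
    IsBoundedInverse T (boundedInverse T) := by
  rw [boundedInverse, dif_pos h]; exact h.choose_spec

/-- The graph of `T` in terms of its inverse. -/
lemma IsBoundedInverse.mem_graph_iff {T : X →ₗ.[ℂ] X} {S : X →L[ℂ] X} (h : IsBoundedInverse T S)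
    {x y : X} : (x, y) ∈ T.graph ↔ x = S y := by
  rw [mem_graph_iff_exists]
  constructor
  · rintro ⟨hx, rfl⟩; exact (h.1 ⟨x, hx⟩).symm
  · rintro rfl; exact h.2 y

lemma isBoundedInverse_of_mem_graph_iff {T : X →ₗ.[ℂ] X} {S : X →L[ℂ] X}
    (h : ∀ x y, (x, y) ∈ T.graph ↔ x = S y) : IsBoundedInverse T S :=
  ⟨fun x => ((h x (T x)).1 (T.mem_graph x)).symm, fun y => mem_graph_iff_exists.1 ((h _ y).2 rfl)⟩

lemma IsBoundedInverse.isClosed {T : X →ₗ.[ℂ] X} {S : X →L[ℂ] X} (h : IsBoundedInverse T S) :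
    T.IsClosed := by
  have : (T.graph : Set (X × X)) = {q | q.1 = S q.2} := by
    ext ⟨x, y⟩; exact h.mem_graph_iff
  rw [LinearPMap.IsClosed, this]
  exact isClosed_eq continuous_fst (S.continuous.comp continuous_snd)

lemma mem_graph_shifted {D : X →ₗ.[ℂ] X} {z : ℂ} {x y : X} :
    (x, y) ∈ (shifted D z).graph ↔ (x, z • x - y) ∈ D.graph := by
  simp only [mem_graph_iff_exists]
  refine exists_congr fun h => ?_
  change z • x + -(D ⟨x, h⟩) = y ↔ D ⟨x, h⟩ = z • x - y
  constructor
  · rintro rfl; abel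
  · intro h; rw [h]; abel

lemma mem_graph_pencil {A B : X →ₗ.[ℂ] X} {z : ℂ} {x y : X} :
    (x, y) ∈ (pencil A B z).graph ↔
      ∃ b a, (x, b) ∈ B.graph ∧ (x, a) ∈ A.graph ∧ z ^ 2 • x + (z • b + a) = y := by
  simp only [mem_graph_iff_exists]
  constructor
  · rintro ⟨h, rfl⟩
    exact ⟨_, _, ⟨h.1, rfl⟩, ⟨h.2, rfl⟩, rfl⟩
  · rintro ⟨_, _, ⟨h1, rfl⟩, ⟨h2, rfl⟩, rfl⟩
    exact ⟨⟨h1, h2⟩, rfl⟩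

lemma mem_graph_sumOp {A B D : X →ₗ.[ℂ] X} {J : X →L[ℂ] X} (hJ : IsBoundedInverse D J) {x v : X} :
    (x, v) ∈ (sumOp A B D).graph ↔
      ∃ e b a, x = J (J e) ∧ (J e, b) ∈ B.graph ∧ (x, a) ∈ A.graph ∧ e + b + a = v := by
  simp only [sumOp, mem_graph_add, mem_graph_natComp, hJ.mem_graph_iff]
  constructor
  · rintro ⟨_, a, ⟨e, b, ⟨y, rfl, rfl⟩, ⟨y, h, hb⟩, rfl⟩, ha, rfl⟩
    have hinj : J e = y := mem_graph_inj (hJ.mem_graph_iff.2 rfl) (hJ.mem_graph_iff.2 rfl) h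
    subst hinj
    exact ⟨e, b, a, rfl, hb, ha, rfl⟩
  · rintro ⟨e, b, a, rfl, hb, ha, rfl⟩
    exact ⟨_, a, ⟨e, b, ⟨_, rfl, rfl⟩, ⟨_, rfl, hb⟩, rfl⟩, ha, rfl⟩

lemma IsBoundedInverse.injective {D : X →ₗ.[ℂ] X} {J : X →L[ℂ] X} (hJ : IsBoundedInverse D J) :
    Function.Injective J := fun _ _ h =>
  mem_graph_inj (hJ.mem_graph_iff.2 rfl) (hJ.mem_graph_iff.2 rfl) h

lemma CommutesWith.mem_graph {A D : X →ₗ.[ℂ] X} {J : X →L[ℂ] X} (hJ : IsBoundedInverse D J)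
    (h : CommutesWith A D) {y a : X} (hy : (y, a) ∈ A.graph) : (J y, J a) ∈ A.graph := by
  have h1 : (J y, a) ∈ (natComp A D).graph :=
    mem_graph_natComp.2 ⟨y, hJ.mem_graph_iff.2 rfl, hy⟩
  obtain ⟨u, hu, hu'⟩ := mem_graph_natComp.1 (mem_graph_le h h1)
  rwa [hJ.mem_graph_iff.1 hu'] at hu

/-- The bounded operator `D R(z, D) = z R(z, D) - 1`. -/
noncomputable def resN (D : X →ₗ.[ℂ] X) (z : ℂ) : X →L[ℂ] X := z • res D z - 1

variable {D : X →ₗ.[ℂ] X} {J : X →L[ℂ] X}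

lemma mul_resN (hJ : IsBoundedInverse D J) {z : ℂ} (hz : z ∈ resSet D) : J * resN D z = res D z := by
  ext y
  have h := isBoundedInverse_boundedInverse hz
  have h1 : (res D z y, y) ∈ (shifted D z).graph := h.mem_graph_iff.2 rfl
  exact (hJ.mem_graph_iff.1 (mem_graph_shifted.1 h1)).symm

lemma resN_mul (hJ : IsBoundedInverse D J) {z : ℂ} (hz : z ∈ resSet D) : resN D z * J = res D z := by
  ext y
  have h := isBoundedInverse_boundedInverse hz
  have h1 : (J y, z • J y - y) ∈ (shifted D z).graph := by
    rw [mem_graph_shifted, hJ.mem_graph_iff]; congr 1; abel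
  have h2 : J y = res D z (z • J y - y) := h.mem_graph_iff.1 h1
  rw [map_sub, map_smul] at h2
  change z • res D z (J y) - J y = res D z y
  rw [eq_sub_iff_add_eq] at h2
  rw [← h2, add_sub_cancel_left]

/-- Since `1 - z J = -(z - D) J`, its inverse is `-N(z)`. The identities for resolvents thereby
become algebra of bounded operators. -/
lemma one_sub_smul_mul_resN (hJ : IsBoundedInverse D J) {z : ℂ} (hz : z ∈ resSet D) :
    (1 - z • J) * resN D z = -1 := by
  rw [sub_mul, one_mul, smul_mul_assoc, mul_resN hJ hz, resN]; abel

lemma resN_mul_one_sub_smul (hJ : IsBoundedInverse D J) {z : ℂ} (hz : z ∈ resSet D) :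
    resN D z * (1 - z • J) = -1 := by
  rw [mul_sub, mul_one, mul_smul_comm, resN_mul hJ hz, resN]; abel

lemma commute_resN (hJ : IsBoundedInverse D J) {z : ℂ} (hz : z ∈ resSet D) {T : X →L[ℂ] X}
    (hT : Commute T J) : Commute T (resN D z) := by
  have h1 : Commute T (1 - z • J) := (Commute.one_right T).sub_right (hT.smul_right z)
  have h2 := one_sub_smul_mul_resN hJ hz
  have h3 := resN_mul_one_sub_smul hJ hz
  have h4 : T * resN D z = -(resN D z * ((1 - z • J) * T) * resN D z) := by
    rw [← mul_assoc, h3]; simp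
  rw [Commute, SemiconjBy, h4, ← h1.eq, mul_assoc, mul_assoc, h2]
  simp

lemma commute_res (hJ : IsBoundedInverse D J) {z : ℂ} (hz : z ∈ resSet D) {T : X →L[ℂ] X}
    (hT : Commute T J) : Commute T (res D z) := by
  rw [← mul_resN hJ hz]; exact hT.mul_right (commute_resN hJ hz hT)

lemma res_sub_res (hJ : IsBoundedInverse D J) {z w : ℂ} (hz : z ∈ resSet D) (hw : w ∈ resSet D) :
    res D z - res D w = (w - z) • (res D z * res D w) := by
  have h1 : res D z * (1 - z • J) = -J := by
    rw [← mul_resN hJ hz, mul_assoc, resN_mul_one_sub_smul hJ hz]; simp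
  have h2 : res D z * (1 - w • J) = -J + (z - w) • (res D z * J) := by
    rw [← h1, mul_sub, mul_sub, sub_smul, mul_smul_comm, mul_smul_comm]; abel
  have h3 := congrArg (· * resN D w) h2
  simp only [mul_assoc, one_sub_smul_mul_resN hJ hw, add_mul, smul_mul_assoc, neg_mul,
    mul_resN hJ hw] at h3
  rw [mul_neg, mul_one] at h3
  rw [← neg_inj, neg_sub, sub_eq_add_neg, h3, ← neg_smul]
  rw [neg_sub]; abel

/-- The resolvent identity for `N = D R`. With `z = -s` it is what makes `N(-s)` computable inside
the contour integrals. -/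
lemma sub_smul_resN_mul_resN (hJ : IsBoundedInverse D J) {z w : ℂ} (hz : z ∈ resSet D)
    (hw : w ∈ resSet D) : (w - z) • (resN D z * resN D w) = z • resN D z - w • resN D w := by
  have h := res_sub_res hJ hz hw
  have : (w - z) • (resN D z * resN D w) = (z * w) • ((w - z) • (res D z * res D w))
      - (w - z) • (z • res D z + w • res D w - 1) := by
    simp only [resN, sub_mul, mul_sub, smul_mul_assoc, mul_smul_comm, one_mul, mul_one]
    module
  rw [this, ← h]
  simp only [resN]
  module

lemma mem_resSet_iff (hJ : IsBoundedInverse D J) {z : ℂ} : z ∈ resSet D ↔ IsUnit (1 - z • J) := by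
  constructor
  · intro hz
    refine ⟨⟨1 - z • J, -resN D z, ?_, ?_⟩, rfl⟩
    · rw [mul_neg, one_sub_smul_mul_resN hJ hz, neg_neg]
    · rw [neg_mul, resN_mul_one_sub_smul hJ hz, neg_neg]
  · rintro ⟨u, hu⟩
    set W : X →L[ℂ] X := ((u⁻¹ : (X →L[ℂ] X)ˣ) : X →L[ℂ] X) with hW
    have h1 : (1 - z • J) * W = 1 := by rw [← hu]; exact u.mul_inv
    have h2 : W * (1 - z • J) = 1 := by rw [← hu]; exact u.inv_mul
    have hJW : J * W = W * J := by
      have hc : Commute (1 - z • J) J :=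
        (Commute.one_left J).sub_left ((Commute.refl J).smul_left z)
      rw [← hu] at hc
      exact (hc.units_inv_left).eq.symm
    -- The factorisation `z - D = -(1 - z J) D` suggests this inverse.
    refine ⟨-(J * W), isBoundedInverse_of_mem_graph_iff fun x y => ?_⟩
    rw [mem_graph_shifted, hJ.mem_graph_iff]
    have e1 : ∀ v, W v - z • J (W v) = v := fun v => by simpa using DFunLike.congr_fun h1 v
    have e2 : ∀ v, W v - z • W (J v) = v := fun v => by simpa using DFunLike.congr_fun h2 v
    have e3 : ∀ v, J (W v) = W (J v) := fun v => DFunLike.congr_fun hJW v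
    constructor
    · intro hx
      change x = -J (W y)
      have h4 : W y = -(z • x - y) := by
        conv_rhs => rw [← e2 (z • x - y), ← hx, map_sub, map_smul]
        abel
      rw [h4, map_neg, neg_neg, ← hx]
    · rintro rfl
      change -J (W y) = J (z • -J (W y) - y)
      have h4 : z • -J (W y) - y = -W y := by
        conv_lhs => rw [← e1 y, e1 y, smul_neg]
        nth_rewrite 2 [← e1 y]
        abel
      rw [h4, map_neg]

variable [CompleteSpace X]

lemma isOpen_resSet (hJ : IsBoundedInverse D J) : IsOpen (resSet D) := by
  have : resSet D = (fun z : ℂ => 1 - z • J) ⁻¹' {T | IsUnit T} := by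
    ext z; exact mem_resSet_iff hJ
  rw [this]
  exact Units.isOpen.preimage (by fun_prop)

lemma zero_mem_resSet (hJ : IsBoundedInverse D J) : (0 : ℂ) ∈ resSet D := by
  rw [mem_resSet_iff hJ]; simp

lemma res_zero (hJ : IsBoundedInverse D J) (h0 : (0 : ℂ) ∈ resSet D) : res D 0 = -J := by
  rw [← mul_resN hJ h0, resN]; simp

lemma differentiableAt_res (hJ : IsBoundedInverse D J) {z : ℂ} (hz : z ∈ resSet D) :
    DifferentiableAt ℂ (res D) z := by
  have h : res D =ᶠ[𝓝 z] fun z => -(J * Ring.inverse (1 - z • J)) := by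
    filter_upwards [(isOpen_resSet hJ).mem_nhds hz] with w hw
    have h1 : Ring.inverse (1 - w • J) = -resN D w := by
      have h3 : (1 - w • J) * -resN D w = 1 := by
        rw [mul_neg, one_sub_smul_mul_resN hJ hw, neg_neg]
      have h4 : -resN D w * (1 - w • J) = 1 := by
        rw [neg_mul, resN_mul_one_sub_smul hJ hw, neg_neg]
      exact Ring.inverse_unit ⟨1 - w • J, -resN D w, h3, h4⟩
    rw [h1, mul_neg, neg_neg, mul_resN hJ hw]
  refine DifferentiableAt.congr_of_eventuallyEq ?_ h
  have h1 : DifferentiableAt ℂ (fun z : ℂ => (1 : X →L[ℂ] X) - z • J) z := by fun_prop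
  have h2 := DifferentiableAt.comp (g := Ring.inverse) z
    (differentiableAt_inverse ((mem_resSet_iff hJ).1 hz)) h1
  exact ((differentiableAt_const J).mul h2).neg

end OperatorTheory

/-! ### The resolvent along a contour -/

section ContourResolvent

variable {X : Type*} [NormedAddCommGroup X] [NormedSpace ℂ X]
  {D : X →ₗ.[ℂ] X} {J : X →L[ℂ] X} {φ₁ φ₂ φ' : ℝ} {γ : ℝ → ℂ}

lemma IsSectorial.mem_resSet (h : IsSectorial D φ₁) {z : ℂ} (hz : z ∉ sector φ₁) :
    z ∈ resSet D := by
  by_contra hn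
  exact hz (h.1 hn)

lemma sector_mono {a b : ℝ} (h : a ≤ b) : sector a ⊆ sector b := by
  rintro z (hz | hz)
  · exact Or.inl (le_trans hz h)
  · exact Or.inr hz

lemma neg_ofReal_notMem_sector {φ s : ℝ} (hφ : φ < Real.pi) (hs : 0 < s) :
    (-(s : ℂ)) ∉ sector φ := by
  rintro (h | h)
  · rw [← Complex.ofReal_neg, mem_ofPred_eq, Complex.arg_ofReal_of_neg (by linarith),
      abs_of_pos Real.pi_pos] at h
    linarith
  · have : (s : ℂ) ≠ 0 := by exact_mod_cast hs.ne'
    simp_all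

lemma IsContour.mem_resSet (h : IsContour D φ₁ φ₂ φ' γ) (hsec : IsSectorial D φ₁) (t : ℝ) :
    γ t ∈ resSet D := by
  obtain ⟨ε, -, hball, hε⟩ := h.surrounds
  by_cases ht : γ t ∈ sector φ₁
  · exact hball (by simpa using hε t ht)
  · exact hsec.mem_resSet ht

lemma IsContour.notMem_sector (h : IsContour D φ₁ φ₂ φ' γ) (h0 : 0 ≤ φ') (hπ : φ' < Real.pi) :
    ∃ r, ∀ t, r < |t| → ∀ ψ < φ', γ t ∉ sector ψ := by
  obtain ⟨r, hr, hl, hu⟩ := h.ends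
  refine ⟨r, fun t ht ψ hψ => ?_⟩
  rcases lt_abs.1 ht with h | h
  · rw [hu t h.le, ← Complex.ofReal_neg, mul_exp_mem_sector_iff (by linarith)
      ⟨by linarith, by linarith⟩, abs_neg, abs_of_nonneg h0]
    linarith
  · rw [hl t (by linarith), mul_exp_mem_sector_iff (by linarith)
      ⟨by linarith, by linarith⟩, abs_of_nonneg h0]
    linarith

variable [CompleteSpace X]

lemma IsContour.continuous_res (h : IsContour D φ₁ φ₂ φ' γ) (hsec : IsSectorial D φ₁)
    (hJ : IsBoundedInverse D J) : Continuous fun t => res D (γ t) :=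
  continuous_iff_continuousAt.2 fun t =>
    ContinuousAt.comp (g := res D) (differentiableAt_res hJ (h.mem_resSet hsec t)).continuousAt
      h.continuous.continuousAt

/-- The rays lie outside a sector of angle strictly between `φ₁` and `φ'`, where sectoriality gives
the bound; the rest of the contour is compact in the resolvent set. -/
lemma IsContour.exists_res_bound (h : IsContour D φ₁ φ₂ φ' γ) (hsec : IsSectorial D φ₁)
    (hJ : IsBoundedInverse D J) (h0 : 0 ≤ φ') (h1 : φ₁ < φ') (hπ : φ' < Real.pi) :
    ∃ C, 0 ≤ C ∧ ∀ t, ‖res D (γ t)‖ ≤ C * ‖γ t‖⁻¹ := by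
  obtain ⟨r, hr⟩ := h.notMem_sector h0 hπ
  obtain ⟨C, hC⟩ := hsec.2 ((φ₁ + φ') / 2) ⟨by linarith, by linarith⟩
  obtain ⟨M, hM⟩ := (isCompact_Icc (a := -r) (b := r)).exists_bound_of_continuousOn
    (h.continuous.smul (h.continuous_res hsec hJ)).continuousOn
  have key : ∀ t, ‖γ t • res D (γ t)‖ ≤ max C M := by
    intro t
    by_cases ht : r < |t|
    · exact (hC _ (hr t ht _ (by linarith))).trans (le_max_left _ _)
    · exact (hM t (abs_le.1 (not_lt.1 ht))).trans (le_max_right _ _)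
  refine ⟨max C M, (norm_nonneg _).trans (key 0), fun t => ?_⟩
  have := key t
  rw [norm_smul] at this
  rw [← div_eq_mul_inv, le_div_iff₀ (norm_pos_iff.2 (h.ne_zero t)), mul_comm]
  exact this

/-- The segment integrals of `z ↦ R(z, D) w` from `0` form a primitive outside the spectrum. -/
lemma hasDerivAt_radialPrimitive_res (hsec : IsSectorial D φ₁) (hJ : IsBoundedInverse D J)
    (h0 : 0 ≤ φ₁) (hπ : φ₁ ≤ Real.pi) {ε : ℝ} (hε : 0 < ε) (hball : Metric.ball 0 ε ⊆ resSet D)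
    (w : X) {z : ℂ} (hz : z ∈ sector φ₁ → ‖z‖ < ε) :
    HasDerivAt (radialPrimitive fun z => res D z w) (res D z w) z := by
  -- This open subset of the resolvent set is star-shaped about `0` and contains the contour, so
  -- segments from `0` never meet the spectrum.
  set V : Set ℂ := (sector φ₁)ᶜ ∪ Metric.ball 0 ε with hV
  have hsc : IsOpen ((sector φ₁)ᶜ) := by
    have : (sector φ₁)ᶜ = {z : ℂ | z.re < ‖z‖ * Real.cos φ₁} := by
      ext z; simp [mem_sector_iff h0 hπ]
    rw [this]
    exact isOpen_lt Complex.continuous_re (by fun_prop)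
  have hVo : IsOpen V := hsc.union Metric.isOpen_ball
  have hVr : V ⊆ resSet D := union_subset (fun z hz => hsec.mem_resSet hz) hball
  have hVs : ∀ z ∈ V, ∀ s ∈ Icc (0 : ℝ) 1, (s : ℂ) * z ∈ V := by
    rintro z hz s ⟨hs0, hs1⟩
    rcases hs0.eq_or_lt with rfl | hs0
    · right; simpa using hε
    rcases hz with hz | hz
    · left
      rw [mem_compl_iff, mem_sector_iff h0 hπ, not_le] at hz ⊢
      rw [norm_mul, Complex.norm_real, Real.norm_of_nonneg hs0.le, Complex.re_ofReal_mul, mul_assoc]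
      gcongr
    · right
      rw [mem_ball_zero_iff] at hz ⊢
      rw [norm_mul, Complex.norm_real, Real.norm_of_nonneg hs0.le]
      nlinarith [norm_nonneg z]
  have hzV : z ∈ V := by
    by_cases h : z ∈ sector φ₁
    · right; simpa using hz h
    · left; exact h
  obtain ⟨r, hr, hrV⟩ := Metric.nhds_basis_closedBall.mem_iff.1 (hVo.mem_nhds hzV)
  have hd : ∀ u ∈ resSet D, DifferentiableAt ℂ (fun z => res D z w) u := fun u hu =>
    (differentiableAt_res hJ hu).clm_apply (differentiableAt_const w)
  have hK : IsCompact ((fun q : ℝ × ℂ => (q.1 : ℂ) * q.2) '' (Icc 0 1 ×ˢ Metric.closedBall z r)) :=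
    (isCompact_Icc.prod (isCompact_closedBall z r)).image (by fun_prop)
  obtain ⟨C, hC⟩ := hK.exists_bound_of_continuousOn (f := fun z => res D z w) (by
    rintro _ ⟨⟨s, u⟩, ⟨hs, hu⟩, rfl⟩
    exact (hd _ (hVr (hVs u (hrV hu) s hs))).continuousAt.continuousWithinAt)
  refine hasDerivAt_radialPrimitive (C := C) hr fun u hu s hs => ?_
  have hu' := Metric.ball_subset_closedBall hu
  have hs' := Ioc_subset_Icc_self hs
  exact ⟨hd _ (hVr (hVs u (hrV hu') s hs')), hC _ ⟨(s, u), ⟨hs', hu'⟩, rfl⟩⟩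

lemma log_mul_exp {s α : ℝ} (hs : 0 < s) (hα : α ∈ Ioc (-Real.pi) Real.pi) :
    Complex.log ((s : ℂ) * Complex.exp (α * Complex.I)) = Real.log s + α * Complex.I := by
  rw [Complex.log_ofReal_mul hs (Complex.exp_ne_zero _), Complex.log_exp] <;> simp [hα.1, hα.2]

/-- The resolvent identity with the point `0`, where `R(0, D) = -J`. It splits off the pole at the
origin, so that `z⁻¹ R(z, D) v` has a primitive consisting of a logarithm and a radial primitive. -/
lemma inv_smul_res_apply (hJ : IsBoundedInverse D J) {z : ℂ} (hz : z ∈ resSet D) (hz0 : z ≠ 0)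
    (v : X) : z⁻¹ • res D z v = z⁻¹ • (-J v) - res D z (-J v) := by
  have h0 := zero_mem_resSet hJ
  have h := DFunLike.congr_fun (res_sub_res hJ hz h0) v
  change res D z v - res D 0 v = (0 - z) • res D z (res D 0 v) at h
  rw [res_zero hJ h0] at h
  change res D z v - -J v = (0 - z) • res D z (-J v) at h
  rw [sub_eq_iff_eq_add.1 h, smul_add, smul_smul, zero_sub, mul_neg, inv_mul_cancel₀ hz0]
  module

/-- The integral `∫ z⁻¹ R(z, D) v dz` is the residue at `0`. -/
lemma IsContour.integral_inv_smul_res (h : IsContour D φ₁ φ₂ φ' γ) (hsec : IsSectorial D φ₁)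
    (hJ : IsBoundedInverse D J) (h0 : 0 ≤ φ₁) (h1 : φ₁ < φ') (h2 : φ₂ ≤ Real.pi)
    (hπ : φ' < Real.pi) (v : X) :
    (Integrable fun t => deriv γ t • ((γ t)⁻¹ • res D (γ t) v)) ∧
      ∫ t, deriv γ t • ((γ t)⁻¹ • res D (γ t) v) = (2 * Real.pi * Complex.I : ℂ) • J v := by
  obtain ⟨C, hC0, hC⟩ := h.exists_res_bound hsec hJ (h0.trans h1.le) h1 hπ
  have hi : Integrable fun t => deriv γ t • ((γ t)⁻¹ • res D (γ t) v) := by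
    refine h.integrable_of_sq (C := C * ‖v‖) ((h.continuous.inv₀ h.ne_zero).smul
      ((h.continuous_res hsec hJ).clm_apply continuous_const)) fun t => ?_
    rw [norm_smul, norm_inv]
    calc ‖γ t‖⁻¹ * ‖res D (γ t) v‖ ≤ ‖γ t‖⁻¹ * (C * ‖γ t‖⁻¹ * ‖v‖) := by
          gcongr
          exact (res D (γ t)).le_of_opNorm_le (hC t) v
      _ = _ := by ring
  refine ⟨hi, ?_⟩
  obtain ⟨ε, hε, hball, hγε⟩ := h.surrounds
  set w : X := -J v with hw
  set P : ℂ → X := radialPrimitive fun z => res D z w with hP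
  have hPd : ∀ z, (z ∈ sector φ₁ → ‖z‖ < ε) → HasDerivAt P (res D z w) z := fun z hz =>
    hasDerivAt_radialPrimitive_res hsec hJ h0 (by linarith) hε hball w hz
  -- the primitive to the left of the contour
  set ψ : ℝ := (φ₁ + φ') / 2 with hψ
  obtain ⟨C', hC'⟩ := hsec.2 ψ ⟨by linarith, by linarith⟩
  have hneg : ∀ z ∈ openSector (Real.pi - ψ), -z ∉ sector ψ := by
    intro z hz
    rw [← neg_mem_openSector_iff (by linarith) (by linarith), neg_neg]; exact hz
  have hneg₁ : ∀ z ∈ openSector (Real.pi - ψ), -z ∉ sector φ₁ := fun z hz hz' =>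
    hneg z hz (sector_mono (by linarith) hz')
  -- Outside the sector of angle `ψ` the integrand is of order `|z|⁻²`, so it also has a primitive
  -- decaying at infinity. The reflection `z ↦ -z` moves this region onto a sector around the
  -- positive axis.
  obtain ⟨G, hG, hGC⟩ := exists_primitive_openSector (φ := Real.pi - ψ) (by linarith) (by linarith)
    (f := fun z => (-z)⁻¹ • res D (-z) v) (C := C' * ‖v‖)
    (by
      intro z hz
      have hd : DifferentiableAt ℂ (fun z => res D (-z)) z :=
        DifferentiableAt.comp (g := res D) z
          (differentiableAt_res hJ (hsec.mem_resSet (hneg₁ z hz))) (by fun_prop)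
      exact ((differentiableAt_id.neg.inv (neg_ne_zero.2 hz.1)).smul
        (hd.clm_apply (differentiableAt_const v))).differentiableWithinAt)
    (by
      intro z hz
      have hz0 : 0 < ‖z‖ := norm_pos_iff.2 hz.1
      have h3 := hC' (-z) (hneg z hz)
      rw [norm_smul, norm_neg] at h3
      rw [norm_smul, norm_inv, norm_neg]
      calc ‖z‖⁻¹ * ‖res D (-z) v‖ ≤ ‖z‖⁻¹ * (‖res D (-z)‖ * ‖v‖) := by
            gcongr; exact (res D (-z)).le_opNorm v
        _ = (‖z‖ * ‖res D (-z)‖) * (‖v‖ * ‖z‖⁻¹ ^ 2) := by field_simp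
        _ ≤ C' * (‖v‖ * ‖z‖⁻¹ ^ 2) := by gcongr
        _ = _ := by ring)
  -- In the reflected region both primitives are available and differ by a constant. This determines
  -- the growth of `P`, which has no direct estimate at infinity.
  have hd0 : ∀ z ∈ openSector (Real.pi - ψ),
      HasDerivAt (fun z => P (-z) - G z - Complex.log z • w) 0 z := by
    intro z hz
    have h3 : HasDerivAt (fun z => P (-z)) ((-1 : ℂ) • res D (-z) w) z :=
      HasDerivAt.scomp (h := fun z : ℂ => -z) z (hPd (-z) fun h => absurd h (hneg₁ z hz))
        (hasDerivAt_neg z)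
    have h4 := (Complex.hasDerivAt_log
      (openSector_subset_slitPlane (by linarith) hz)).smul_const w
    refine ((h3.sub (hG z hz)).sub h4).congr_deriv ?_
    rw [inv_smul_res_apply hJ (hsec.mem_resSet (hneg₁ z hz)) (neg_ne_zero.2 hz.1), inv_neg]
    module
  obtain ⟨c, hc⟩ := IsOpen.exists_is_const_of_deriv_eq_zero (𝕜 := ℂ)
    (isOpen_openSector (φ := Real.pi - ψ) (by linarith) (by linarith))
    (isPreconnected_openSector (by linarith))
    (f := fun z => P (-z) - G z - Complex.log z • w) 
    (fun z hz => (hd0 z hz).differentiableAt.differentiableWithinAt) (fun z hz => (hd0 z hz).deriv)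
  have hF : ∀ t, HasDerivAt (fun z => Complex.log z • w - P z) ((γ t)⁻¹ • res D (γ t) v) (γ t) := by
    intro t
    rw [inv_smul_res_apply hJ (h.mem_resSet hsec t) (h.ne_zero t)]
    exact ((Complex.hasDerivAt_log (openSector_subset_slitPlane h2 (h.mem_sector t))).smul_const
      w).sub (hPd _ (hγε t))
  refine h.integral_eq hi hF ?_
  obtain ⟨r, hr, hl, hu⟩ := h.ends
  -- Two branches of the logarithm occur: the principal one at `z`, cut along the negative axis, and
  -- the one at `-z`, cut along the positive axis. Their mismatch at the two ends produces `2πi`.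
  have hmem : ∀ T, r ≤ T → -γ T ∈ openSector (Real.pi - ψ) ∧ -γ (-T) ∈ openSector (Real.pi - ψ) ∧
      Complex.log (γ T) = Real.log T + (-φ' : ℝ) * Complex.I ∧
      Complex.log (γ (-T)) = Real.log T + φ' * Complex.I ∧
      Complex.log (-γ T) = Real.log T + (Real.pi - φ' : ℝ) * Complex.I ∧
      Complex.log (-γ (-T)) = Real.log T + (-(Real.pi - φ') : ℝ) * Complex.I := by
    intro T hT
    have hT0 : 0 < T := hr.trans_le hT
    have e1 : γ T = (T : ℂ) * Complex.exp ((-φ' : ℝ) * Complex.I) := by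
      rw [hu T hT]; push_cast; rfl
    have e2 : γ (-T) = (T : ℂ) * Complex.exp (φ' * Complex.I) := by
      rw [hl (-T) (by linarith), neg_neg]
    have e3 : -γ T = (T : ℂ) * Complex.exp ((Real.pi - φ' : ℝ) * Complex.I) := by
      rw [e1, show ((Real.pi - φ' : ℝ) : ℂ) * Complex.I
        = Real.pi * Complex.I + (-φ' : ℝ) * Complex.I by push_cast; ring, Complex.exp_add,
        Complex.exp_pi_mul_I]
      ring
    have e4 : -γ (-T) = (T : ℂ) * Complex.exp ((-(Real.pi - φ') : ℝ) * Complex.I) := by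
      rw [e2, show ((-(Real.pi - φ') : ℝ) : ℂ) * Complex.I
        = -(Real.pi * Complex.I) + φ' * Complex.I by push_cast; ring, Complex.exp_add,
        Complex.exp_neg, Complex.exp_pi_mul_I]
      ring
    refine ⟨?_, ?_, ?_, ?_, ?_, ?_⟩
    · rw [e3, mul_exp_mem_openSector_iff hT0 ⟨by linarith, by linarith⟩,
        abs_of_nonneg (by linarith)]
      linarith
    · rw [e4, mul_exp_mem_openSector_iff hT0 ⟨by linarith, by linarith⟩, abs_neg,
        abs_of_nonneg (by linarith)]
      linarith
    · rw [e1, log_mul_exp hT0 ⟨by linarith, by linarith⟩]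
    · rw [e2, log_mul_exp hT0 ⟨by linarith, by linarith⟩]
    · rw [e3, log_mul_exp hT0 ⟨by linarith, by linarith⟩]
    · rw [e4, log_mul_exp hT0 ⟨by linarith, by linarith⟩]
  -- The terms `log T` and the constant `c` cancel. The angles contribute `-π` at the end and `π` at
  -- the beginning, hence `-2πi w = 2πi J v`.
  have hval : ∀ᶠ T : ℝ in atTop, (2 * Real.pi * Complex.I : ℂ) • J v - (G (-γ T) - G (-γ (-T))) =
      (Complex.log (γ T) • w - P (γ T)) - (Complex.log (γ (-T)) • w - P (γ (-T))) := by
    filter_upwards [eventually_ge_atTop r] with T hT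
    obtain ⟨m1, m2, l1, l2, l3, l4⟩ := hmem T hT
    have c1 := hc _ m1
    have c2 := hc _ m2
    simp only [neg_neg, l3, l4] at c1 c2
    rw [l1, l2, ← sub_eq_zero]
    have p1 := eq_add_of_sub_eq (eq_add_of_sub_eq c1)
    have p2 := eq_add_of_sub_eq (eq_add_of_sub_eq c2)
    rw [p1, p2, hw]
    push_cast
    module
  refine Tendsto.congr' hval ?_
  have g1 : Tendsto (fun T : ℝ => G (-γ T)) atTop (𝓝 0) := by
    refine squeeze_zero_norm' (a := fun T => C' * ‖v‖ * ‖γ T‖⁻¹) ?_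
      (by simpa using h.tendsto_norm.1.const_mul (C' * ‖v‖))
    filter_upwards [eventually_ge_atTop r] with T hT
    simpa using hGC _ (hmem T hT).1
  have g2 : Tendsto (fun T : ℝ => G (-γ (-T))) atTop (𝓝 0) := by
    refine squeeze_zero_norm' (a := fun T => C' * ‖v‖ * ‖γ (-T)‖⁻¹) ?_
      (by simpa using h.tendsto_norm.2.const_mul (C' * ‖v‖))
    filter_upwards [eventually_ge_atTop r] with T hT
    simpa using hGC _ (hmem T hT).2.1
  simpa using (tendsto_const_nhds (x := (2 * Real.pi * Complex.I : ℂ) • J v)).sub (g1.sub g2)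

end ContourResolvent

/-! ### Existence of contours -/

section ExistsContour

variable {X : Type*} [NormedAddCommGroup X] [NormedSpace ℂ X] [CompleteSpace X]
  {D : X →ₗ.[ℂ] X} {J : X →L[ℂ] X} {φ₁ φ₂ φ' : ℝ}

/-- The standard keyhole path: in along one ray, across an arc of radius `ε / 2` inside a disc in
the resolvent set, out along the other ray. -/
lemma exists_isContour (hJ : IsBoundedInverse D J) (h0 : 0 ≤ φ₁) (h1 : φ₁ < φ') (h2 : φ' < φ₂)
    (hπ : φ₂ ≤ Real.pi) : ∃ γ, IsContour D φ₁ φ₂ φ' γ := by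
  obtain ⟨ε, hε, hball⟩ := Metric.isOpen_iff.1 (isOpen_resSet hJ) 0 (zero_mem_resSet hJ)
  set r : ℝ := ε / 2 with hr
  have hr0 : 0 < r := by positivity
  -- The argument is `t` rescaled and clamped: it runs from `φ'` to `-φ'` on `[-r, r]` and is
  -- constant on the rays.
  set α : ℝ → ℝ := fun t => -(φ' * max (-1) (min 1 (t / r))) with hα
  set γ : ℝ → ℂ := fun t => ((max |t| r : ℝ) : ℂ) * Complex.exp (α t * Complex.I) with hγ
  have hαabs : ∀ t, |α t| ≤ φ' := by
    intro t
    rw [hα]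
    simp only [abs_neg, abs_mul, abs_of_pos (h0.trans_lt h1)]
    refine mul_le_of_le_one_right (h0.trans h1.le) (abs_le.2 ⟨le_max_left _ _, ?_⟩)
    exact max_le (by norm_num) (min_le_left _ _)
  have hαmem : ∀ t, α t ∈ Ioc (-Real.pi) Real.pi := fun t => by
    have := abs_le.1 (hαabs t)
    constructor <;> linarith
  have hpos : ∀ t : ℝ, 0 < max |t| r := fun t => hr0.trans_le (le_max_right _ _)
  have hlow : ∀ t ≤ -r, γ t = ((-t : ℝ) : ℂ) * Complex.exp ((φ' : ℂ) * Complex.I) := by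
    intro t ht
    have e1 : α t = φ' := by
      have : t / r ≤ -1 := by rw [div_le_iff₀ hr0]; linarith
      simp only [hα]
      rw [min_eq_right (by linarith), max_eq_left this]; ring
    have e2 : max |t| r = -t := by
      rw [abs_of_nonpos (by linarith), max_eq_left (by linarith)]
    simp only [hγ, e1, e2]
  have hupp : ∀ t ≥ r, γ t = (t : ℂ) * Complex.exp (-(φ' : ℂ) * Complex.I) := by
    intro t ht
    have e1 : α t = -φ' := by
      have : 1 ≤ t / r := by rw [le_div_iff₀ hr0]; linarith
      simp only [hα]
      rw [min_eq_left this, max_eq_right (by norm_num)]; ring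
    have e2 : max |t| r = t := by
      rw [abs_of_nonneg (by linarith), max_eq_left (by linarith)]
    simp only [hγ, e1, e2, Complex.ofReal_neg]
  have hmid : ∀ t ∈ Icc (-r) r, γ t = (r : ℂ) * Complex.exp ((-(φ' * (t / r)) : ℝ) * Complex.I) := by
    rintro t ⟨ht1, ht2⟩
    have e1 : α t = -(φ' * (t / r)) := by
      have i1 : t / r ≤ 1 := by rw [div_le_iff₀ hr0]; linarith
      have i2 : -1 ≤ t / r := by rw [le_div_iff₀ hr0]; linarith
      simp only [hα]
      rw [min_eq_right i1, max_eq_right i2]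
    have e2 : max |t| r = r := max_eq_right (abs_le.2 ⟨ht1, ht2⟩)
    simp only [hγ, e1, e2]
  have hofReal : ContDiff ℝ 1 fun t : ℝ => (t : ℂ) := Complex.ofRealCLM.contDiff
  refine ⟨γ, ⟨?_, {-r, r}, ?_⟩, ⟨r, hr0, hlow, hupp⟩, ?_, ε, hε, hball, ?_⟩
  · simp only [hγ, hα]
    fun_prop
  · intro a b hab hdisj
    have hr1 : ¬(a < r ∧ r < b) := fun h => Set.disjoint_left.1 hdisj h (by simp)
    have hr2 : ¬(a < -r ∧ -r < b) := fun h => Set.disjoint_left.1 hdisj h (by simp)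
    by_cases c1 : b ≤ -r
    · refine ContDiffOn.congr (ContDiff.contDiffOn ?_) fun t ht => hlow t (ht.2.trans c1)
      simp only [Complex.ofReal_neg]
      exact hofReal.neg.mul contDiff_const
    by_cases c2 : r ≤ a
    · refine ContDiffOn.congr (ContDiff.contDiffOn ?_) fun t ht => hupp t (c2.trans ht.1)
      exact hofReal.mul contDiff_const
    · have c3 : -r ≤ a := by
        by_contra h; exact hr2 ⟨not_le.1 h, not_le.1 c1⟩
      have c4 : b ≤ r := by
        by_contra h; exact hr1 ⟨not_le.1 c2, not_le.1 h⟩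
      refine ContDiffOn.congr (ContDiff.contDiffOn ?_)
        fun t ht => hmid t ⟨c3.trans ht.1, ht.2.trans c4⟩
      have : ContDiff ℝ 1 fun t : ℝ => ((-(φ' * (t / r)) : ℝ) : ℂ) :=
        hofReal.comp (by fun_prop)
      exact contDiff_const.mul (this.mul contDiff_const).cexp
  · intro t
    exact (mul_exp_mem_openSector_iff (hpos t) (hαmem t)).2 ((hαabs t).trans_lt h2)
  · intro t ht
    have hα' := (mul_exp_mem_sector_iff (hpos t) (hαmem t)).1 ht
    have htr : |t| ≤ r := by
      by_contra hcon
      rcases lt_abs.1 (not_le.1 hcon) with h | h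
      · rw [hupp t h.le, ← Complex.ofReal_neg, mul_exp_mem_sector_iff (by linarith)
          ⟨by linarith, by linarith⟩, abs_neg, abs_of_nonneg (by linarith)] at ht
        linarith
      · rw [hlow t (by linarith), mul_exp_mem_sector_iff (by linarith)
          ⟨by linarith, by linarith⟩, abs_of_nonneg (by linarith)] at ht
        linarith
    simp only [hγ, norm_mul, Complex.norm_exp_ofReal_mul_I, mul_one, max_eq_right htr,
      Complex.norm_real, Real.norm_of_nonneg hr0.le]
    linarith

end ExistsContour

/-! ### The inverse of the pencil -/

section Pencil

variable {X : Type*} [NormedAddCommGroup X] [NormedSpace ℂ X]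

/-- Since a graph is a single-valued linear relation, `x ↦ T (G z x)` is linear, and the bound makes
it continuous because `c z ≠ 0`. -/
lemma UnifBdd.exists_clm {s : Set ℂ} {c : ℂ → ℂ} {T : X →ₗ.[ℂ] X} {G : ℂ → X →L[ℂ] X}
    (h : UnifBdd s c T G) (hc : ∀ z ∈ s, c z ≠ 0) :
    ∃ (C : ℝ) (Q : ℂ → X →L[ℂ] X), 0 ≤ C ∧
      ∀ z ∈ s, (∀ x, (G z x, Q z x) ∈ T.graph) ∧ ‖c z • Q z‖ ≤ C := by
  obtain ⟨C, hC⟩ := h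
  have key : ∀ z ∈ s, ∃ Q : X →L[ℂ] X, (∀ x, (G z x, Q x) ∈ T.graph) ∧ ‖c z • Q‖ ≤ max C 0 := by
    intro z hz
    choose hd hb using hC z hz
    have hg : ∀ x, (G z x, T ⟨G z x, hd x⟩) ∈ T.graph := fun x => T.mem_graph ⟨_, hd x⟩
    let L : X →ₗ[ℂ] X :=
      { toFun := fun x => T ⟨G z x, hd x⟩
        map_add' := fun x y =>
          mem_graph_inj (hg (x + y)) (T.graph.add_mem (hg x) (hg y)) (map_add _ _ _)
        map_smul' := fun a x =>
          mem_graph_inj (hg (a • x)) (T.graph.smul_mem a (hg x)) (map_smul _ _ _) }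
    have hb' : ∀ x, ‖c z • L x‖ ≤ max C 0 * ‖x‖ := fun x =>
      (hb x).trans (by gcongr; exact le_max_left _ _)
    have hL : ∀ x, ‖L x‖ ≤ (max C 0 / ‖c z‖) * ‖x‖ := by
      intro x
      have h1 := hb' x
      rw [norm_smul] at h1
      rw [div_mul_eq_mul_div, le_div_iff₀ (norm_pos_iff.2 (hc z hz)), mul_comm]
      exact h1
    exact ⟨L.mkContinuous _ hL, hg, ContinuousLinearMap.opNorm_le_bound _ (le_max_right _ _) hb'⟩
  choose! Q hQ using key
  exact ⟨max C 0, Q, le_max_right _ _, hQ⟩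

variable {A B D : X →ₗ.[ℂ] X} {J : X →L[ℂ] X} {s : Set ℂ} {H Q P : ℂ → X →L[ℂ] X}

/-- `H z` is the inverse of `z² + z B + A`, and `Q z = B (H z)`, `P z = A (H z)`. -/
structure IsPencilInverse (A B : X →ₗ.[ℂ] X) (s : Set ℂ) (H Q P : ℂ → X →L[ℂ] X) : Prop where
  inv : ∀ z ∈ s, IsBoundedInverse (pencil A B z) (H z)
  graphB : ∀ z ∈ s, ∀ x, (H z x, Q z x) ∈ B.graph
  graphA : ∀ z ∈ s, ∀ x, (H z x, P z x) ∈ A.graph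

namespace IsPencilInverse

lemma left_inv (h : IsPencilInverse A B s H Q P) {z : ℂ} (hz : z ∈ s) {u b a : X}
    (hb : (u, b) ∈ B.graph) (ha : (u, a) ∈ A.graph) : H z (z ^ 2 • u + (z • b + a)) = u :=
  ((h.inv z hz).mem_graph_iff.1 (mem_graph_pencil.2 ⟨b, a, hb, ha, rfl⟩)).symm

lemma right_inv (h : IsPencilInverse A B s H Q P) {z : ℂ} (hz : z ∈ s) (y : X) :
    z ^ 2 • H z y + (z • Q z y + P z y) = y := by
  obtain ⟨b, a, hb, ha, hy⟩ := mem_graph_pencil.1 ((h.inv z hz).mem_graph_iff.2 (rfl : H z y = H z y))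
  rwa [mem_graph_inj hb (h.graphB z hz y) rfl, mem_graph_inj ha (h.graphA z hz y) rfl] at hy

lemma commute (h : IsPencilInverse A B s H Q P)
    (hA : ∀ y a, (y, a) ∈ A.graph → (J y, J a) ∈ A.graph)
    (hB : ∀ y b, (y, b) ∈ B.graph → (J y, J b) ∈ B.graph) {z : ℂ} (hz : z ∈ s) :
    Commute (H z) J ∧ Commute (Q z) J ∧ Commute (P z) J := by
  have h1 : ∀ y, H z (J y) = J (H z y) := by
    intro y
    have := h.left_inv hz (hB _ _ (h.graphB z hz y)) (hA _ _ (h.graphA z hz y))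
    rwa [← J.map_smul, ← J.map_smul, ← J.map_add, ← J.map_add, h.right_inv hz] at this
  refine ⟨ContinuousLinearMap.ext h1, ContinuousLinearMap.ext fun y => ?_,
    ContinuousLinearMap.ext fun y => ?_⟩
  · exact mem_graph_inj (h.graphB z hz (J y)) (hB _ _ (h.graphB z hz y)) (h1 y)
  · exact mem_graph_inj (h.graphA z hz (J y)) (hA _ _ (h.graphA z hz y)) (h1 y)

/-- The resolvent identity of the pencil, `H(z) - H(w) = (w - z) H(z) ((w + z) + B) H(w)`, followed
by `B`. -/
lemma sub_eq (h : IsPencilInverse A B s H Q P) {z w : ℂ} (hz : z ∈ s) (hw : w ∈ s) :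
    Q z - Q w = (w - z) • (Q z * ((w + z) • H w + Q w)) := by
  have h1 : ∀ y, H z y - H w y = (w - z) • H z ((w + z) • H w y + Q w y) := by
    intro y
    have e1 := h.left_inv hz (h.graphB w hw y) (h.graphA w hw y)
    have e2 : y = (z ^ 2 • H w y + (z • Q w y + P w y))
        + (w - z) • ((w + z) • H w y + Q w y) := by
      conv_lhs => rw [← h.right_inv hw y]
      module
    conv_lhs => rw [e2, map_add, e1, map_smul, ← e2]
    abel
  refine ContinuousLinearMap.ext fun y => ?_
  exact mem_graph_inj (B.graph.sub_mem (h.graphB z hz y) (h.graphB w hw y))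
    (B.graph.smul_mem (w - z) (h.graphB z hz ((w + z) • H w y + Q w y))) (h1 y)

/-- Holomorphy of `B H(z)` comes from the identity `Q(z) K(z) = Q(w)` with `K` polynomial in `z` and
`K(w) = 1`, so that `Q(z) = Q(w) K(z)⁻¹` near `w`. -/
lemma differentiableAt_right [CompleteSpace X] (h : IsPencilInverse A B s H Q P) {w : ℂ}
    (hw : s ∈ 𝓝 w) : DifferentiableAt ℂ Q w := by
  have hws : w ∈ s := mem_of_mem_nhds hw
  set K : ℂ → X →L[ℂ] X := fun z => 1 - (w - z) • ((w + z) • H w + Q w) with hK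
  have hKd : DifferentiableAt ℂ K w := by simp only [hK]; fun_prop
  have hKw : IsUnit (K w) := by simp [hK]
  have hunit : ∀ᶠ z in 𝓝 w, IsUnit (K z) :=
    hKd.continuousAt.eventually_mem (Units.isOpen.mem_nhds hKw)
  have heq : Q =ᶠ[𝓝 w] fun z => Q w * Ring.inverse (K z) := by
    filter_upwards [hunit, hw] with z hz hzs
    have h1 : Q z * K z = Q w := by
      have := h.sub_eq hzs hws
      simp only [hK]
      rw [mul_sub, mul_one, mul_smul_comm, ← this]; abel
    rw [← h1, mul_assoc, Ring.mul_inverse_cancel _ hz, mul_one]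
  refine DifferentiableAt.congr_of_eventuallyEq ?_ heq
  exact (differentiableAt_const _).mul
    (DifferentiableAt.comp (g := Ring.inverse) w (differentiableAt_inverse hKw) hKd)

lemma differentiableAt_left [CompleteSpace X] (h : IsPencilInverse A B s H Q P) {w : ℂ}
    (hw : s ∈ 𝓝 w) (hH : DifferentiableAt ℂ H w) : DifferentiableAt ℂ P w := by
  have hQ := h.differentiableAt_right hw
  have heq : P =ᶠ[𝓝 w] fun z => 1 - z ^ 2 • H z - z • Q z := by
    filter_upwards [hw] with z hz
    refine ContinuousLinearMap.ext fun y => ?_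
    have h1 := h.right_inv hz y
    change P z y = y - z ^ 2 • H z y - z • Q z y
    rw [sub_sub, eq_sub_iff_add_eq, ← add_assoc, add_comm (P z y), add_assoc, add_comm (P z y)]
    exact h1
  refine DifferentiableAt.congr_of_eventuallyEq ?_ heq
  have h2 : DifferentiableAt ℂ (fun z : ℂ => z ^ 2) w := by fun_prop
  have h3 : DifferentiableAt ℂ (fun z : ℂ => z) w := by fun_prop
  exact ((differentiableAt_const (1 : X →L[ℂ] X)).sub (h2.smul hH)).sub (h3.smul hQ)

end IsPencilInverse

/-- A closed subspace contains the Bochner integrals of its functions. -/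
lemma integral_mem_of_isClosed {Y : Type*} [NormedAddCommGroup Y] [NormedSpace ℂ Y]
    [CompleteSpace Y] {V : Submodule ℂ Y} (hV : IsClosed (V : Set Y)) {f : ℝ → Y}
    (hf : Integrable f) (h : ∀ t, f t ∈ V) : ∫ t, f t ∈ V := by
  by_contra hn
  obtain ⟨g, u, h1, h2⟩ := RCLike.geometric_hahn_banach_closed_point (𝕜 := ℂ)
    (V.restrictScalars ℝ).convex hV hn
  -- A functional that is bounded above on a subspace vanishes there: otherwise a multiple of `x`
  -- has value `u + 1`.
  have h3 : ∀ x ∈ V, g x = 0 := by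
    intro x hx
    by_contra hne
    have := h1 (((u + 1 : ℝ) / g x) • x) (V.smul_mem _ hx)
    rw [map_smul, smul_eq_mul, div_mul_cancel₀ _ hne] at this
    simp at this
    linarith
  have h4 : g (∫ t, f t) = 0 := by
    rw [← ContinuousLinearMap.integral_comp_comm _ hf]
    simp [h3 _ (h _)]
  have := h1 0 V.zero_mem
  simp [h4] at h2 this
  linarith

/-- A closed operator commutes with the Bochner integral. -/
lemma integral_mem_graph [CompleteSpace X] {T : X →ₗ.[ℂ] X} (hT : T.IsClosed) {f g : ℝ → X}
    (hf : Integrable f) (hg : Integrable g) (h : ∀ t, (f t, g t) ∈ T.graph) :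
    (∫ t, f t, ∫ t, g t) ∈ T.graph := by
  rw [← integral_pair hf hg]
  exact integral_mem_of_isClosed hT (hf.prodMk hg) h

end Pencil

/-! ### Estimates of the K-functional -/

section KFunctional

variable {X : Type*} [NormedAddCommGroup X] [NormedSpace ℂ X] {D : X →ₗ.[ℂ] X} {J : X →L[ℂ] X}

lemma kFun_le {t : ℝ} (ht : 0 < t) (x : X) {b d : X} (h : (b, d) ∈ D.graph) :
    kFun D t x ≤ ‖x - b‖ + t * (‖b‖ + ‖d‖) := by
  obtain ⟨hb, rfl⟩ := mem_graph_iff_exists.1 h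
  exact ciInf_le (kFun_bdd D ht x) ⟨b, hb⟩

lemma le_kFun {t c : ℝ} {x : X} (h : ∀ b d, (b, d) ∈ D.graph → c ≤ ‖x - b‖ + t * (‖b‖ + ‖d‖)) :
    c ≤ kFun D t x :=
  le_ciInf fun b => h _ _ (D.mem_graph b)

lemma kFun_mul_le {t c : ℝ} (ht : 0 < t) (hc : 0 < c) (x : X) :
    kFun D (c * t) x ≤ max 1 c * kFun D t x := by
  have hm : 0 < max 1 c := zero_lt_one.trans_le (le_max_left _ _)
  rw [mul_comm (max 1 c), ← div_le_iff₀ hm]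
  refine le_kFun fun b d h => ?_
  rw [div_le_iff₀ hm]
  refine (kFun_le (by positivity) x h).trans ?_
  rw [add_mul]
  have h1 : ‖x - b‖ ≤ ‖x - b‖ * max 1 c := le_mul_of_one_le_right (norm_nonneg _) (le_max_left _ _)
  have h2 : t * c * (‖b‖ + ‖d‖) ≤ t * (‖b‖ + ‖d‖) * max 1 c := by
    rw [mul_right_comm]
    gcongr
    exact le_max_right _ _
  rw [mul_comm c t]
  exact add_le_add h1 h2

/-- `T` maps `dom D` to itself and commutes with `D` there, so `T b` competes for `T x` whenever `b`
competes for `x`. -/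
lemma kFun_apply_le (hJ : IsBoundedInverse D J) {T : X →L[ℂ] X} (hT : Commute T J) {t : ℝ}
    (ht : 0 < t) (x : X) : kFun D t (T x) ≤ ‖T‖ * kFun D t x := by
  rcases (norm_nonneg T).eq_or_lt with h | h
  · have hT0 : T = 0 := norm_eq_zero.1 h.symm
    have : kFun D t 0 ≤ 0 := by simpa using kFun_smul_le D ht 0 0
    simpa [hT0] using this
  · rw [mul_comm, ← div_le_iff₀ h]
    refine le_kFun fun b d hbd => ?_
    rw [div_le_iff₀ h]
    have hb := hJ.mem_graph_iff.1 hbd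
    have hTb : (T b, T d) ∈ D.graph := by
      rw [hJ.mem_graph_iff, hb]; exact DFunLike.congr_fun hT.eq d
    refine (kFun_le ht _ hTb).trans ?_
    rw [← map_sub]
    have h1 := T.le_opNorm (x - b)
    have h2 := T.le_opNorm b
    have h3 := T.le_opNorm d
    calc ‖T (x - b)‖ + t * (‖T b‖ + ‖T d‖)
        ≤ ‖T‖ * ‖x - b‖ + t * (‖T‖ * ‖b‖ + ‖T‖ * ‖d‖) := by gcongr
      _ = _ := by ring

/-- The competitor is `b = z R(z) y` with `z = -1/t`: then `y - b = -N(z) y` and `D b = z N(z) y`,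
while `‖b‖ ≤ ‖J‖ ‖D b‖`. -/
lemma kFun_le_norm_resN (hJ : IsBoundedInverse D J) {t : ℝ} (ht : 0 < t)
    (hz : -((t⁻¹ : ℝ) : ℂ) ∈ resSet D) (y : X) :
    kFun D t y ≤ (2 + ‖J‖) * ‖resN D (-((t⁻¹ : ℝ) : ℂ)) y‖ := by
  set z : ℂ := -((t⁻¹ : ℝ) : ℂ) with hzdef
  set n : X := resN D z y with hn
  have hzn : ‖z‖ = t⁻¹ := by
    rw [hzdef, norm_neg, Complex.norm_real, Real.norm_of_nonneg (inv_nonneg.2 ht.le)]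
  have h1 : J (z • n) = z • res D z y := by
    rw [map_smul, ← mul_resN hJ hz]; rfl
  have hg : (z • res D z y, z • n) ∈ D.graph := by rw [hJ.mem_graph_iff, h1]
  refine (kFun_le ht y hg).trans ?_
  have e1 : ‖y - z • res D z y‖ = ‖n‖ := by
    rw [← norm_neg]; congr 1; rw [neg_sub]; rfl
  have e2 : ‖z • n‖ = t⁻¹ * ‖n‖ := by rw [norm_smul, hzn]
  have e3 : ‖z • res D z y‖ ≤ ‖J‖ * (t⁻¹ * ‖n‖) := by
    rw [← h1, ← e2]; exact J.le_opNorm _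
  rw [e1, e2]
  calc ‖n‖ + t * (‖z • res D z y‖ + t⁻¹ * ‖n‖)
      ≤ ‖n‖ + t * (‖J‖ * (t⁻¹ * ‖n‖) + t⁻¹ * ‖n‖) := by gcongr
    _ = _ := by field_simp; ring

/-- For each competitor `b`, `N(z) x = N(z)(x - b) + R(z) D b`; the first factor is bounded and the
second is of order `‖z‖⁻¹`. -/
lemma norm_resN_le_kFun (hJ : IsBoundedInverse D J) {z : ℂ} (hz : z ∈ resSet D) (hz0 : z ≠ 0)
    {C : ℝ} (hC : 0 ≤ C) (h : ‖res D z‖ ≤ C * ‖z‖⁻¹) (x : X) :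
    ‖resN D z x‖ ≤ (C + 1) * kFun D ‖z‖⁻¹ x := by
  have hzn : 0 < ‖z‖ := norm_pos_iff.2 hz0
  have hN : ‖resN D z‖ ≤ C + 1 := by
    refine (norm_sub_le _ _).trans (add_le_add ?_ ContinuousLinearMap.norm_id_le)
    rw [norm_smul]
    calc ‖z‖ * ‖res D z‖ ≤ ‖z‖ * (C * ‖z‖⁻¹) := by gcongr
      _ = C := by field_simp
  rw [mul_comm, ← div_le_iff₀ (by positivity)]
  refine le_kFun fun b d hbd => ?_
  rw [div_le_iff₀ (by positivity)]
  have hb := hJ.mem_graph_iff.1 hbd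
  have h1 : resN D z b = res D z d := by rw [hb, ← resN_mul hJ hz]; rfl
  have h2 : resN D z x = resN D z (x - b) + res D z d := by rw [← h1, ← map_add]; simp
  rw [h2]
  calc ‖resN D z (x - b) + res D z d‖ ≤ (C + 1) * ‖x - b‖ + C * ‖z‖⁻¹ * ‖d‖ :=
        (norm_add_le _ _).trans (add_le_add ((resN D z).le_of_opNorm_le hN _)
          ((res D z).le_of_opNorm_le h _))
    _ ≤ (C + 1) * ‖x - b‖ + (C + 1) * ‖z‖⁻¹ * (‖b‖ + ‖d‖) := by
        gcongr
        · linarith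
        · linarith [norm_nonneg b]
    _ = _ := by ring

lemma setLIntegral_haarPos {s : Set ℝ} (hs : MeasurableSet s) (hs0 : s ⊆ Ioi 0) (f : ℝ → ℝ≥0∞) :
    ∫⁻ t in s, f t ∂haarPos = ∫⁻ t in s, ENNReal.ofReal t⁻¹ * f t := by
  rw [haarPos, restrict_withDensity hs, Measure.restrict_restrict hs,
    inter_eq_self_of_subset_left hs0, lintegral_withDensity_eq_lintegral_mul_non_measurable]
  · rfl
  · fun_prop
  · exact Eventually.of_forall fun t => ENNReal.ofReal_lt_top

lemma lintegral_haarPos (f : ℝ → ℝ≥0∞) :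
    ∫⁻ t, f t ∂haarPos = ∫⁻ t in Ioi 0, ENNReal.ofReal t⁻¹ * f t := by
  rw [← setLIntegral_haarPos measurableSet_Ioi subset_rfl,
    Measure.restrict_eq_self_of_ae_mem (s := Ioi 0) ae_haarPos_pos]

/-- Elements of `(X, dom D)_{θ,p}` satisfy `K(t, x) ≤ C t ^ θ`. -/
lemma exists_kFun_le_rpow {θ : ℝ} (hθ : 0 < θ) {p : ℝ≥0∞} (hp : 1 ≤ p) {x : X}
    (hx : MemLp (kWeighted D θ x) p haarPos) : ∃ C, 0 ≤ C ∧ ∀ t, 0 < t → kFun D t x ≤ C * t ^ θ := by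
  set N := eLpNorm (kWeighted D θ x) p haarPos with hN
  have hNtop : N ≠ ∞ := hx.eLpNorm_ne_top
  refine ⟨2 * N.toReal * 2 ^ θ, by positivity, fun t ht => ?_⟩
  set a : ℝ := (2 * t) ^ (-θ) * kFun D t x with ha
  have hK := kFun_nonneg D ht x
  have ha0 : 0 ≤ a := by positivity
  set S : Set ℝ := Ioc t (2 * t)
  have hS0 : S ⊆ Ioi 0 := fun u hu => ht.trans hu.1
  have hμ : ENNReal.ofReal (1 / 2) ≤ haarPos S := by
    have h1 : haarPos S = ∫⁻ u in S, ENNReal.ofReal u⁻¹ := by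
      have := setLIntegral_haarPos measurableSet_Ioc hS0 (fun _ => 1)
      simpa using this
    rw [h1]
    calc ENNReal.ofReal (1 / 2) = ∫⁻ u in S, ENNReal.ofReal (2 * t)⁻¹ := by
          rw [setLIntegral_const, Real.volume_Ioc, ← ENNReal.ofReal_mul (by positivity)]
          congr 1; field_simp; ring
      _ ≤ _ := by
          refine setLIntegral_mono' measurableSet_Ioc fun u hu => ?_
          exact ENNReal.ofReal_le_ofReal (inv_anti₀ (ht.trans hu.1) hu.2)
  have hμ0 : haarPos.restrict S ≠ 0 := by
    rw [Ne, Measure.restrict_eq_zero]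
    intro h
    rw [h] at hμ
    norm_num at hμ
  have hp0 : p ≠ 0 := (zero_lt_one.trans_le hp).ne'
  have h1 : eLpNorm (fun _ : ℝ => a) p (haarPos.restrict S) ≤ N := by
    refine (eLpNorm_mono_ae ?_).trans (eLpNorm_mono_measure _ Measure.restrict_le_self)
    refine (ae_restrict_mem measurableSet_Ioc).mono fun u hu => ?_
    have hu0 : 0 < u := ht.trans hu.1
    rw [Real.norm_of_nonneg ha0, kWeighted, Real.norm_of_nonneg
      (mul_nonneg (Real.rpow_nonneg hu0.le _) (kFun_nonneg D hu0 x))]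
    exact mul_le_mul (Real.rpow_le_rpow_of_nonpos hu0 hu.2 (by linarith))
      (kFun_mono D x ht hu0 hu.1.le) hK (Real.rpow_nonneg hu0.le _)
  rw [eLpNorm_const _ hp0 hμ0, Measure.restrict_apply_univ] at h1
  -- The exponent lies in `[0, 1]`; it is `0` for `p = ∞`, where `p.toReal = 0`.
  have h2 : ENNReal.ofReal (1 / 2) ≤ haarPos S ^ (1 / p.toReal) := by
    have he0 : 0 ≤ 1 / p.toReal := by positivity
    have he1 : 1 / p.toReal ≤ 1 := by
      rcases eq_or_ne p ∞ with rfl | hpt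
      · simp
      · have : 1 ≤ p.toReal := by simpa using ENNReal.toReal_mono hpt hp
        rw [div_le_one (by linarith)]; exact this
    refine le_trans ?_ (ENNReal.rpow_le_rpow hμ he0)
    conv_lhs => rw [← ENNReal.rpow_one (ENNReal.ofReal (1 / 2))]
    exact ENNReal.rpow_le_rpow_of_exponent_ge (by simp) he1
  have h3 : ENNReal.ofReal (a * (1 / 2)) ≤ N := by
    rw [ENNReal.ofReal_mul ha0, ← Real.enorm_of_nonneg ha0]
    exact (mul_le_mul_right h2 _).trans h1
  have h4 : a * (1 / 2) ≤ N.toReal := (ENNReal.ofReal_le_iff_le_toReal hNtop).1 h3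
  have h5 : kFun D t x = a * (2 * t) ^ θ := by
    rw [ha, mul_right_comm, ← Real.rpow_add (by positivity)]; simp
  rw [h5, Real.mul_rpow zero_le_two ht.le]
  calc a * (2 ^ θ * t ^ θ) ≤ (2 * N.toReal) * (2 ^ θ * t ^ θ) := by gcongr; linarith
    _ = _ := by ring

end KFunctional

/-! ### A Schur test and a Hardy inequality -/

section Hardy

/-- **Schur test** for nonnegative kernels. -/
lemma lintegral_rpow_kernel_le {α : Type*} [MeasurableSpace α] {μ : Measure α} [SFinite μ]
    {κ : α → α → ℝ≥0∞} (hκ : Measurable (Function.uncurry κ)) {M : ℝ≥0∞}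
    (h1 : ∀ᵐ t ∂μ, ∫⁻ τ, κ t τ ∂μ ≤ M) (h2 : ∀ᵐ τ ∂μ, ∫⁻ t, κ t τ ∂μ ≤ M)
    {f : α → ℝ} (hf : AEStronglyMeasurable f μ) {p : ℝ} (hp : 1 ≤ p) :
    ∫⁻ t, (∫⁻ τ, κ t τ * ‖f τ‖ₑ ∂μ) ^ p ∂μ ≤ M ^ p * ∫⁻ τ, ‖f τ‖ₑ ^ p ∂μ := by
  have hp0 : 0 < p := by linarith
  have hκt : ∀ t, Measurable (κ t) := fun t => hκ.of_uncurry_left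
  have hfe : AEMeasurable (fun τ => ‖f τ‖ₑ) μ := hf.enorm
  have step : ∀ᵐ t ∂μ, (∫⁻ τ, κ t τ * ‖f τ‖ₑ ∂μ) ^ p ≤
      M ^ (p - 1) * ∫⁻ τ, κ t τ * ‖f τ‖ₑ ^ p ∂μ := by
    filter_upwards [h1] with t ht
    -- Hölder's inequality for the measure with density `κ t`, of total mass at most `M`, gives the
    -- factor `M ^ (p - 1)`. The remaining factor `M` comes from Tonelli's theorem and the other
    -- marginal.
    set ν := μ.withDensity (κ t)
    have hν : AEStronglyMeasurable f ν := hf.mono_ac (withDensity_absolutelyContinuous _ _)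
    have h := eLpNorm'_le_eLpNorm'_mul_rpow_measure_univ (f := f) (μ := ν) one_pos hp hν
    simp only [eLpNorm'_eq_lintegral_enorm, ENNReal.rpow_one, div_one] at h
    have e1 : ∫⁻ τ, ‖f τ‖ₑ ∂ν = ∫⁻ τ, κ t τ * ‖f τ‖ₑ ∂μ :=
      lintegral_withDensity_eq_lintegral_mul₀ (hκt t).aemeasurable hfe
    have e2 : ∫⁻ τ, ‖f τ‖ₑ ^ p ∂ν = ∫⁻ τ, κ t τ * ‖f τ‖ₑ ^ p ∂μ :=
      lintegral_withDensity_eq_lintegral_mul₀ (hκt t).aemeasurable (hfe.pow_const p)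
    have e3 : ν univ ≤ M := by
      rw [withDensity_apply _ MeasurableSet.univ, setLIntegral_univ]; exact ht
    have h3 := ENNReal.rpow_le_rpow h hp0.le
    rw [e1, ENNReal.mul_rpow_of_nonneg _ _ hp0.le, ← ENNReal.rpow_mul,
      ← ENNReal.rpow_mul, e2, one_div, inv_mul_cancel₀ hp0.ne', ENNReal.rpow_one, sub_mul,
      one_mul, inv_mul_cancel₀ hp0.ne'] at h3
    rw [mul_comm]
    refine h3.trans ?_
    gcongr
  have hprod : AEMeasurable (Function.uncurry fun t τ => κ t τ * ‖f τ‖ₑ ^ p) (μ.prod μ) :=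
    hκ.aemeasurable.mul (hfe.comp_snd.pow_const p)
  calc ∫⁻ t, (∫⁻ τ, κ t τ * ‖f τ‖ₑ ∂μ) ^ p ∂μ
      ≤ ∫⁻ t, M ^ (p - 1) * ∫⁻ τ, κ t τ * ‖f τ‖ₑ ^ p ∂μ ∂μ := lintegral_mono_ae step
    _ = M ^ (p - 1) * ∫⁻ τ, ∫⁻ t, κ t τ * ‖f τ‖ₑ ^ p ∂μ ∂μ := by
        rw [← lintegral_lintegral_swap hprod]
        exact lintegral_const_mul'' _ hprod.lintegral_prod_right'
    _ ≤ M ^ (p - 1) * ∫⁻ τ, M * ‖f τ‖ₑ ^ p ∂μ := by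
        gcongr M ^ (p - 1) * ?_
        refine lintegral_mono_ae ?_
        filter_upwards [h2] with τ hτ
        rw [lintegral_mul_const _ hκ.of_uncurry_right]
        gcongr
    _ = M ^ p * ∫⁻ τ, ‖f τ‖ₑ ^ p ∂μ := by
        rw [lintegral_const_mul'' _ (hfe.pow_const p), ← mul_assoc]
        congr 1
        have := ENNReal.rpow_add_of_nonneg (x := M) (p - 1) 1 (by linarith) zero_le_one
        rw [sub_add_cancel, ENNReal.rpow_one] at this
        exact this.symm

/-- The kernel `(τ / t) ^ θ / (1 + τ / t)`. -/
noncomputable def hardyKernel (θ t τ : ℝ) : ℝ≥0∞ :=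
  ENNReal.ofReal ((τ / t) ^ θ * (t / (t + τ)))

lemma measurable_hardyKernel (θ : ℝ) : Measurable (Function.uncurry (hardyKernel θ)) := by
  unfold hardyKernel Function.uncurry
  fun_prop

/-- Exchanging the variables exchanges `θ` and `1 - θ`, so one marginal estimate serves for both. -/
lemma hardyKernel_swap (θ : ℝ) {t τ : ℝ} (ht : 0 < t) (hτ : 0 < τ) :
    hardyKernel θ t τ = hardyKernel (1 - θ) τ t := by
  unfold hardyKernel
  congr 1
  rw [← inv_div τ t, Real.inv_rpow (by positivity), ← Real.rpow_neg (by positivity), neg_sub,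
    Real.rpow_sub_one (by positivity)]
  field_simp
  ring

lemma hardyKernel_le_rpow {θ t τ : ℝ} (ht : 0 < t) (hτ : 0 < τ) :
    hardyKernel θ t τ ≤ ENNReal.ofReal ((τ / t) ^ θ) := by
  refine ENNReal.ofReal_le_ofReal (mul_le_of_le_one_right (by positivity) ?_)
  rw [div_le_one (by positivity)]; linarith

lemma hardyKernel_le_rpow_sub_one {θ t τ : ℝ} (ht : 0 < t) (hτ : 0 < τ) :
    hardyKernel θ t τ ≤ ENNReal.ofReal ((τ / t) ^ (θ - 1)) := by
  refine ENNReal.ofReal_le_ofReal ?_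
  rw [Real.rpow_sub_one (by positivity), div_div_eq_mul_div, mul_div_assoc]
  gcongr
  linarith

lemma setLIntegral_Ioc_hardyKernel_le {θ : ℝ} (hθ : 0 < θ) {t : ℝ} (ht : 0 < t) :
    ∫⁻ τ in Ioc 0 t, hardyKernel θ t τ ∂haarPos ≤ ENNReal.ofReal (1 / θ) := by
  rw [setLIntegral_haarPos measurableSet_Ioc fun u hu => hu.1]
  calc ∫⁻ τ in Ioc 0 t, ENNReal.ofReal τ⁻¹ * hardyKernel θ t τ
      ≤ ∫⁻ τ in Ioc 0 t, ENNReal.ofReal (t ^ (-θ) * τ ^ (θ - 1)) := by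
        refine setLIntegral_mono' measurableSet_Ioc fun τ hτ => ?_
        have hτ0 : 0 < τ := hτ.1
        refine (mul_le_mul_right (hardyKernel_le_rpow ht hτ0) _).trans_eq ?_
        rw [← ENNReal.ofReal_mul (by positivity), Real.div_rpow hτ0.le ht.le,
          Real.rpow_sub_one hτ0.ne', Real.rpow_neg ht.le]
        congr 1; field_simp
    _ = ENNReal.ofReal (∫ τ in (0 : ℝ)..t, t ^ (-θ) * τ ^ (θ - 1)) := by
        rw [intervalIntegral.integral_of_le ht.le, ofReal_integral_eq_lintegral_ofReal]
        · rw [← IntegrableOn, ← intervalIntegrable_iff_integrableOn_Ioc_of_le ht.le]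
          exact (intervalIntegral.intervalIntegrable_rpow' (by linarith)).const_mul _
        · refine (ae_restrict_mem measurableSet_Ioc).mono fun τ hτ => ?_
          have hτ0 : 0 < τ := hτ.1
          simp only [Pi.zero_apply]; positivity
    _ = ENNReal.ofReal (1 / θ) := by
        rw [intervalIntegral.integral_const_mul, integral_rpow (Or.inl (by linarith))]
        congr 1
        rw [sub_add_cancel, Real.zero_rpow hθ.ne', Real.rpow_neg ht.le]
        have := Real.rpow_pos_of_pos ht θ
        field_simp
        simp

lemma setLIntegral_Ioi_hardyKernel_le {θ : ℝ} (hθ : θ < 1) {t δ : ℝ} (ht : 0 < t) (hδ : 0 < δ) :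
    ∫⁻ τ in Ioi δ, hardyKernel θ t τ ∂haarPos ≤
      ENNReal.ofReal ((t / δ) ^ (1 - θ) * (1 / (1 - θ))) := by
  have hsub : Ioi δ ⊆ Ioi 0 := Ioi_subset_Ioi hδ.le
  rw [setLIntegral_haarPos measurableSet_Ioi hsub]
  calc ∫⁻ τ in Ioi δ, ENNReal.ofReal τ⁻¹ * hardyKernel θ t τ
      ≤ ∫⁻ τ in Ioi δ, ENNReal.ofReal (t ^ (1 - θ) * τ ^ (θ - 2)) := by
        refine setLIntegral_mono' measurableSet_Ioi fun τ hτ => ?_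
        have hτ0 : 0 < τ := hsub hτ
        refine (mul_le_mul_right (hardyKernel_le_rpow_sub_one ht hτ0) _).trans_eq ?_
        rw [← ENNReal.ofReal_mul (by positivity), Real.div_rpow hτ0.le ht.le,
          show θ - 2 = θ - 1 - 1 by ring, Real.rpow_sub_one hτ0.ne' (θ - 1),
          show 1 - θ = -(θ - 1) by ring, Real.rpow_neg ht.le]
        congr 1; field_simp
    _ = ENNReal.ofReal (∫ τ in Ioi δ, t ^ (1 - θ) * τ ^ (θ - 2)) := by
        rw [ofReal_integral_eq_lintegral_ofReal]
        · exact (integrableOn_Ioi_rpow_of_lt (by linarith) hδ).const_mul _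
        · refine (ae_restrict_mem measurableSet_Ioi).mono fun τ hτ => ?_
          have hτ0 : 0 < τ := hsub hτ
          simp only [Pi.zero_apply]; positivity
    _ = _ := by
        rw [integral_const_mul, integral_Ioi_rpow_of_lt (by linarith) hδ]
        congr 1
        rw [Real.div_rpow ht.le hδ.le, show θ - 2 + 1 = -(1 - θ) by ring, Real.rpow_neg hδ.le]
        have : 1 - θ ≠ 0 := by linarith
        field_simp

/-- Splitting at `τ = t`: the kernel is dominated by `(τ/t)^θ` below and by `(τ/t)^(θ-1)` above,
integrable for `dτ/τ` at `0` and at infinity respectively. -/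
lemma lintegral_hardyKernel_le {θ : ℝ} (h0 : 0 < θ) (h1 : θ < 1) {t : ℝ} (ht : 0 < t) :
    ∫⁻ τ, hardyKernel θ t τ ∂haarPos ≤ ENNReal.ofReal (1 / θ + 1 / (1 - θ)) := by
  have h2 : 0 < 1 - θ := by linarith
  rw [← Measure.restrict_eq_self_of_ae_mem (s := Ioi 0) ae_haarPos_pos, ← Ioc_union_Ioi_eq_Ioi ht.le,
    lintegral_union measurableSet_Ioi (Set.disjoint_left.2 fun u hu hu' => not_lt.2 hu.2 hu'),
    ENNReal.ofReal_add (by positivity) (by positivity)]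
  refine add_le_add (setLIntegral_Ioc_hardyKernel_le h0 ht) ?_
  simpa [div_self ht.ne'] using setLIntegral_Ioi_hardyKernel_le h1 ht ht

instance : SFinite haarPos := by unfold haarPos; infer_instance

lemma lintegral_Ioi_comp_inv (g : ℝ → ℝ≥0∞) :
    ∫⁻ σ in Ioi (0 : ℝ), g σ = ∫⁻ τ in Ioi (0 : ℝ), ENNReal.ofReal (τ ^ 2)⁻¹ * g τ⁻¹ := by
  have himg : (fun x : ℝ => x⁻¹) '' Ioi 0 = Ioi 0 := by
    ext x
    constructor
    · rintro ⟨y, hy, rfl⟩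
      exact inv_pos.2 (show (0 : ℝ) < y from hy)
    · intro hx
      exact ⟨x⁻¹, inv_pos.2 (show (0 : ℝ) < x from hx), inv_inv x⟩
  conv_lhs => rw [← himg]
  rw [lintegral_image_eq_lintegral_abs_deriv_mul measurableSet_Ioi (f' := fun x => -(x ^ 2)⁻¹)
    (fun x hx => (hasDerivAt_inv (ne_of_gt hx)).hasDerivWithinAt) inv_injective.injOn]
  refine setLIntegral_congr_fun measurableSet_Ioi fun x hx => ?_
  simp only [abs_neg]
  rw [abs_of_nonneg (by positivity)]

lemma lintegral_comp_abs_eq (g : ℝ → ℝ≥0∞) : ∫⁻ σ, g |σ| = 2 * ∫⁻ σ in Ioi (0 : ℝ), g σ := by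
  have h1 : ∫⁻ σ in Ioi (0 : ℝ), g |σ| = ∫⁻ σ in Ioi (0 : ℝ), g σ :=
    setLIntegral_congr_fun measurableSet_Ioi fun σ hσ => by rw [abs_of_pos hσ]
  have h2 : ∫⁻ σ in Iic (0 : ℝ), g |σ| = ∫⁻ σ in Ioi (0 : ℝ), g σ := by
    have himg : (fun x : ℝ => -x) '' Ioi 0 = Iio 0 := by simp
    rw [← setLIntegral_congr Iio_ae_eq_Iic, ← himg,
      lintegral_image_eq_lintegral_abs_deriv_mul measurableSet_Ioi (f' := fun _ => -1)
      (fun x _ => (hasDerivAt_neg x).hasDerivWithinAt) neg_injective.injOn]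
    refine setLIntegral_congr_fun measurableSet_Ioi fun x hx => ?_
    simp [abs_of_pos (show (0 : ℝ) < x from hx)]
  rw [← lintegral_add_compl (fun σ => g |σ|) (measurableSet_Ioi (a := (0 : ℝ))), compl_Ioi, h1, h2,
    two_mul]

end Hardy

/-! ### Boundedness of the Hardy operator on the interpolation spaces -/

section InterpolationEstimates

variable {X : Type*} [NormedAddCommGroup X] [NormedSpace ℂ X] {D : X →ₗ.[ℂ] X}

/-- The estimate `K(t, y) ≤ C ∫₀^∞ K(τ, x) / (1 + τ / t) dτ / τ`. -/
def KDominated (D : X →ₗ.[ℂ] X) (x y : X) : Prop :=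
  ∃ C : ℝ, 0 ≤ C ∧ ∀ t, 0 < t → ENNReal.ofReal (kFun D t y) ≤
    ENNReal.ofReal C * ∫⁻ τ in Ioi 0, ENNReal.ofReal (kFun D τ x * (t / (t + τ) * τ⁻¹))

lemma KDominated.kWeighted_le {x y : X} (h : KDominated D x y) (θ : ℝ) :
    ∃ C : ℝ, 0 ≤ C ∧ ∀ t, 0 < t → ENNReal.ofReal (kWeighted D θ y t) ≤
      ENNReal.ofReal C * ∫⁻ τ, hardyKernel θ t τ * ‖kWeighted D θ x τ‖ₑ ∂haarPos := by
  obtain ⟨C, hC0, hC⟩ := h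
  refine ⟨C, hC0, fun t ht => ?_⟩
  rw [kWeighted, ENNReal.ofReal_mul (Real.rpow_nonneg ht.le _)]
  refine (mul_le_mul_right (hC t ht) _).trans_eq ?_
  rw [mul_left_comm, ← lintegral_const_mul' _ _ ENNReal.ofReal_ne_top, lintegral_haarPos]
  congr 1
  refine setLIntegral_congr_fun measurableSet_Ioi fun τ hτ => ?_
  have hτ0 : (0 : ℝ) < τ := hτ
  have hK := kFun_nonneg D hτ0 x
  have hk : 0 ≤ kWeighted D θ x τ := mul_nonneg (Real.rpow_nonneg hτ0.le _) hK
  simp only [hardyKernel]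
  rw [Real.enorm_of_nonneg hk, ← ENNReal.ofReal_mul (by positivity),
    ← ENNReal.ofReal_mul (by positivity), ← ENNReal.ofReal_mul (by positivity), kWeighted,
    Real.div_rpow hτ0.le ht.le, Real.rpow_neg ht.le, Real.rpow_neg hτ0.le]
  congr 1
  have := Real.rpow_pos_of_pos ht θ
  have := Real.rpow_pos_of_pos hτ0 θ
  field_simp

/-- The Schur test for finite `p`; for `p = ∞` the first marginal of the kernel suffices. -/
lemma KDominated.memLp {x y : X} (h : KDominated D x y) {θ : ℝ} (h0 : 0 < θ) (h1 : θ < 1)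
    {p : ℝ≥0∞} (hp : 1 ≤ p) (hx : MemLp (kWeighted D θ x) p haarPos) :
    MemLp (kWeighted D θ y) p haarPos := by
  refine ⟨kWeighted_aesm D θ y, ?_⟩
  obtain ⟨C, hC0, hC⟩ := h.kWeighted_le θ
  have hle : ∀ᵐ t ∂haarPos, ‖kWeighted D θ y t‖ₑ ≤
      ENNReal.ofReal C * ∫⁻ τ, hardyKernel θ t τ * ‖kWeighted D θ x τ‖ₑ ∂haarPos := by
    filter_upwards [ae_haarPos_pos] with t ht
    have hk : 0 ≤ kWeighted D θ y t :=
      mul_nonneg (Real.rpow_nonneg ht.le _) (kFun_nonneg D ht y)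
    rw [Real.enorm_of_nonneg hk]
    exact hC t ht
  set M : ℝ≥0∞ := ENNReal.ofReal (1 / θ + 1 / (1 - θ)) with hM
  have hM1 : ∀ᵐ t ∂haarPos, ∫⁻ τ, hardyKernel θ t τ ∂haarPos ≤ M := by
    filter_upwards [ae_haarPos_pos] with t ht using lintegral_hardyKernel_le h0 h1 ht
  have hM2 : ∀ᵐ τ ∂haarPos, ∫⁻ t, hardyKernel θ t τ ∂haarPos ≤ M := by
    filter_upwards [ae_haarPos_pos] with τ hτ
    have : ∫⁻ t, hardyKernel θ t τ ∂haarPos = ∫⁻ t, hardyKernel (1 - θ) τ t ∂haarPos := by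
      refine lintegral_congr_ae ?_
      filter_upwards [ae_haarPos_pos] with t ht using hardyKernel_swap θ ht hτ
    rw [this]
    refine (lintegral_hardyKernel_le (by linarith) (by linarith) hτ).trans_eq ?_
    rw [hM, sub_sub_cancel, add_comm]
  rcases eq_or_ne p ∞ with rfl | hpt
  · set N := eLpNorm (kWeighted D θ x) ∞ haarPos with hN
    have hNtop : N < ∞ := hx.eLpNorm_lt_top
    refine lt_of_le_of_lt (b := ENNReal.ofReal C * (M * N)) ?_
      (ENNReal.mul_lt_top ENNReal.ofReal_lt_top (ENNReal.mul_lt_top ENNReal.ofReal_lt_top hNtop))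
    rw [eLpNorm_exponent_top]
    refine essSup_le_of_ae_le _ ?_
    filter_upwards [hle, hM1] with t ht hMt
    refine ht.trans ?_
    gcongr ENNReal.ofReal C * ?_
    calc ∫⁻ τ, hardyKernel θ t τ * ‖kWeighted D θ x τ‖ₑ ∂haarPos
        ≤ ∫⁻ τ, hardyKernel θ t τ * N ∂haarPos := by
          refine lintegral_mono_ae ?_
          filter_upwards [enorm_ae_le_eLpNormEssSup (kWeighted D θ x) haarPos] with τ hτ
          gcongr
          rw [hN, eLpNorm_exponent_top]; exact hτ
      _ = (∫⁻ τ, hardyKernel θ t τ ∂haarPos) * N :=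
          lintegral_mul_const _ (measurable_hardyKernel θ).of_uncurry_left
      _ ≤ M * N := by gcongr
  · have hp0 : p ≠ 0 := (zero_lt_one.trans_le hp).ne'
    have hpr : 1 ≤ p.toReal := by simpa using ENNReal.toReal_mono hpt hp
    rw [eLpNorm_lt_top_iff_lintegral_rpow_enorm_lt_top hp0 hpt]
    have hx' := (eLpNorm_lt_top_iff_lintegral_rpow_enorm_lt_top hp0 hpt).1 hx.eLpNorm_lt_top
    have hsch := lintegral_rpow_kernel_le (measurable_hardyKernel θ) hM1 hM2
      (kWeighted_aesm D θ x) hpr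
    calc ∫⁻ t, ‖kWeighted D θ y t‖ₑ ^ p.toReal ∂haarPos
        ≤ ∫⁻ t, (ENNReal.ofReal C * ∫⁻ τ, hardyKernel θ t τ * ‖kWeighted D θ x τ‖ₑ ∂haarPos)
            ^ p.toReal ∂haarPos := by
          refine lintegral_mono_ae ?_
          filter_upwards [hle] with t ht
          gcongr
      _ = ENNReal.ofReal C ^ p.toReal *
            ∫⁻ t, (∫⁻ τ, hardyKernel θ t τ * ‖kWeighted D θ x τ‖ₑ ∂haarPos)
              ^ p.toReal ∂haarPos := by
          rw [← lintegral_const_mul' _ _ (ENNReal.rpow_ne_top_of_nonneg (by linarith)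
            ENNReal.ofReal_ne_top)]
          congr 1; ext t
          rw [ENNReal.mul_rpow_of_nonneg _ _ (by linarith)]
      _ ≤ ENNReal.ofReal C ^ p.toReal *
            (M ^ p.toReal * ∫⁻ τ, ‖kWeighted D θ x τ‖ₑ ^ p.toReal ∂haarPos) := by gcongr
      _ < ∞ := by
          refine ENNReal.mul_lt_top ?_ (ENNReal.mul_lt_top ?_ hx')
          · exact ENNReal.rpow_lt_top_of_nonneg (by linarith) ENNReal.ofReal_ne_top
          · exact ENNReal.rpow_lt_top_of_nonneg (by linarith) ENNReal.ofReal_ne_top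

/-- Near `0` the weighted function of `x` is small and the kernel has bounded mass; away from `0`
that function is bounded and the mass of the kernel tends to `0` with `t`. -/
lemma KDominated.tendsto {x y : X} (h : KDominated D x y) {θ : ℝ} (h0 : 0 < θ) (h1 : θ < 1)
    {N : ℝ} (hN : 0 ≤ N) (hb : ∀ t, 0 < t → kWeighted D θ x t ≤ N)
    (hx : Tendsto (kWeighted D θ x) (𝓝[>] 0) (𝓝 0)) :
    Tendsto (kWeighted D θ y) (𝓝[>] 0) (𝓝 0) := by
  obtain ⟨C, hC0, hC⟩ := h.kWeighted_le θ
  have h2 : 0 < 1 - θ := by linarith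
  have hnn : ∀ x : X, ∀ t, 0 < t → 0 ≤ kWeighted D θ x t := fun x t ht =>
    mul_nonneg (Real.rpow_nonneg ht.le _) (kFun_nonneg D ht x)
  set M : ℝ := 1 / θ + 1 / (1 - θ) with hM
  have hM0 : 0 < M := by positivity
  have key : ∀ ε, 0 < ε → ∃ δ, 0 < δ ∧ ∀ t, 0 < t →
      kWeighted D θ y t ≤ C * (M * ε + (t / δ) ^ (1 - θ) * (1 / (1 - θ)) * N) := by
    intro ε hε
    have hev : ∀ᶠ t in 𝓝[>] (0 : ℝ), kWeighted D θ x t < ε := hx.eventually (gt_mem_nhds hε)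
    obtain ⟨δ, hδ, hsub⟩ := mem_nhdsGT_iff_exists_Ioc_subset.1 hev
    have hδ0 : 0 < δ := hδ
    refine ⟨δ, hδ0, fun t ht => ?_⟩
    have hA : ∫⁻ τ in Ioc 0 δ, hardyKernel θ t τ * ‖kWeighted D θ x τ‖ₑ ∂haarPos ≤
        ENNReal.ofReal (M * ε) := by
      calc ∫⁻ τ in Ioc 0 δ, hardyKernel θ t τ * ‖kWeighted D θ x τ‖ₑ ∂haarPos
          ≤ ∫⁻ τ in Ioc 0 δ, hardyKernel θ t τ * ENNReal.ofReal ε ∂haarPos := by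
            refine setLIntegral_mono' measurableSet_Ioc fun τ hτ => ?_
            gcongr
            rw [Real.enorm_of_nonneg (hnn x τ hτ.1)]
            exact ENNReal.ofReal_le_ofReal (hsub hτ).le
        _ = (∫⁻ τ in Ioc 0 δ, hardyKernel θ t τ ∂haarPos) * ENNReal.ofReal ε :=
            lintegral_mul_const _ (measurable_hardyKernel θ).of_uncurry_left
        _ ≤ ENNReal.ofReal M * ENNReal.ofReal ε := by
            gcongr
            exact (setLIntegral_le_lintegral _ _).trans (lintegral_hardyKernel_le h0 h1 ht)
        _ = _ := by rw [ENNReal.ofReal_mul hM0.le]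
    have hB : ∫⁻ τ in Ioi δ, hardyKernel θ t τ * ‖kWeighted D θ x τ‖ₑ ∂haarPos ≤
        ENNReal.ofReal ((t / δ) ^ (1 - θ) * (1 / (1 - θ)) * N) := by
      calc ∫⁻ τ in Ioi δ, hardyKernel θ t τ * ‖kWeighted D θ x τ‖ₑ ∂haarPos
          ≤ ∫⁻ τ in Ioi δ, hardyKernel θ t τ * ENNReal.ofReal N ∂haarPos := by
            refine setLIntegral_mono' measurableSet_Ioi fun τ hτ => ?_
            have hτ0 : 0 < τ := hδ0.trans hτ
            gcongr
            rw [Real.enorm_of_nonneg (hnn x τ hτ0)]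
            exact ENNReal.ofReal_le_ofReal (hb τ hτ0)
        _ = (∫⁻ τ in Ioi δ, hardyKernel θ t τ ∂haarPos) * ENNReal.ofReal N :=
            lintegral_mul_const _ (measurable_hardyKernel θ).of_uncurry_left
        _ ≤ _ := by
            rw [ENNReal.ofReal_mul (by positivity)]
            gcongr
            exact setLIntegral_Ioi_hardyKernel_le h1 ht hδ0
    have hsplit := hC t ht
    rw [← Measure.restrict_eq_self_of_ae_mem (s := Ioi 0) ae_haarPos_pos,
      ← Ioc_union_Ioi_eq_Ioi hδ0.le, lintegral_union measurableSet_Ioi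
      (Set.disjoint_left.2 fun u hu hu' => not_lt.2 hu.2 hu')] at hsplit
    have h3 := hsplit.trans (mul_le_mul_right (add_le_add hA hB) _)
    rw [← ENNReal.ofReal_add (by positivity) (by positivity), ← ENNReal.ofReal_mul hC0] at h3
    exact (ENNReal.ofReal_le_ofReal_iff (by positivity)).1 h3
  rw [Metric.tendsto_nhdsWithin_nhds]
  intro η hη
  -- The summand `1` keeps the denominator positive when `C = 0`.
  obtain ⟨δ, hδ, hy⟩ := key (η / (2 * (C * M + 1))) (by positivity)
  have hlim : Tendsto (fun t : ℝ => C * ((t / δ) ^ (1 - θ) * (1 / (1 - θ)) * N)) (𝓝 0) (𝓝 0) := by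
    have : ContinuousAt (fun t : ℝ => C * ((t / δ) ^ (1 - θ) * (1 / (1 - θ)) * N)) 0 := by
      have : ContinuousAt (fun t : ℝ => (t / δ) ^ (1 - θ)) 0 :=
        ContinuousAt.rpow_const (by fun_prop) (Or.inr h2.le)
      fun_prop
    simpa [ContinuousAt, Real.zero_rpow h2.ne'] using this
  obtain ⟨r, hr, hball⟩ := Metric.tendsto_nhds_nhds.1 hlim (η / 2) (by positivity)
  refine ⟨r, hr, fun {t} ht htr => ?_⟩
  have ht0 : 0 < t := ht
  have h4 := hball htr
  rw [Real.dist_eq, sub_zero] at h4 ⊢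
  rw [abs_of_nonneg (hnn y t ht0)]
  have h5 := hy t ht0
  have h6 : C * (M * (η / (2 * (C * M + 1)))) ≤ η / 2 := by
    rw [← mul_assoc, mul_div_assoc', div_le_div_iff₀ (by positivity) (by positivity)]
    nlinarith [mul_nonneg hC0 hM0.le]
  rw [mul_add] at h5
  linarith [le_abs_self (C * ((t / δ) ^ (1 - θ) * (1 / (1 - θ)) * N))]

end InterpolationEstimates

/-! ### The contour integral `S`: left inverse and regularity estimate -/

section SumSetting

/-- The hypotheses of the theorem on the operators and the contour, with `J = D⁻¹`,
`H z = (z² + z B + A)⁻¹`, `Q z = B (H z)`, `P z = A (H z)`, all bounds being by one constant `C`. -/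
structure SumSetting {X : Type*} [NormedAddCommGroup X] [NormedSpace ℂ X] (A B D : X →ₗ.[ℂ] X)
    (J : X →L[ℂ] X) (φ₁ φ₂ φ' : ℝ) (γ : ℝ → ℂ) (H Q P : ℂ → X →L[ℂ] X) (C : ℝ) : Prop where
  closedA : A.IsClosed
  closedB : B.IsClosed
  inv : IsBoundedInverse D J
  commA : ∀ y a, (y, a) ∈ A.graph → (J y, J a) ∈ A.graph
  commB : ∀ y b, (y, b) ∈ B.graph → (J y, J b) ∈ B.graph
  sectorial : IsSectorial D φ₁
  nonneg : 0 ≤ φ₁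
  lt_angle : φ₁ < φ'
  angle_lt : φ' < φ₂
  lt_pi : φ₂ < Real.pi
  contour : IsContour D φ₁ φ₂ φ' γ
  pencil : IsPencilInverse A B (sector φ₂ \ {0}) H Q P
  holo : DifferentiableOn ℂ H (openSector φ₂)
  norm_sq_le : ∀ z ∈ openSector φ₂, ‖z ^ 2 • H z‖ ≤ C
  norm_inv_le : ∀ z ∈ openSector φ₂, ‖H z‖ ≤ C
  norm_right_le : ∀ z ∈ openSector φ₂, ‖z • Q z‖ ≤ C
  norm_left_le : ∀ z ∈ openSector φ₂, ‖P z‖ ≤ C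

namespace SumSetting

variable {X : Type*} [NormedAddCommGroup X] [NormedSpace ℂ X] [CompleteSpace X]
  {A B D : X →ₗ.[ℂ] X} {J : X →L[ℂ] X} {φ₁ φ₂ φ' : ℝ} {γ : ℝ → ℂ} {H Q P : ℂ → X →L[ℂ] X} {C : ℝ}

lemma nonneg₂ (h : SumSetting A B D J φ₁ φ₂ φ' γ H Q P C) : 0 ≤ φ₂ :=
  (h.nonneg.trans h.lt_angle.le).trans h.angle_lt.le

lemma mem_resSet (h : SumSetting A B D J φ₁ φ₂ φ' γ H Q P C) (t : ℝ) : γ t ∈ resSet D :=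
  h.contour.mem_resSet h.sectorial t

lemma neg_mem_resSet (h : SumSetting A B D J φ₁ φ₂ φ' γ H Q P C) {s : ℝ} (hs : 0 < s) :
    -(s : ℂ) ∈ resSet D :=
  h.sectorial.mem_resSet (neg_ofReal_notMem_sector
    ((h.lt_angle.trans h.angle_lt).trans h.lt_pi) hs)

lemma isOpen (h : SumSetting A B D J φ₁ φ₂ φ' γ H Q P C) : IsOpen (openSector φ₂) :=
  isOpen_openSector h.nonneg₂ h.lt_pi.le

lemma norm_le_sq (h : SumSetting A B D J φ₁ φ₂ φ' γ H Q P C) {z : ℂ} (hz : z ∈ openSector φ₂) :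
    ‖H z‖ ≤ C * ‖z‖⁻¹ ^ 2 := by
  have hz0 : 0 < ‖z‖ := norm_pos_iff.2 hz.1
  have h1 := h.norm_sq_le z hz
  rw [norm_smul, norm_pow] at h1
  rw [inv_pow, ← div_eq_mul_inv, le_div_iff₀ (by positivity), mul_comm]
  exact h1

/-- Boundedness of `H` is used for small `z` and the decay `|z|⁻²` for large `z`. This makes `z⁻¹
H(z)` of order `|z|⁻²` on the whole sector, as its primitive requires. -/
lemma norm_le_inv (h : SumSetting A B D J φ₁ φ₂ φ' γ H Q P C) {z : ℂ} (hz : z ∈ openSector φ₂) :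
    ‖H z‖ ≤ C * ‖z‖⁻¹ := by
  have hz0 : 0 < ‖z‖ := norm_pos_iff.2 hz.1
  have h1 := h.norm_le_sq hz
  have h2 := h.norm_inv_le z hz
  have hC : 0 ≤ C := (norm_nonneg _).trans h2
  rcases le_total 1 ‖z‖⁻¹ with h3 | h3
  · exact h2.trans (le_mul_of_one_le_right hC h3)
  · refine h1.trans ?_
    gcongr
    rw [sq]
    exact mul_le_of_le_one_right (by positivity) h3

lemma commute_pencil (h : SumSetting A B D J φ₁ φ₂ φ' γ H Q P C) {z : ℂ}
    (hz : z ∈ openSector φ₂) : Commute (H z) J ∧ Commute (Q z) J ∧ Commute (P z) J :=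
  h.pencil.commute h.commA h.commB (openSector_subset_sector _ hz)

lemma continuous_pencilInv (h : SumSetting A B D J φ₁ φ₂ φ' γ H Q P C) :
    Continuous fun t => H (γ t) :=
  h.holo.continuousOn.comp_continuous h.contour.continuous h.contour.mem_sector

lemma continuous_res (h : SumSetting A B D J φ₁ φ₂ φ' γ H Q P C) :
    Continuous fun t => res D (γ t) :=
  h.contour.continuous_res h.sectorial h.inv

lemma continuous_resN (h : SumSetting A B D J φ₁ φ₂ φ' γ H Q P C) :
    Continuous fun t => resN D (γ t) :=
  (h.contour.continuous.smul h.continuous_res).sub continuous_const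

lemma exists_res_bound (h : SumSetting A B D J φ₁ φ₂ φ' γ H Q P C) :
    ∃ K, 0 ≤ K ∧ ∀ t, ‖res D (γ t)‖ ≤ K * ‖γ t‖⁻¹ :=
  h.contour.exists_res_bound h.sectorial h.inv (h.nonneg.trans h.lt_angle.le) h.lt_angle
    (h.angle_lt.trans h.lt_pi)

lemma pencilInv_resN (h : SumSetting A B D J φ₁ φ₂ φ' γ H Q P C) (t : ℝ) (x : X) :
    H (γ t) (resN D (γ t) x) = resN D (γ t) (H (γ t) x) :=
  DFunLike.congr_fun (commute_resN h.inv (h.mem_resSet t)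
    (h.commute_pencil (h.contour.mem_sector t)).1).eq x

lemma pencilInv_res (h : SumSetting A B D J φ₁ φ₂ φ' γ H Q P C) (t : ℝ) (x : X) :
    H (γ t) (res D (γ t) x) = res D (γ t) (H (γ t) x) :=
  DFunLike.congr_fun (commute_res h.inv (h.mem_resSet t)
    (h.commute_pencil (h.contour.mem_sector t)).1).eq x

/-- `∫ H(z) x dz = 0`. -/
lemma integral_pencilInv (h : SumSetting A B D J φ₁ φ₂ φ' γ H Q P C) (x : X) :
    (Integrable fun t => deriv γ t • H (γ t) x) ∧ ∫ t, deriv γ t • H (γ t) x = 0 := by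
  refine h.contour.integral_eq_zero (f := fun z => H z x) (C := C * ‖x‖) h.nonneg₂ h.lt_pi.le
    (h.holo.clm_apply (differentiableOn_const x)) fun z hz => ?_
  refine ((H z).le_of_opNorm_le (h.norm_le_sq hz) x).trans_eq (by ring)

/-- `∫ z⁻¹ H(z) x dz = 0`. -/
lemma integral_inv_smul_pencilInv (h : SumSetting A B D J φ₁ φ₂ φ' γ H Q P C) (x : X) :
    (Integrable fun t => deriv γ t • (γ t)⁻¹ • H (γ t) x) ∧
      ∫ t, deriv γ t • (γ t)⁻¹ • H (γ t) x = 0 := by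
  refine h.contour.integral_eq_zero (f := fun z => z⁻¹ • H z x) (C := C * ‖x‖) h.nonneg₂ h.lt_pi.le
    ((differentiableOn_inv.mono fun z hz => hz.1).smul
      (h.holo.clm_apply (differentiableOn_const x))) fun z hz => ?_
  rw [norm_smul, norm_inv]
  calc ‖z‖⁻¹ * ‖H z x‖ ≤ ‖z‖⁻¹ * (C * ‖z‖⁻¹ * ‖x‖) := by
        gcongr; exact (H z).le_of_opNorm_le (h.norm_le_inv hz) x
    _ = _ := by ring

lemma integrable_res_mul_pencilInv (h : SumSetting A B D J φ₁ φ₂ φ' γ H Q P C) :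
    Integrable fun t => deriv γ t • (res D (γ t) * H (γ t)) := by
  obtain ⟨K, hK0, hK⟩ := h.exists_res_bound
  refine h.contour.integrable_of_sq (C := K * C) (h.continuous_res.mul h.continuous_pencilInv)
    fun t => ?_
  refine (norm_mul_le _ _).trans ?_
  calc ‖res D (γ t)‖ * ‖H (γ t)‖ ≤ (K * ‖γ t‖⁻¹) * (C * ‖γ t‖⁻¹) := by
        gcongr
        · exact hK t
        · exact h.norm_le_inv (h.contour.mem_sector t)
    _ = _ := by ring

lemma integrable_smul_res_mul_pencilInv (h : SumSetting A B D J φ₁ φ₂ φ' γ H Q P C) (x : X) :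
    Integrable fun t => deriv γ t • γ t • res D (γ t) (H (γ t) x) := by
  obtain ⟨K, hK0, hK⟩ := h.exists_res_bound
  refine h.contour.integrable_of_sq (C := K * C * ‖x‖) (h.contour.continuous.smul
    (h.continuous_res.clm_apply (h.continuous_pencilInv.clm_apply continuous_const))) fun t => ?_
  have hz0 : 0 < ‖γ t‖ := norm_pos_iff.2 (h.contour.ne_zero t)
  rw [norm_smul]
  calc ‖γ t‖ * ‖res D (γ t) (H (γ t) x)‖
      ≤ ‖γ t‖ * (K * ‖γ t‖⁻¹ * (C * ‖γ t‖⁻¹ ^ 2 * ‖x‖)) := by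
        gcongr
        refine ((res D (γ t)).le_of_opNorm_le (hK t) _).trans ?_
        gcongr
        exact (H (γ t)).le_of_opNorm_le (h.norm_le_sq (h.contour.mem_sector t)) x
    _ = _ := by field_simp

variable (D γ H) in
/-- The operator `(2πi)⁻¹ ∫ R(z, D) H(z) dz`. -/
noncomputable def solution : X →L[ℂ] X :=
  (2 * Real.pi * Complex.I : ℂ)⁻¹ • ∫ t, deriv γ t • (res D (γ t) * H (γ t))

lemma two_pi_I_ne_zero : (2 * Real.pi * Complex.I : ℂ) ≠ 0 := by
  simp [Real.pi_ne_zero]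

lemma integrable_apply (h : SumSetting A B D J φ₁ φ₂ φ' γ H Q P C) (x : X) :
    Integrable fun t => deriv γ t • res D (γ t) (H (γ t) x) :=
  (ContinuousLinearMap.apply ℂ X x).integrable_comp h.integrable_res_mul_pencilInv

lemma solution_apply (h : SumSetting A B D J φ₁ φ₂ φ' γ H Q P C) (x : X) :
    solution D γ H x =
      (2 * Real.pi * Complex.I : ℂ)⁻¹ • ∫ t, deriv γ t • res D (γ t) (H (γ t) x) := by
  change (2 * Real.pi * Complex.I : ℂ)⁻¹ • (∫ t, deriv γ t • (res D (γ t) * H (γ t))) x = _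
  rw [ContinuousLinearMap.integral_apply h.integrable_res_mul_pencilInv]
  rfl

lemma commute_solution (h : SumSetting A B D J φ₁ φ₂ φ' γ H Q P C) :
    Commute (solution D γ H) J := by
  refine ContinuousLinearMap.ext fun x => ?_
  change solution D γ H (J x) = J (solution D γ H x)
  rw [h.solution_apply, h.solution_apply, map_smul, ← ContinuousLinearMap.integral_comp_comm _
    (h.integrable_apply x)]
  congr 2
  ext t
  have h1 : Commute (res D (γ t)) J :=
    (commute_res h.inv (h.mem_resSet t) (Commute.refl J)).symm
  have h2 := (h.commute_pencil (h.contour.mem_sector t)).1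
  have h3 : res D (γ t) (H (γ t) (J x)) = J (res D (γ t) (H (γ t) x)) :=
    DFunLike.congr_fun (h1.mul_left h2).eq x
  rw [h3, map_smul]

/-- `(2πi)⁻¹ ∫ R(z, D) H(z) dz` is a left inverse of `D² + B D + A`. -/
lemma solution_left_inv (h : SumSetting A B D J φ₁ φ₂ φ' γ H Q P C) {x v : X}
    (hx : (x, v) ∈ (sumOp A B D).graph) : solution D γ H v = x := by
  obtain ⟨e, b, a, hxe, hb, ha, hv⟩ := (mem_graph_sumOp h.inv).1 hx
  have hb' : (x, J b) ∈ B.graph := by rw [hxe]; exact h.commB _ _ hb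
  -- Here `e = D² x`, `J e = D x`, `b = B D x`, `J b = B x` and `a = A x`.
  have key : ∀ t, deriv γ t • res D (γ t) (H (γ t) v) =
      deriv γ t • (γ t)⁻¹ • res D (γ t) (J e) +
        (deriv γ t • (γ t)⁻¹ • H (γ t) a - deriv γ t • H (γ t) (J e)) := by
    intro t
    have hz := h.contour.mem_sector t
    have hz0 := h.contour.ne_zero t
    set z := γ t with hzt
    have hr : ∀ y, res D z (z • J y - y) = J y := by
      intro y
      have h1 : resN D z (J y) = res D z y := DFunLike.congr_fun (resN_mul h.inv (h.mem_resSet t)) y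
      change z • res D z (J y) - J y = res D z y at h1
      rw [map_sub, map_smul, ← h1]; abel
    have hH := h.pencil.left_inv (openSector_subset_sector _ hz) hb' ha
    -- This is `D² + DB + A = (z² + zB + A) - (z - D)(z + D) - (z - D)B`: the pencil absorbs `H(z)`
    -- and the factors `z - D` absorb `R(z)`.
    have e1 : v = (z ^ 2 • x + (z • J b + a)) - (z • J (z • J e + e) - (z • J e + e))
        - (z • J b - b) := by
      rw [← hv, hxe, map_add, map_smul]; module
    have e2 : res D z (H z v) = res D z x - H z (z • x + J e) - H z (J b) := by
      have r1 : res D z v = res D z (z ^ 2 • x + (z • J b + a)) - J (z • J e + e) - J b := by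
        conv_lhs => rw [e1, map_sub, map_sub, hr, hr]
      have r2 : J (z • J e + e) = z • x + J e := by rw [map_add, map_smul, ← hxe]
      rw [← h.pencilInv_res t v, ← hzt, r1, r2, map_sub, map_sub, hzt, h.pencilInv_res t, ← hzt, hH]
    have e3 : res D z x = z⁻¹ • res D z (J e) + z⁻¹ • x := by
      have := hr (J e)
      rw [← hxe, map_sub, map_smul, sub_eq_iff_eq_add] at this
      rw [← smul_add, add_comm, ← this, smul_smul, inv_mul_cancel₀ hz0, one_smul]
    -- From `z (z + B) = (z² + zB + A) - A`. The term `z⁻¹ x` cancels against the one in `e3`.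
    have e4 : H z (z • x) + H z (J b) = z⁻¹ • x - z⁻¹ • H z a := by
      rw [← map_add, ← smul_sub]
      nth_rewrite 2 [← hH]
      rw [← map_sub, ← map_smul]
      congr 1
      have : z ^ 2 • x + (z • J b + a) - a = z • (z • x + J b) := by module
      rw [this, smul_smul, inv_mul_cancel₀ hz0, one_smul]
    have e5 : res D z (H z v) = z⁻¹ • res D z (J e) + (z⁻¹ • H z a - H z (J e)) := by
      have : res D z (H z v) = res D z x - (H z (z • x) + H z (J b)) - H z (J e) := by
        rw [e2, map_add]; abel
      rw [this, e4, e3]; abel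
    rw [e5, smul_add, smul_sub]
  obtain ⟨i1, v1⟩ := h.contour.integral_inv_smul_res h.sectorial h.inv h.nonneg h.lt_angle
    h.lt_pi.le (h.angle_lt.trans h.lt_pi) (J e)
  obtain ⟨i2, v2⟩ := h.integral_inv_smul_pencilInv a
  obtain ⟨i3, v3⟩ := h.integral_pencilInv (J e)
  rw [h.solution_apply]
  simp only [key]
  have hadd := integral_add i1 (i2.sub i3)
  simp only [Pi.sub_apply] at hadd
  rw [hadd, integral_sub i2 i3, v1, v2, v3, sub_zero, add_zero, smul_smul,
    inv_mul_cancel₀ two_pi_I_ne_zero, one_smul, hxe]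

/-- Integrals `∫ z⁻¹ G(z) D R(z, D) x dz` with a bounded holomorphic family `G` converge for
elements of the interpolation spaces. -/
lemma integrable_family (h : SumSetting A B D J φ₁ φ₂ φ' γ H Q P C) {G : ℂ → X →L[ℂ] X}
    (hG : DifferentiableOn ℂ G (openSector φ₂)) {K : ℝ} (hK : ∀ z ∈ openSector φ₂, ‖G z‖ ≤ K)
    {x : X} {θ : ℝ} (hθ : 0 < θ) {c : ℝ} (hx : ∀ t, 0 < t → kFun D t x ≤ c * t ^ θ) :
    Integrable fun t => deriv γ t • (γ t)⁻¹ • G (γ t) (resN D (γ t) x) := by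
  obtain ⟨R, hR0, hR⟩ := h.exists_res_bound
  have hK0 : 0 ≤ K := (norm_nonneg _).trans (hK _ (h.contour.mem_sector 0))
  refine h.contour.integrable_of_rpow (C := K * ((R + 1) * c)) ?_ hθ fun t => ?_
  · exact (h.contour.continuous.inv₀ h.contour.ne_zero).smul
      ((hG.continuousOn.comp_continuous h.contour.continuous h.contour.mem_sector).clm_apply
        (h.continuous_resN.clm_apply continuous_const))
  · have hz0 : 0 < ‖γ t‖ := norm_pos_iff.2 (h.contour.ne_zero t)
    rw [norm_smul, norm_inv]
    calc ‖γ t‖⁻¹ * ‖G (γ t) (resN D (γ t) x)‖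
        ≤ ‖γ t‖⁻¹ * (K * ((R + 1) * (c * ‖γ t‖⁻¹ ^ θ))) := by
          gcongr
          refine ((G (γ t)).le_of_opNorm_le (hK _ (h.contour.mem_sector t)) _).trans ?_
          gcongr
          refine (norm_resN_le_kFun h.inv (h.mem_resSet t) (h.contour.ne_zero t) hR0 (hR t) x).trans
            ?_
          gcongr
          exact hx _ (inv_pos.2 hz0)
      _ = K * ((R + 1) * c) * ‖γ t‖ ^ (-(1 + θ)) := by
          rw [neg_add, Real.rpow_add hz0, Real.rpow_neg_one, Real.inv_rpow hz0.le,
            Real.rpow_neg hz0.le]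
          ring

/-- The key estimate for integrals `∫ z⁻¹ G(z) D R(z, D) x dz`. -/
lemma kDominated_family (h : SumSetting A B D J φ₁ φ₂ φ' γ H Q P C) {G : ℂ → X →L[ℂ] X}
    (hG : DifferentiableOn ℂ G (openSector φ₂)) {K : ℝ} (hK : ∀ z ∈ openSector φ₂, ‖G z‖ ≤ K)
    (hGJ : ∀ z ∈ openSector φ₂, Commute (G z) J) {x : X} {θ : ℝ} (hθ : 0 < θ) {c : ℝ}
    (hx : ∀ t, 0 < t → kFun D t x ≤ c * t ^ θ) (α : ℂ) :
    KDominated D x (α • ∫ t, deriv γ t • (γ t)⁻¹ • G (γ t) (resN D (γ t) x)) := by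
  obtain ⟨R, hR0, hR⟩ := h.exists_res_bound
  obtain ⟨M, hM0, hM⟩ := h.contour.exists_deriv_bound
  -- The bound `m ≤ 1` gives `m (|u| + s) ≤ m |u| + s` and makes `max 1 m⁻¹` equal to `m⁻¹`.
  obtain ⟨m, hm0, hm1, hm⟩ : ∃ m, 0 < m ∧ m ≤ 1 ∧ ∀ t, m * |t| ≤ ‖γ t‖ := by
    obtain ⟨m, hm0, hm⟩ := h.contour.exists_norm_ge
    refine ⟨min m 1, lt_min hm0 one_pos, min_le_right _ _, fun t => le_trans ?_ (hm t)⟩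
    gcongr
    · exact min_le_left _ _
    · linarith
  have hK0 : 0 ≤ K := (norm_nonneg _).trans (hK _ (h.contour.mem_sector 0))
  have hint := h.integrable_family hG hK hθ hx
  set κ := √((1 + Real.cos φ₂) / 2) with hκ
  have hκ0 : 0 < κ := sqrt_one_add_cos_pos h.nonneg₂ h.lt_pi
  have hadd : ∀ z ∈ openSector φ₂, ∀ s, 0 < s → κ * (‖z‖ + s) ≤ ‖z + (s : ℝ)‖ := fun z hz s hs =>
    norm_add_pos_ge h.nonneg₂ h.lt_pi (openSector_subset_sector _ hz).1 hs.le
  set L : ℝ := M * (κ⁻¹ * m⁻¹ * (K * ((R + 1) * m⁻¹))) with hL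
  have hL0 : 0 ≤ L := by positivity
  refine ⟨(2 + ‖J‖) * ‖α‖ * (L * 2), by positivity, fun t ht => ?_⟩
  set s : ℝ := t⁻¹ with hs
  have hs0 : 0 < s := inv_pos.2 ht
  have hz₀ := h.neg_mem_resSet hs0
  set N₀ := resN D (-(s : ℂ)) with hN₀
  have hne : ∀ z ∈ openSector φ₂, z + (s : ℂ) ≠ 0 := by
    intro z hz
    have h1 := hadd z hz s hs0
    have h2 : 0 < κ * (‖z‖ + s) := by positivity
    exact norm_pos_iff.1 (h2.trans_le h1)
  -- the part of the integral that vanishes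
  obtain ⟨i1, v1⟩ := h.contour.integral_eq_zero
    (f := fun z => (z⁻¹ * (z + s)⁻¹) • G z (-(s : ℂ) • N₀ x))
    (C := κ⁻¹ * (K * ‖-(s : ℂ) • N₀ x‖)) h.nonneg₂ h.lt_pi.le
    (((differentiableOn_inv.mono fun z hz => hz.1).mul
      ((differentiableOn_id.add (differentiableOn_const _)).inv hne)).smul
      (hG.clm_apply (differentiableOn_const _)))
    (by
      intro z hz
      have hz0 : 0 < ‖z‖ := norm_pos_iff.2 hz.1
      rw [norm_smul, norm_mul, norm_inv, norm_inv]
      have h1 : ‖z + s‖⁻¹ ≤ κ⁻¹ * ‖z‖⁻¹ := by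
        rw [← mul_inv]
        refine inv_anti₀ (by positivity) (le_trans ?_ (hadd z hz s hs0))
        gcongr
        linarith
      calc ‖z‖⁻¹ * ‖z + s‖⁻¹ * ‖G z (-(s : ℂ) • N₀ x)‖
          ≤ ‖z‖⁻¹ * (κ⁻¹ * ‖z‖⁻¹) * (K * ‖-(s : ℂ) • N₀ x‖) := by
            gcongr
            exact (G z).le_of_opNorm_le (hK z hz) _
        _ = _ := by ring)
  -- By the resolvent identity `(z + s) N(-s) N(z) = -s N(-s) - z N(z)`. In the first part the
  -- vector no longer depends on `z`, so the integrand is holomorphic in the entire sector.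
  have hsplit : ∀ u, N₀ (deriv γ u • (γ u)⁻¹ • G (γ u) (resN D (γ u) x)) =
      deriv γ u • (((γ u)⁻¹ * (γ u + s)⁻¹) • G (γ u) (-(s : ℂ) • N₀ x)) -
        deriv γ u • (γ u + s)⁻¹ • G (γ u) (resN D (γ u) x) := by
    intro u
    have hz := h.contour.mem_sector u
    have hz0 := h.contour.ne_zero u
    have h1 : N₀ (G (γ u) (resN D (γ u) x)) = G (γ u) (N₀ (resN D (γ u) x)) :=
      (DFunLike.congr_fun (commute_resN h.inv hz₀ (hGJ _ hz)).eq _).symm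
    have h2 := DFunLike.congr_fun (sub_smul_resN_mul_resN h.inv hz₀ (h.mem_resSet u)) x
    change (γ u - -(s : ℂ)) • N₀ (resN D (γ u) x) = -(s : ℂ) • N₀ x - γ u • resN D (γ u) x at h2
    rw [sub_neg_eq_add] at h2
    have h3 : N₀ (resN D (γ u) x) =
        (γ u + s)⁻¹ • (-(s : ℂ) • N₀ x - γ u • resN D (γ u) x) := by
      rw [← h2, smul_smul, inv_mul_cancel₀ (hne _ hz), one_smul]
    rw [map_smul, map_smul, h1, h3, map_smul, map_sub, map_smul _ (γ u), ← smul_sub]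
    congr 1
    rw [smul_sub, smul_sub, smul_smul, smul_smul, smul_smul]
    congr 2
    rw [mul_right_comm, inv_mul_cancel₀ hz0, one_mul]
  have hN₀i : Integrable fun u => N₀ (deriv γ u • (γ u)⁻¹ • G (γ u) (resN D (γ u) x)) :=
    N₀.integrable_comp hint
  have i2 : Integrable fun u => deriv γ u • (γ u + s)⁻¹ • G (γ u) (resN D (γ u) x) := by
    refine (i1.sub hN₀i).congr (Eventually.of_forall fun u => ?_)
    simp only [Pi.sub_apply, hsplit u]
    abel
  have hval : N₀ (∫ u, deriv γ u • (γ u)⁻¹ • G (γ u) (resN D (γ u) x)) =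
      -∫ u, deriv γ u • (γ u + s)⁻¹ • G (γ u) (resN D (γ u) x) := by
    rw [← ContinuousLinearMap.integral_comp_comm _ hint]
    simp only [hsplit]
    rw [integral_sub i1 i2, v1, zero_sub]
  -- Both `‖γ u + s‖` and `K(1/‖γ u‖, x)` are compared with their values for `|u|` in place of `‖γ
  -- u‖`.
  have hpt : ∀ᵐ u : ℝ, ‖deriv γ u • (γ u + s)⁻¹ • G (γ u) (resN D (γ u) x)‖ₑ ≤
      ENNReal.ofReal L * ENNReal.ofReal (kFun D |u|⁻¹ x / (|u| + s)) := by
    have h0 : ∀ᵐ u : ℝ, u ≠ 0 := by simp [ae_iff, measure_singleton]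
    filter_upwards [h0] with u hu
    have hu0 : 0 < |u| := abs_pos.2 hu
    have hz := h.contour.mem_sector u
    have hz0 : 0 < ‖γ u‖ := norm_pos_iff.2 (h.contour.ne_zero u)
    have hk0 := kFun_nonneg D (inv_pos.2 hu0) x
    rw [← ENNReal.ofReal_mul hL0, ← ofReal_norm]
    refine ENNReal.ofReal_le_ofReal ?_
    rw [norm_smul, norm_smul, norm_inv]
    have h1 : ‖γ u + s‖⁻¹ ≤ κ⁻¹ * m⁻¹ * (|u| + s)⁻¹ := by
      rw [← mul_inv, ← mul_inv]
      refine inv_anti₀ (by positivity) (le_trans ?_ (hadd _ hz s hs0))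
      rw [mul_assoc, mul_add]
      gcongr
      · exact hm u
      · exact mul_le_of_le_one_left hs0.le hm1
    have h2 : kFun D ‖γ u‖⁻¹ x ≤ m⁻¹ * kFun D |u|⁻¹ x := by
      have h3 : ‖γ u‖⁻¹ ≤ m⁻¹ * |u|⁻¹ := by
        rw [← mul_inv]; exact inv_anti₀ (by positivity) (hm u)
      have h4 := kFun_mul_le (D := D) (inv_pos.2 hu0) (inv_pos.2 hm0) x
      rw [max_eq_right ((one_le_inv₀ hm0).2 hm1)] at h4
      exact (kFun_mono D x (inv_pos.2 hz0)
        (show (0 : ℝ) < m⁻¹ * |u|⁻¹ by positivity) h3).trans h4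
    calc ‖deriv γ u‖ * (‖γ u + s‖⁻¹ * ‖G (γ u) (resN D (γ u) x)‖)
        ≤ M * ((κ⁻¹ * m⁻¹ * (|u| + s)⁻¹) * (K * ((R + 1) * (m⁻¹ * kFun D |u|⁻¹ x)))) := by
          gcongr
          · exact hM u
          · refine ((G (γ u)).le_of_opNorm_le (hK _ hz) _).trans ?_
            gcongr
            refine (norm_resN_le_kFun h.inv (h.mem_resSet u) (h.contour.ne_zero u) hR0
              (hR u) x).trans ?_
            gcongr
      _ = L * (kFun D |u|⁻¹ x / (|u| + s)) := by rw [hL]; ring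
  -- The substitution `u = 1/τ`; the two half-lines give the factor `2`.
  have hInt : ∫⁻ u : ℝ, ENNReal.ofReal (kFun D |u|⁻¹ x / (|u| + s)) =
      2 * ∫⁻ τ in Ioi 0, ENNReal.ofReal (kFun D τ x * (t / (t + τ) * τ⁻¹)) := by
    rw [lintegral_comp_abs_eq fun u => ENNReal.ofReal (kFun D u⁻¹ x / (u + s)),
      lintegral_Ioi_comp_inv]
    congr 1
    refine setLIntegral_congr_fun measurableSet_Ioi fun τ hτ => ?_
    have hτ0 : (0 : ℝ) < τ := hτ
    rw [← ENNReal.ofReal_mul (by positivity), inv_inv, hs]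
    congr 1
    field_simp
  have hmain : ENNReal.ofReal ‖N₀ (∫ u, deriv γ u • (γ u)⁻¹ • G (γ u) (resN D (γ u) x))‖ ≤
      ENNReal.ofReal (L * 2) *
        ∫⁻ τ in Ioi 0, ENNReal.ofReal (kFun D τ x * (t / (t + τ) * τ⁻¹)) := by
    rw [hval, norm_neg, ofReal_norm]
    refine (enorm_integral_le_lintegral_enorm _).trans ((lintegral_mono_ae hpt).trans_eq ?_)
    rw [lintegral_const_mul' _ _ ENNReal.ofReal_ne_top, hInt, ENNReal.ofReal_mul hL0, mul_assoc]
    simp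
  refine (ENNReal.ofReal_le_ofReal (kFun_le_norm_resN h.inv ht hz₀ _)).trans ?_
  rw [map_smul, norm_smul, ← mul_assoc, ENNReal.ofReal_mul (by positivity),
    ENNReal.ofReal_mul (by positivity) (q := L * 2), mul_assoc]
  gcongr

end SumSetting

end SumSetting

/-! ### The right inverse on interpolation spaces -/

section RightInverse

lemma smul_mem_graph {X : Type*} [NormedAddCommGroup X] [NormedSpace ℂ X] {T : X →ₗ.[ℂ] X} (c : ℂ)
    {x y : X} (h : (x, y) ∈ T.graph) : (c • x, c • y) ∈ T.graph := T.graph.smul_mem c h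

namespace SumSetting

variable {X : Type*} [NormedAddCommGroup X] [NormedSpace ℂ X] [CompleteSpace X]
  {A B D : X →ₗ.[ℂ] X} {J : X →L[ℂ] X} {φ₁ φ₂ φ' : ℝ} {γ : ℝ → ℂ} {H Q P : ℂ → X →L[ℂ] X} {C : ℝ}

lemma sector_mem_nhds (h : SumSetting A B D J φ₁ φ₂ φ' γ H Q P C) {z : ℂ}
    (hz : z ∈ openSector φ₂) : sector φ₂ \ {0} ∈ 𝓝 z :=
  mem_of_superset (h.isOpen.mem_nhds hz) (openSector_subset_sector _)

lemma differentiableAt_pencilInv (h : SumSetting A B D J φ₁ φ₂ φ' γ H Q P C) {z : ℂ}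
    (hz : z ∈ openSector φ₂) : DifferentiableAt ℂ H z :=
  h.holo.differentiableAt (h.isOpen.mem_nhds hz)

lemma differentiableOn_sq_smul (h : SumSetting A B D J φ₁ φ₂ φ' γ H Q P C) :
    DifferentiableOn ℂ (fun z => z ^ 2 • H z) (openSector φ₂) :=
  (differentiableOn_pow 2).smul h.holo

lemma differentiableOn_smul (h : SumSetting A B D J φ₁ φ₂ φ' γ H Q P C) :
    DifferentiableOn ℂ (fun z => z • Q z) (openSector φ₂) := fun _ hz =>
  (differentiableAt_id.smul
    (h.pencil.differentiableAt_right (h.sector_mem_nhds hz))).differentiableWithinAt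

lemma differentiableOn_left (h : SumSetting A B D J φ₁ φ₂ φ' γ H Q P C) :
    DifferentiableOn ℂ P (openSector φ₂) := fun _ hz =>
  (h.pencil.differentiableAt_left (h.sector_mem_nhds hz)
    (h.differentiableAt_pencilInv hz)).differentiableWithinAt

/-- The three terms of `(D² + B D + A) S x = x` for `x` in an interpolation space. -/
lemma exists_right_inv (h : SumSetting A B D J φ₁ φ₂ φ' γ H Q P C) {x : X} {θ : ℝ} (hθ : 0 < θ)
    {c : ℝ} (hx : ∀ t, 0 < t → kFun D t x ≤ c * t ^ θ) :
    ∃ d e b a, (solution D γ H x, d) ∈ D.graph ∧ (d, e) ∈ D.graph ∧ (d, b) ∈ B.graph ∧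
      (solution D γ H x, a) ∈ A.graph ∧ e + b + a = x ∧
      KDominated D x e ∧ KDominated D x b ∧ KDominated D x a := by
  set α : ℂ := (2 * Real.pi * Complex.I : ℂ)⁻¹ with hα
  have hD : D.IsClosed := h.inv.isClosed
  have hN : ∀ t y, (res D (γ t) y, resN D (γ t) y) ∈ D.graph := fun t y => by
    rw [h.inv.mem_graph_iff]
    exact (DFunLike.congr_fun (mul_resN h.inv (h.mem_resSet t)) y).symm
  have hzs : ∀ t, γ t ∈ sector φ₂ \ {0} := fun t =>
    openSector_subset_sector _ (h.contour.mem_sector t)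
  obtain ⟨iH, vH⟩ := h.integral_pencilInv x
  obtain ⟨iH', vH'⟩ := h.integral_inv_smul_pencilInv x
  have iR := h.integrable_apply x
  have iR' := h.integrable_smul_res_mul_pencilInv x
  have i1 := h.integrable_family h.differentiableOn_sq_smul h.norm_sq_le hθ hx
  have i2 := h.integrable_family h.differentiableOn_smul h.norm_right_le hθ hx
  have i3 := h.integrable_family h.differentiableOn_left h.norm_left_le hθ hx
  have k1 := h.kDominated_family h.differentiableOn_sq_smul h.norm_sq_le
    (fun z hz => (h.commute_pencil hz).1.smul_left (z ^ 2)) hθ hx α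
  have k2 := h.kDominated_family h.differentiableOn_smul h.norm_right_le
    (fun z hz => (h.commute_pencil hz).2.1.smul_left z) hθ hx α
  have k3 := h.kDominated_family h.differentiableOn_left h.norm_left_le
    (fun z hz => (h.commute_pencil hz).2.2) hθ hx α
  -- `z⁻¹ H(z) D R(z) x` and `H(z) D R(z) x`
  have p1 : ∀ t, deriv γ t • (γ t)⁻¹ • H (γ t) (resN D (γ t) x) =
      deriv γ t • res D (γ t) (H (γ t) x) - deriv γ t • (γ t)⁻¹ • H (γ t) x := by
    intro t
    rw [h.pencilInv_resN]
    change deriv γ t • (γ t)⁻¹ • (γ t • res D (γ t) (H (γ t) x) - H (γ t) x) = _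
    rw [smul_sub, smul_smul, inv_mul_cancel₀ (h.contour.ne_zero t), one_smul, smul_sub]
  have p2 : ∀ t, deriv γ t • H (γ t) (resN D (γ t) x) =
      deriv γ t • γ t • res D (γ t) (H (γ t) x) - deriv γ t • H (γ t) x := by
    intro t
    rw [h.pencilInv_resN]
    change deriv γ t • (γ t • res D (γ t) (H (γ t) x) - H (γ t) x) = _
    rw [smul_sub]
  have j1 : Integrable fun t => deriv γ t • (γ t)⁻¹ • H (γ t) (resN D (γ t) x) :=
    (iR.sub iH').congr (Eventually.of_forall fun t => (p1 t).symm)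
  have j2 : Integrable fun t => deriv γ t • H (γ t) (resN D (γ t) x) :=
    (iR'.sub iH).congr (Eventually.of_forall fun t => (p2 t).symm)
  -- `S x` and, in `s2`, `D S x` are each written in two ways, differing by integrals of `z⁻¹ H(z)
  -- x` and `H(z) x`, which vanish. Closedness applies to an operator only in a form whose image
  -- integrand is integrable: `A` needs `z⁻¹ H N x`, `B` needs `H N x`, and the second `D` is
  -- applied to `z R H x`.
  have s1 : solution D γ H x = α • ∫ t, deriv γ t • (γ t)⁻¹ • H (γ t) (resN D (γ t) x) := by
    simp only [p1]
    rw [integral_sub iR iH', vH', sub_zero, h.solution_apply]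
  have s2 : ∫ t, deriv γ t • H (γ t) (resN D (γ t) x) =
      ∫ t, deriv γ t • γ t • res D (γ t) (H (γ t) x) := by
    simp only [p2]
    rw [integral_sub iR' iH, vH, sub_zero]
  refine ⟨α • ∫ t, deriv γ t • H (γ t) (resN D (γ t) x), _, _, _, ?_, ?_, ?_, ?_, ?_, k1, k2, k3⟩
  · rw [h.solution_apply]
    refine smul_mem_graph α (integral_mem_graph hD iR j2 fun t => ?_)
    rw [h.pencilInv_resN]
    exact smul_mem_graph _ (hN t _)
  · rw [s2]
    refine smul_mem_graph α (integral_mem_graph hD iR' i1 fun t => ?_)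
    refine smul_mem_graph _ ?_
    have : (γ t)⁻¹ • (γ t ^ 2 • H (γ t)) (resN D (γ t) x) = γ t • resN D (γ t) (H (γ t) x) := by
      change (γ t)⁻¹ • γ t ^ 2 • H (γ t) (resN D (γ t) x) = _
      rw [smul_smul, h.pencilInv_resN, sq, ← mul_assoc, inv_mul_cancel₀ (h.contour.ne_zero t),
        one_mul]
    rw [this]
    exact smul_mem_graph _ (hN t _)
  · refine smul_mem_graph α (integral_mem_graph h.closedB j2 i2 fun t => ?_)
    refine smul_mem_graph _ ?_
    have : (γ t)⁻¹ • (γ t • Q (γ t)) (resN D (γ t) x) = Q (γ t) (resN D (γ t) x) := by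
      change (γ t)⁻¹ • γ t • Q (γ t) (resN D (γ t) x) = _
      rw [smul_smul, inv_mul_cancel₀ (h.contour.ne_zero t), one_smul]
    rw [this]
    exact h.pencil.graphB _ (hzs t) _
  · rw [s1]
    refine smul_mem_graph α (integral_mem_graph h.closedA j1 i3 fun t => ?_)
    exact smul_mem_graph _ (smul_mem_graph _ (h.pencil.graphA _ (hzs t) _))
  · rw [← smul_add, ← smul_add, ← integral_add i1 i2]
    have hadd := integral_add (i1.add i2) i3
    simp only [Pi.add_apply] at hadd
    rw [← hadd]
    have i4 := h.integrable_family (G := fun _ => 1) (differentiableOn_const _) (K := ‖(1 : X →L[ℂ] X)‖)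
      (fun _ _ => le_rfl) hθ hx
    have hsum : ∀ t, deriv γ t • (γ t)⁻¹ • (γ t ^ 2 • H (γ t)) (resN D (γ t) x) +
        deriv γ t • (γ t)⁻¹ • (γ t • Q (γ t)) (resN D (γ t) x) +
        deriv γ t • (γ t)⁻¹ • P (γ t) (resN D (γ t) x) =
        deriv γ t • (γ t)⁻¹ • (1 : X →L[ℂ] X) (resN D (γ t) x) := by
      intro t
      rw [← smul_add, ← smul_add, ← smul_add, ← smul_add, add_assoc]
      exact congrArg (fun y => deriv γ t • (γ t)⁻¹ • y) (h.pencil.right_inv (hzs t) _)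
    simp only [hsum]
    -- Applying `J` turns `N` into `R`, so that the residue formula becomes applicable.
    refine h.inv.injective ?_
    rw [map_smul, ← ContinuousLinearMap.integral_comp_comm _ i4]
    have hJ : ∀ t, J (deriv γ t • (γ t)⁻¹ • (1 : X →L[ℂ] X) (resN D (γ t) x)) =
        deriv γ t • (γ t)⁻¹ • res D (γ t) x := by
      intro t
      rw [map_smul, map_smul, ← mul_resN h.inv (h.mem_resSet t)]
      rfl
    simp only [hJ]
    rw [(h.contour.integral_inv_smul_res h.sectorial h.inv h.nonneg h.lt_angle h.lt_pi.le
      (h.angle_lt.trans h.lt_pi) x).2, smul_smul, inv_mul_cancel₀ two_pi_I_ne_zero, one_smul]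

end SumSetting

end RightInverse

/-! ### Operators on embedded spaces -/

section Parts

variable {X : Type*} [NormedAddCommGroup X] [NormedSpace ℂ X]
  {F : Type*} [NormedAddCommGroup F] [NormedSpace ℂ F] {ι : F →ₗ[ℂ] X}
  {hι : Function.Injective ι}

lemma mem_graph_partIn {T : X →ₗ.[ℂ] X} {u v : F} :
    (u, v) ∈ (partIn ι hι T).graph ↔ (ι u, ι v) ∈ T.graph := by
  rw [mem_graph_iff_exists, mem_graph_iff_exists]
  constructor
  · rintro ⟨h, rfl⟩
    exact ⟨h.1, (partIn_apply ι hι T ⟨u, h⟩).symm⟩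
  · rintro ⟨h, hv⟩
    have hd : u ∈ (partIn ι hι T).domain := ⟨h, by rw [hv]; exact ⟨v, rfl⟩⟩
    exact ⟨hd, hι ((partIn_apply ι hι T ⟨u, hd⟩).trans hv)⟩

lemma mem_graph_sumOpIn {A B D : X →ₗ.[ℂ] X} {u v : F} :
    (u, v) ∈ (sumOpIn ι hι A B D).graph ↔
      ∃ e b a : F, (ι u, ι e) ∈ (natComp D D).graph ∧ (ι u, ι b) ∈ (natComp B D).graph ∧
        (ι u, ι a) ∈ A.graph ∧ e + b + a = v := by
  simp only [sumOpIn, mem_graph_add, mem_graph_partIn]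
  constructor
  · rintro ⟨_, a, ⟨e, b, he, hb, rfl⟩, ha, rfl⟩
    exact ⟨e, b, a, he, hb, ha, rfl⟩
  · rintro ⟨e, b, a, he, hb, ha, rfl⟩
    exact ⟨_, a, ⟨e, b, he, hb, rfl⟩, ha, rfl⟩

/-- A left inverse in the large space remains one in the embedded space. For the right inverse each
of the three terms must lie in `F` separately, as the domain of the operator there demands. -/
lemma isBoundedInverse_sumOpIn {A B D : X →ₗ.[ℂ] X} {S : X →L[ℂ] X}
    (hS : ∀ x v, (x, v) ∈ (sumOp A B D).graph → S v = x) {T : F →L[ℂ] F}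
    (hT : ∀ u, ι (T u) = S (ι u))
    (hR : ∀ u : F, ∃ (d : X) (e b a : F), (S (ι u), d) ∈ D.graph ∧ (d, ι e) ∈ D.graph ∧
      (d, ι b) ∈ B.graph ∧ (S (ι u), ι a) ∈ A.graph ∧ ι e + ι b + ι a = ι u) :
    IsBoundedInverse (sumOpIn ι hι A B D) T := by
  refine isBoundedInverse_of_mem_graph_iff fun u v => ?_
  constructor
  · intro h
    obtain ⟨e, b, a, he, hb, ha, rfl⟩ := mem_graph_sumOpIn.1 h
    refine hι ?_
    rw [hT]
    refine (hS _ _ ?_).symm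
    rw [map_add, map_add]
    exact mem_graph_add.2 ⟨_, _, mem_graph_add.2 ⟨_, _, he, hb, rfl⟩, ha, rfl⟩
  · rintro rfl
    obtain ⟨d, e, b, a, hd, he, hb, ha, hsum⟩ := hR v
    refine mem_graph_sumOpIn.2 ⟨e, b, a, ?_, ?_, ?_, hι (by rw [map_add, map_add]; exact hsum)⟩
    · rw [hT]; exact mem_graph_natComp.2 ⟨d, hd, he⟩
    · rw [hT]; exact mem_graph_natComp.2 ⟨d, hd, hb⟩
    · rw [hT]; exact ha

end Parts

/-! ### Restriction of commuting operators to the interpolation spaces -/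

section InterpolationSpaces

variable {X : Type*} [NormedAddCommGroup X] [NormedSpace ℂ X] {D : X →ₗ.[ℂ] X} {J S : X →L[ℂ] X}

lemma kWeighted_apply_le (hJ : IsBoundedInverse D J) (hS : Commute S J) (θ : ℝ) (x : X) {t : ℝ}
    (ht : 0 < t) : kWeighted D θ (S x) t ≤ ‖S‖ * kWeighted D θ x t := by
  rw [kWeighted, kWeighted, mul_left_comm]
  exact mul_le_mul_of_nonneg_left (kFun_apply_le hJ hS ht x) (Real.rpow_nonneg ht.le _)

lemma kWeighted_nonneg (D : X →ₗ.[ℂ] X) (θ : ℝ) (x : X) {t : ℝ} (ht : 0 < t) :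
    0 ≤ kWeighted D θ x t :=
  mul_nonneg (Real.rpow_nonneg ht.le _) (kFun_nonneg D ht x)

lemma norm_kWeighted_apply_le (hJ : IsBoundedInverse D J) (hS : Commute S J) (θ : ℝ) (x : X) :
    ∀ᵐ t ∂haarPos, ‖kWeighted D θ (S x) t‖ ≤ ‖(‖S‖ • kWeighted D θ x) t‖ := by
  filter_upwards [ae_haarPos_pos] with t ht
  have h0 := kWeighted_nonneg D θ x ht
  rw [Real.norm_of_nonneg (kWeighted_nonneg D θ (S x) ht), Pi.smul_apply, smul_eq_mul,
    Real.norm_of_nonneg (by positivity)]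
  exact kWeighted_apply_le hJ hS θ x ht

lemma interpSubmodule_mem (hJ : IsBoundedInverse D J) (hS : Commute S J) {θ : ℝ} {p : ℝ≥0∞} {x : X}
    (hx : x ∈ interpSubmodule D θ p) : S x ∈ interpSubmodule D θ p :=
  (MemLp.const_smul hx ‖S‖).mono (kWeighted_aesm D θ (S x)) (norm_kWeighted_apply_le hJ hS θ x)

/-- A bounded operator commuting with `D` acts on the interpolation spaces. -/
lemma exists_interp_restrict (hJ : IsBoundedInverse D J) (hS : Commute S J) (θ : ℝ) (p : ℝ≥0∞)
    [Fact (1 ≤ p)] : ∃ T : InterpSpace D θ p →L[ℂ] InterpSpace D θ p,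
      ∀ u, InterpSpace.incl D θ p (T u) = S (InterpSpace.incl D θ p u) := by
  let L : InterpSpace D θ p →ₗ[ℂ] InterpSpace D θ p :=
    { toFun := fun u => ⟨S (InterpSpace.incl D θ p u), interpSubmodule_mem hJ hS u.2⟩
      map_add' := fun u v => InterpSpace.incl_injective D θ p (by
        change S (InterpSpace.incl D θ p (u + v)) =
          S (InterpSpace.incl D θ p u) + S (InterpSpace.incl D θ p v)
        rw [map_add, map_add])
      map_smul' := fun c u => InterpSpace.incl_injective D θ p (by
        change S (InterpSpace.incl D θ p (c • u)) = c • S (InterpSpace.incl D θ p u)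
        rw [map_smul, map_smul]) }
  have hL : ∀ u, ‖L u‖ ≤ ‖S‖ * ‖u‖ := by
    intro u
    change interpNorm D θ p (L u) ≤ ‖S‖ * interpNorm D θ p u
    have h := eLpNorm_mono_ae (p := p)
      (norm_kWeighted_apply_le hJ hS θ (InterpSpace.incl D θ p u))
    rw [eLpNorm_const_smul] at h
    have h' := ENNReal.toReal_mono
      (ENNReal.mul_ne_top (by simp) (InterpSpace.memLp D u).eLpNorm_ne_top) h
    rw [ENNReal.toReal_mul, toReal_enorm, norm_norm] at h'
    exact h'
  exact ⟨L.mkContinuous ‖S‖ hL, fun u => rfl⟩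

lemma exists_little_restrict (hJ : IsBoundedInverse D J) (hS : Commute S J) (θ : ℝ) :
    ∃ T : littleInterp D θ →L[ℂ] littleInterp D θ,
      ∀ u, littleInterp.incl D θ (T u) = S (littleInterp.incl D θ u) := by
  obtain ⟨T, hT⟩ := exists_interp_restrict hJ hS θ ∞
  have hmem : ∀ u : littleInterp D θ, T u ∈ littleInterp D θ := by
    intro u
    change Tendsto (kWeighted D θ (InterpSpace.incl D θ ∞ (T u))) (𝓝[>] 0) (𝓝 0)
    rw [hT]
    have hu : Tendsto (kWeighted D θ (InterpSpace.incl D θ ∞ u)) (𝓝[>] 0) (𝓝 0) := u.2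
    refine squeeze_zero' ?_ ?_ (by simpa using hu.const_mul ‖S‖)
    · filter_upwards [self_mem_nhdsWithin] with t ht using kWeighted_nonneg D θ _ ht
    · filter_upwards [self_mem_nhdsWithin] with t ht using kWeighted_apply_le hJ hS θ _ ht
  exact ⟨(T.comp (littleInterp D θ).subtypeL).codRestrict _ hmem, fun u => hT u⟩

end InterpolationSpaces

/-! ### The bounded inverses on the interpolation spaces -/

namespace SumSetting

variable {X : Type*} [NormedAddCommGroup X] [NormedSpace ℂ X] [CompleteSpace X]
  {A B D : X →ₗ.[ℂ] X} {J : X →L[ℂ] X} {φ₁ φ₂ φ' : ℝ} {γ : ℝ → ℂ} {H Q P : ℂ → X →L[ℂ] X} {C : ℝ}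

lemma exists_interp_inverse (h : SumSetting A B D J φ₁ φ₂ φ' γ H Q P C) {θ : ℝ}
    (hθ : θ ∈ Ioo (0 : ℝ) 1) (p : ℝ≥0∞) [hp : Fact (1 ≤ p)] :
    ∃ T : InterpSpace D θ p →L[ℂ] InterpSpace D θ p,
      (∀ u, InterpSpace.incl D θ p (T u) = solution D γ H (InterpSpace.incl D θ p u)) ∧
        IsBoundedInverse (interpOp A B D θ p) T := by
  obtain ⟨T, hT⟩ := exists_interp_restrict h.inv h.commute_solution θ p
  refine ⟨T, hT, isBoundedInverse_sumOpIn (fun x v => h.solution_left_inv) hT fun u => ?_⟩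
  have hu : MemLp (kWeighted D θ (InterpSpace.incl D θ p u)) p haarPos := u.2
  obtain ⟨c, -, hc⟩ := exists_kFun_le_rpow hθ.1 hp.out hu
  obtain ⟨d, e, b, a, hd, he, hb, ha, hs, k1, k2, k3⟩ := h.exists_right_inv hθ.1 hc
  exact ⟨d, ⟨e, k1.memLp hθ.1 hθ.2 hp.out hu⟩, ⟨b, k2.memLp hθ.1 hθ.2 hp.out hu⟩,
    ⟨a, k3.memLp hθ.1 hθ.2 hp.out hu⟩, hd, he, hb, ha, hs⟩

lemma exists_little_inverse (h : SumSetting A B D J φ₁ φ₂ φ' γ H Q P C) {θ : ℝ}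
    (hθ : θ ∈ Ioo (0 : ℝ) 1) :
    ∃ T : littleInterp D θ →L[ℂ] littleInterp D θ,
      (∀ u, littleInterp.incl D θ (T u) = solution D γ H (littleInterp.incl D θ u)) ∧
        IsBoundedInverse (littleOp A B D θ) T := by
  obtain ⟨T, hT⟩ := exists_little_restrict h.inv h.commute_solution θ
  refine ⟨T, hT, isBoundedInverse_sumOpIn (fun x v => h.solution_left_inv) hT fun u => ?_⟩
  have hp : (1 : ℝ≥0∞) ≤ ∞ := le_top
  have hu : MemLp (kWeighted D θ (littleInterp.incl D θ u)) ∞ haarPos := u.1.2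
  have hu' : Tendsto (kWeighted D θ (littleInterp.incl D θ u)) (𝓝[>] 0) (𝓝 0) := u.2
  obtain ⟨c, hc0, hc⟩ := exists_kFun_le_rpow hθ.1 hp hu
  obtain ⟨d, e, b, a, hd, he, hb, ha, hs, k1, k2, k3⟩ := h.exists_right_inv hθ.1 hc
  have hbd : ∀ t, 0 < t → kWeighted D θ (littleInterp.incl D θ u) t ≤ c := by
    intro t ht
    have h1 := mul_le_mul_of_nonneg_left (hc t ht) (Real.rpow_nonneg ht.le (-θ))
    rw [mul_left_comm, ← Real.rpow_add ht, neg_add_cancel, Real.rpow_zero, mul_one] at h1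
    exact h1
  -- The domination provides both requirements: membership in the space with `p = ∞`, and the limit
  -- at `0`.
  have key : ∀ {y}, KDominated D (littleInterp.incl D θ u) y →
      ∃ w : littleInterp D θ, littleInterp.incl D θ w = y := fun {y} k =>
    ⟨⟨⟨y, k.memLp hθ.1 hθ.2 hp hu⟩, k.tendsto hθ.1 hθ.2 hc0 hbd hu'⟩, rfl⟩
  obtain ⟨e, rfl⟩ := key k1
  obtain ⟨b, rfl⟩ := key k2
  obtain ⟨a, rfl⟩ := key k3
  exact ⟨d, e, b, a, hd, he, hb, ha, hs⟩

end SumSetting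

end OpSum

theorem theorem3p1 {X : Type*} [NormedAddCommGroup X] [NormedSpace ℂ X] [CompleteSpace X]
    (A B D : X →ₗ.[ℂ] X) (hA : A.IsClosed) (hB : B.IsClosed) (hD : D.IsClosed)
    (hAD : OpSum.CommutesWith A D) (hBD : OpSum.CommutesWith B D)
    (φ₁ φ₂ : ℝ) (hφ₁ : 0 < φ₁) (hφ₁₂ : φ₁ < φ₂) (hφ₂ : φ₂ < Real.pi)
    -- (a)
    (hDinv : OpSum.BoundedlyInvertible D) (hDsec : OpSum.IsSectorial D φ₁)
    -- (b)
    (hH : ∀ z ∈ OpSum.sector φ₂ \ {0}, OpSum.BoundedlyInvertible (OpSum.pencil A B z))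
    -- (c)
    (hHhol : DifferentiableOn ℂ (OpSum.pencilInv A B) (OpSum.openSector φ₂))
    (hHbdd : ∃ C : ℝ, ∀ z ∈ OpSum.sector φ₂ \ {0}, ‖OpSum.pencilInv A B z‖ ≤ C)
    -- (d)
    (hsq : ∃ C : ℝ, ∀ z ∈ OpSum.sector φ₂ \ {0}, ‖z ^ 2 • OpSum.pencilInv A B z‖ ≤ C)
    (hBH : OpSum.UnifBdd (OpSum.sector φ₂ \ {0}) (fun z => z) B (OpSum.pencilInv A B))
    (hAH : OpSum.UnifBdd (OpSum.sector φ₂ \ {0}) (fun _ => 1) A (OpSum.pencilInv A B)) :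
    -- `L_{θ,p}` is closed and boundedly invertible, and so is its analogue on `D_D(θ)`
    (∀ θ ∈ Ioo (0 : ℝ) 1,
      (∀ (p : ℝ≥0∞) [Fact (1 ≤ p)],
        (OpSum.interpOp A B D θ p).IsClosed ∧
          OpSum.BoundedlyInvertible (OpSum.interpOp A B D θ p)) ∧
      (OpSum.littleOp A B D θ).IsClosed ∧
        OpSum.BoundedlyInvertible (OpSum.littleOp A B D θ)) ∧
    -- the inverse is the contour integral
    ∀ φ' ∈ Ioo φ₁ φ₂, ∀ γ : ℝ → ℂ, OpSum.IsContour D φ₁ φ₂ φ' γ →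
      ∃ S : X →L[ℂ] X,
        -- `S` is given by the (absolutely convergent) contour integral
        (∀ x, Integrable (OpSum.contourIntegrand A B D γ x) ∧
          S x = (2 * Real.pi * Complex.I : ℂ)⁻¹ • ∫ t, OpSum.contourIntegrand A B D γ x t) ∧
        -- `S` is a left inverse of `D² + BD + A` in `X`
        (∀ x : (OpSum.sumOp A B D).domain, S (OpSum.sumOp A B D x) = x) ∧
        ∀ θ ∈ Ioo (0 : ℝ) 1,
          -- the restriction of `S` to `D_D(θ, p)` is the bounded inverse of `L_{θ,p}`
          (∀ (p : ℝ≥0∞) [Fact (1 ≤ p)],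
            ∃ T : OpSum.InterpSpace D θ p →L[ℂ] OpSum.InterpSpace D θ p,
              (∀ u, OpSum.InterpSpace.incl D θ p (T u) = S (OpSum.InterpSpace.incl D θ p u)) ∧
              OpSum.IsBoundedInverse (OpSum.interpOp A B D θ p) T) ∧
          -- the restriction of `S` to `D_D(θ)` is the bounded inverse of its analogue there
          ∃ T : OpSum.littleInterp D θ →L[ℂ] OpSum.littleInterp D θ,
            (∀ u, OpSum.littleInterp.incl D θ (T u) = S (OpSum.littleInterp.incl D θ u)) ∧
            OpSum.IsBoundedInverse (OpSum.littleOp A B D θ) T := by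
  obtain ⟨C₁, hC₁⟩ := hHbdd
  obtain ⟨C₂, hC₂⟩ := hsq
  obtain ⟨C₃, Q, -, hQ⟩ := hBH.exists_clm fun z hz => hz.2
  obtain ⟨C₄, P, -, hP⟩ := hAH.exists_clm fun _ _ => one_ne_zero
  have hJ := OpSum.isBoundedInverse_boundedInverse hDinv
  have setting : ∀ φ' ∈ Ioo φ₁ φ₂, ∀ γ : ℝ → ℂ, OpSum.IsContour D φ₁ φ₂ φ' γ →
      OpSum.SumSetting A B D (OpSum.boundedInverse D) φ₁ φ₂ φ' γ (OpSum.pencilInv A B) Q P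
        (max (max C₁ C₂) (max C₃ C₄)) := by
    intro φ' hφ' γ hγ
    have hsub := OpSum.openSector_subset_sector φ₂
    exact
      { closedA := hA
        closedB := hB
        inv := hJ
        commA := fun _ _ => hAD.mem_graph hJ
        commB := fun _ _ => hBD.mem_graph hJ
        sectorial := hDsec
        nonneg := hφ₁.le
        lt_angle := hφ'.1
        angle_lt := hφ'.2
        lt_pi := hφ₂
        contour := hγ
        pencil :=
          ⟨fun z hz => OpSum.isBoundedInverse_boundedInverse (hH z hz), fun z hz => (hQ z hz).1,
            fun z hz => (hP z hz).1⟩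
        holo := hHhol
        norm_sq_le := fun z hz =>
          (hC₂ z (hsub hz)).trans ((le_max_right _ _).trans (le_max_left _ _))
        norm_inv_le := fun z hz =>
          (hC₁ z (hsub hz)).trans ((le_max_left _ _).trans (le_max_left _ _))
        norm_right_le := fun z hz =>
          (hQ z (hsub hz)).2.trans ((le_max_left _ _).trans (le_max_right _ _))
        norm_left_le := fun z hz => by
          have h1 := (hP z (hsub hz)).2
          rw [one_smul] at h1
          exact h1.trans ((le_max_right _ _).trans (le_max_right _ _)) }
  refine ⟨fun θ hθ => ?_, fun φ' hφ' γ hγ => ?_⟩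
  -- No contour is given in this part; one exists for any angle strictly between `φ₁` and `φ₂`.
  · have hmid : (φ₁ + φ₂) / 2 ∈ Ioo φ₁ φ₂ := ⟨by linarith, by linarith⟩
    obtain ⟨γ, hγ⟩ := OpSum.exists_isContour hJ hφ₁.le hmid.1 hmid.2 hφ₂.le
    have h := setting _ hmid γ hγ
    refine ⟨fun p hp => ?_, ?_⟩
    · obtain ⟨T, -, hT⟩ := h.exists_interp_inverse hθ p
      exact ⟨hT.isClosed, T, hT⟩
    · obtain ⟨T, -, hT⟩ := h.exists_little_inverse hθ
      exact ⟨hT.isClosed, T, hT⟩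
  · have h := setting φ' hφ' γ hγ
    refine ⟨OpSum.SumSetting.solution D γ (OpSum.pencilInv A B),
      fun x => ⟨h.integrable_apply x, h.solution_apply x⟩,
      fun x => h.solution_left_inv ((OpSum.sumOp A B D).mem_graph x), fun θ hθ => ⟨fun p hp => ?_, ?_⟩⟩
    · exact h.exists_interp_inverse hθ p
    · exact h.exists_little_inverse hθ
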